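/- Let $\Sigma=\mathbb F_2$, let $\Sigma^*$ be the set of finite words over $\Sigma$ (the rooted binary tree), and for $x\in\mathbb F_2$ put $\overline x=1-x$. Let $a,b,c,d$ be the automorphisms of $\Sigma^*$ given by $$a(x\sigma)=\overline x\sigma,\quad b(0x\sigma)=0\overline x\sigma,\ b(1\sigma)=1c(\sigma),\quad c(0x\sigma)=0\overline x\sigma,\ c(1\sigma)=1d(\sigma),\quad d(0x\sigma)=0x\sigma,\ d(1\sigma)=1b(\sigma),$$ and let $\mathfrak G=\langle a,b,c,d\rangle$ be Grigorchuk's group (acting on the left). Let $\Delta$ be the augmentation ideal of the group algebra $\mathbb F_2[\mathfrak G]$ and $\mathfrak G_n=\{g\in\mathfrak G : g-1\in\Delta^n\}$, $n\ge1$, the dimension series of $\mathfrak G$ over $\mathbb F_2$. Put $x=[a,b]=aba^{-1}b^{-1}$, and let $K=\langle x\rangle^{\mathfrak G}$ and $T=\langle x^2\rangle^{\mathfrak G}$ be the normal closures of $x$ and $x^2$ in $\mathfrak G$. For $Q\le K$ let $Q_m=Q\times\dots\times Q$ ($2^m$ factors), acting on the $2^m$ subtrees $\sigma\Sigma^*$,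 $|\sigma|=m$, and for $m\ge1$ let $N_m=K_m\cdot T_{m-1}$. Let $V_n=\mathbb F_2[X_1,\dots,X_n]/(X_1^2-1,\dots,X_n^2-1)$, where the vertex $\sigma=\sigma_1\dots\sigma_n$ of level $n$ corresponds to the monomial $X_1^{\sigma_1}\cdots X_n^{\sigma_n}$. For $0\le r<2^n$ with binary expansion $r=\sum_{i=1}^n r_i2^{i-1}$ let $v_n^r=(1-X_1)^{r_1}\cdots(1-X_n)^{r_n}$ and $V_n^r=\langle v_n^r,v_n^{r+1},\dots,v_n^{2^n-1}\rangle$, and let $V_n^r=0$ for $r\ge2^n$. Then for all $m\ge1$: 1. $\mathfrak G_{2^m+1}=N_m$. 2. There is an isomorphism $\alpha\oplus\beta:N_m/N_{m+1}\to V_m\oplus V_{m-1}$ that maps the class of $(1,\dots,1,x,1,\dots,1)\in K_m$ to the monomial of $V_m$ corresponding to the vertex at the position of $x$, and the class of $(1,\dots,1,x^2,1,\dots,1)\in T_{m-1}$ to the monomial of $V_{m-1}$ corresponding to the vertex at the position of $x^2$; and, for $0\le r\le2^m$, $$\mathfrak G_{2^m+1+r}=N_{m+1}\,\alpha^{-1}(V_m^r)\,\beta^{-1}\bigl(V_{m-1}^{\lfloor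 r/2\rfloor}\bigr),$$ where $\alpha^{-1}(S)$ and $\beta^{-1}(S)$ are the unions of the cosets that $\alpha\oplus\beta$ maps into $S\oplus0$ and $0\oplus S$ respectively. Moreover 3. $\operatorname{rank}(\mathfrak G_i/\mathfrak G_{i+1})=\dim_{\mathbb F_2}\bigl((\mathfrak G_i/\mathfrak G_{i+1})\otimes\mathbb F_2\bigr)$ is $3$ if $i=1$, $2$ if $i>1$ is even, and $1$ if $i>1$ is odd. Hence $\mathfrak G$ has finite $D$-width with respect to $\mathbb F_2$: it is residually-$2$ (every nontrivial element has a nontrivial image in some finite quotient $2$-group) and the ranks $\operatorname{rank}(\mathfrak G_i/\mathfrak G_{i+1})$ are uniformly bounded. -/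

import Mathlib

open scoped Pointwise TensorProduct commutatorElement

noncomputable section

/-! ### Dimension subgroups -/

section DimensionSubgroups

variable (k : Type*) [Field k] (G : Type*) [Group G]

/-- The augmentation map `k[G] → k`, `∑ kᵢ gᵢ ↦ ∑ kᵢ`. -/
def augmentation : MonoidAlgebra k G →ₐ[k] k :=
  MonoidAlgebra.lift k k G 1

/-- The augmentation ideal `Δ` of the group algebra `k[G]`. -/
def augIdeal : Ideal (MonoidAlgebra k G) :=
  RingHom.ker (augmentation k G)

instance augIdeal_isTwoSided : (augIdeal k G).IsTwoSided := by
  unfold augIdeal; infer_instance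

variable {G} in
/-- A group element, seen in the group algebra. -/
abbrev toAlg (g : G) : MonoidAlgebra k G := MonoidAlgebra.of k G g

/-- The `n`-th dimension subgroup `Gₙ = {g ∈ G | g - 1 ∈ Δⁿ}` of `G` over `k`. -/
def dimSubgroup (n : ℕ) : Subgroup G where
  carrier := {g | toAlg k g - 1 ∈ augIdeal k G ^ n}
  one_mem' := by
    have e : toAlg k (1 : G) - 1 = 0 := sub_eq_zero.mpr (map_one (MonoidAlgebra.of k G))
    change toAlg k (1 : G) - 1 ∈ augIdeal k G ^ n
    rw [e]
    exact zero_mem _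
  mul_mem' := by
    intro g h hg hh
    have e : toAlg k (g * h) - 1 = toAlg k g * (toAlg k h - 1) + (toAlg k g - 1) := by
      simp only [toAlg, map_mul]; noncomm_ring
    change toAlg k (g * h) - 1 ∈ augIdeal k G ^ n
    rw [e]
    exact add_mem (Ideal.mul_mem_left _ _ hh) hg
  inv_mem' := by
    intro g hg
    have e : toAlg k g⁻¹ - 1 = -(toAlg k g⁻¹ * (toAlg k g - 1)) := by
      rw [mul_sub, ← map_mul, inv_mul_cancel, map_one]; noncomm_ring
    change toAlg k g⁻¹ - 1 ∈ augIdeal k G ^ n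
    rw [e]
    exact neg_mem (Ideal.mul_mem_left _ _ hg)

instance dimSubgroup_normal (n : ℕ) : (dimSubgroup k G n).Normal where
  conj_mem := by
    intro h hh g
    have e : toAlg k (g * h * g⁻¹) - 1 = toAlg k g * (toAlg k h - 1) * toAlg k g⁻¹ := by
      rw [mul_sub, sub_mul, mul_one, ← map_mul, ← map_mul, ← map_mul, mul_inv_cancel, map_one]
    change toAlg k (g * h * g⁻¹) - 1 ∈ augIdeal k G ^ n
    rw [e]
    exact Ideal.mul_mem_right _ _ (Ideal.mul_mem_left _ _ hh)

/-- The quotient `Gₙ / Gₙ₊₁`. -/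
abbrev DimLayer (n : ℕ) : Type _ :=
  dimSubgroup k G n ⧸ (dimSubgroup k G (n + 1)).subgroupOf (dimSubgroup k G n)

theorem dimSubgroup_commutator_mem (n : ℕ) {g h : G} (hg : g ∈ dimSubgroup k G n)
    (hh : h ∈ dimSubgroup k G n) : (h * g)⁻¹ * (g * h) ∈ dimSubgroup k G (n + 1) := by
  change toAlg k ((h * g)⁻¹ * (g * h)) - 1 ∈ augIdeal k G ^ (n + 1)
  have aug : ∀ u : G, toAlg k u - 1 ∈ augIdeal k G := by
    intro u
    simp [augIdeal, RingHom.mem_ker, augmentation, toAlg]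
  have key : ∀ {u v : G}, u ∈ dimSubgroup k G n →
      (toAlg k u - 1) * (toAlg k v - 1) ∈ augIdeal k G ^ (n + 1) := by
    intro u v hu
    rw [Submodule.pow_succ]
    exact Ideal.mul_mem_mul hu (aug v)
  have e : toAlg k ((h * g)⁻¹ * (g * h)) - 1 = toAlg k (h * g)⁻¹ *
      ((toAlg k g - 1) * (toAlg k h - 1) - (toAlg k h - 1) * (toAlg k g - 1)) := by
    have e1 : (toAlg k g - 1) * (toAlg k h - 1) - (toAlg k h - 1) * (toAlg k g - 1)
        = toAlg k (g * h) - toAlg k (h * g) := by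
      simp only [toAlg, map_mul]; noncomm_ring
    rw [e1, mul_sub, ← map_mul, ← map_mul, inv_mul_cancel, map_one]
  rw [e]
  exact Ideal.mul_mem_left _ _ (sub_mem (key hg) (key hh))

instance dimLayerCommGroup (n : ℕ) : CommGroup (DimLayer k G n) where
  mul_comm := by
    rintro ⟨g⟩ ⟨h⟩
    refine QuotientGroup.eq.mpr ?_
    rw [Subgroup.mem_subgroupOf]
    have := dimSubgroup_commutator_mem k G n h.2 g.2
    simpa using this

/-- `bₙ(G) = rank (Gₙ / Gₙ₊₁) = dim_k ((Gₙ / Gₙ₊₁) ⊗ k)`, as a cardinal. -/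
def dimRank (n : ℕ) : Cardinal :=
  Module.rank k (k ⊗[ℤ] Additive (DimLayer k G n))

/-- `G` is residually-`p`: every nontrivial element survives in a finite quotient `p`-group. -/
def ResiduallyP (p : ℕ) : Prop :=
  ∀ g : G, g ≠ 1 → ∃ N : Subgroup G, N.Normal ∧ (∃ e : ℕ, N.index = p ^ e) ∧ g ∉ N

/-- `G` has finite `D`-width with respect to `𝔽_p`: it is residually-`p` and the ranks
`bₙ(G)`, `n ≥ 1`, over `𝔽_p` are uniformly bounded. -/
def FiniteDWidth (p : ℕ) [Fact p.Prime] : Prop :=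
  ResiduallyP G p ∧ ∃ C : ℕ, ∀ n : ℕ, 1 ≤ n → dimRank (ZMod p) G n ≤ C

end DimensionSubgroups

/-! ### Grigorchuk's group, acting on the binary words `Σ*`, `Σ = 𝔽₂` -/

namespace Grigorchuk

/-- The set `Σ*` of finite words over `𝔽₂`. -/
abbrev Word := List (ZMod 2)

/-- `a(xσ) = x̄σ` with `x̄ = 1 - x`. -/
def aFun : Word → Word
  | [] => []
  | s :: w => (1 - s) :: w

mutual
/-- `b(0xσ) = 0x̄σ`, `b(1σ) = 1c(σ)`; the automorphism `(a, c)`. -/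
def bFun : Word → Word
  | [] => []
  | s :: w => if s = 0 then 0 :: aFun w else 1 :: cFun w
/-- `c(0xσ) = 0x̄σ`, `c(1σ) = 1d(σ)`; the automorphism `(a, d)`. -/
def cFun : Word → Word
  | [] => []
  | s :: w => if s = 0 then 0 :: aFun w else 1 :: dFun w
/-- `d(0xσ) = 0xσ`, `d(1σ) = 1b(σ)`; the automorphism `(1, b)`. -/
def dFun : Word → Word
  | [] => []
  | s :: w => if s = 0 then 0 :: w else 1 :: bFun w
end

theorem aFun_invol : Function.Involutive aFun := by
  intro w; cases w <;> simp [aFun]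

theorem bcdFun_invol (w : Word) :
    bFun (bFun w) = w ∧ cFun (cFun w) = w ∧ dFun (dFun w) = w := by
  induction w with
  | nil => simp [bFun, cFun, dFun]
  | cons s w ih =>
    obtain ⟨hb, hc, hd⟩ := ih
    have h1 : s ≠ 0 → s = 1 := by revert s; decide
    by_cases hs : s = 0
    · subst hs; simp [bFun, cFun, dFun, aFun_invol w]
    · obtain rfl := h1 hs; simp [bFun, cFun, dFun, hb, hc, hd]

/-- The generator `a`. -/
def a : Equiv.Perm Word := aFun_invol.toPerm
/-- The generator `b`. -/
def b : Equiv.Perm Word := Function.Involutive.toPerm bFun fun w => (bcdFun_invol w).1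
/-- The generator `c`. -/
def c : Equiv.Perm Word := Function.Involutive.toPerm cFun fun w => (bcdFun_invol w).2.1
/-- The generator `d`. -/
def d : Equiv.Perm Word := Function.Involutive.toPerm dFun fun w => (bcdFun_invol w).2.2

/-- Grigorchuk's group `⟨a, b, c, d⟩`. -/
def GG : Subgroup (Equiv.Perm Word) := Subgroup.closure {a, b, c, d}

/-- `x = [a, b] = a b a⁻¹ b⁻¹`. -/
def x : Equiv.Perm Word := ⁅a, b⁆

/-- `⟨g⟩^𝔊`, the subgroup generated by the conjugates of `g` by elements of Grigorchuk's group. -/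
def conjClosure (g : Equiv.Perm Word) : Subgroup (Equiv.Perm Word) :=
  Subgroup.closure {y | ∃ u ∈ GG, y = u * g * u⁻¹}

/-- `K = ⟨x⟩^𝔊`. -/
def K : Subgroup (Equiv.Perm Word) := conjClosure x

/-- `T = ⟨x²⟩^𝔊`. -/
def T : Subgroup (Equiv.Perm Word) := conjClosure (x ^ 2)

/-- `Q_m = Q × ⋯ × Q` (`2^m` factors): the permutations that fix every word of length `< m` and
that act on each subtree `σΣ*`, `|σ| = m`, by `σw ↦ σ(q w)` for some `q ∈ Q` depending on `σ`. -/
def level (Q : Subgroup (Equiv.Perm Word)) (m : ℕ) : Subgroup (Equiv.Perm Word) where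
  carrier := {g | (∀ w : Word, w.length < m → g w = w) ∧
    ∀ σ : Word, σ.length = m → ∃ q ∈ Q, ∀ w : Word, g (σ ++ w) = σ ++ q w}
  one_mem' := ⟨fun _ _ => rfl, fun _ _ => ⟨1, Q.one_mem, fun _ => rfl⟩⟩
  mul_mem' := by
    rintro g h ⟨hg, hg'⟩ ⟨hh, hh'⟩
    refine ⟨fun w hw => by rw [Equiv.Perm.mul_apply, hh w hw, hg w hw], fun σ hσ => ?_⟩
    obtain ⟨q, hq, e⟩ := hg' σ hσ
    obtain ⟨q', hq', e'⟩ := hh' σ hσ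
    exact ⟨q * q', Q.mul_mem hq hq', fun w => by simp [e', e]⟩
  inv_mem' := by
    rintro g ⟨hg, hg'⟩
    refine ⟨fun w hw => by rw [Equiv.Perm.inv_eq_iff_eq, hg w hw], fun σ hσ => ?_⟩
    obtain ⟨q, hq, e⟩ := hg' σ hσ
    exact ⟨q⁻¹, Q.inv_mem hq, fun w => by rw [Equiv.Perm.inv_eq_iff_eq, e]; simp⟩

/-- `N_m = K_m · T_{m-1}`, for `m ≥ 1`. -/
def N (m : ℕ) : Subgroup (Equiv.Perm Word) := level K m ⊔ level T (m - 1)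

/-- The underlying map of `atVertex`. -/
def atVertexFun (g : Word → Word) : Word → Word → Word
  | [], w => g w
  | _ :: _, [] => []
  | s :: σ, t :: w => if t = s then t :: atVertexFun g σ w else t :: w

theorem atVertexFun_comp (g h : Word → Word) (hgh : ∀ w, g (h w) = w) :
    ∀ σ w, atVertexFun g σ (atVertexFun h σ w) = w
  | [], w => hgh w
  | _ :: _, [] => rfl
  | s :: σ, t :: w => by
    by_cases ht : t = s
    · simp [atVertexFun, ht, atVertexFun_comp g h hgh σ w]
    · simp [atVertexFun, ht]

/-- `(1, …, 1, g, 1, …, 1)` with `g` at the vertex `σ`: the permutation that maps `σw` to `σ(g w)`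
and fixes all words that do not begin with `σ`. -/
def atVertex (σ : Word) (g : Equiv.Perm Word) : Equiv.Perm Word where
  toFun := atVertexFun g σ
  invFun := atVertexFun g.symm σ
  left_inv := atVertexFun_comp _ _ g.symm_apply_apply σ
  right_inv := atVertexFun_comp _ _ g.apply_symm_apply σ

theorem atVertex_append (σ : Word) (g : Equiv.Perm Word) (w : Word) :
    atVertex σ g (σ ++ w) = σ ++ g w := by
  induction σ with
  | nil => rfl
  | cons s σ ih =>
    change atVertexFun g (s :: σ) (s :: (σ ++ w)) = _
    simp only [atVertexFun, if_true]
    exact congrArg (s :: ·) ih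

theorem atVertex_of_not_prefix (σ : Word) (g : Equiv.Perm Word) (w : Word) (hw : ¬ σ <+: w) :
    atVertex σ g w = w := by
  induction σ generalizing w with
  | nil => simp at hw
  | cons s σ ih =>
    cases w with
    | nil => rfl
    | cons t w =>
      change atVertexFun g (s :: σ) (t :: w) = _
      by_cases ht : t = s
      · subst ht
        have : atVertexFun g σ w = w := ih w (by simpa [List.cons_prefix_cons] using hw)
        simp [atVertexFun, this]
      · simp [atVertexFun, ht]

/-! ### The modules `V_n` -/

/-- `V_n = 𝔽₂[X₁, …, X_n]/(X₁² - 1, …, X_n² - 1)`, as the group algebra of `(ℤ/2)ⁿ`; the monomial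
`X₁^{σ₁} ⋯ X_n^{σ_n}` is the basis element `σ = (σ₁, …, σ_n)`. -/
abbrev V (n : ℕ) : Type := AddMonoidAlgebra (ZMod 2) (Fin n → ZMod 2)

/-- The monomial `X₁^{σ₁} ⋯ X_n^{σ_n}` attached to the vertex `σ = σ₁ ⋯ σ_n` of level `n`. -/
def monomial {n : ℕ} (σ : Fin n → ZMod 2) : V n := AddMonoidAlgebra.single σ 1

/-- The variable `X_{i+1}` (the index `i : Fin n` starts at `0`). -/
def X {n : ℕ} (i : Fin n) : V n := monomial (Pi.single i 1)

/-- `v_n^r = (1 - X₁)^{r₁} ⋯ (1 - X_n)^{r_n}`, where `r = r_n ⋯ r₁` in base `2`. -/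
def v (n r : ℕ) : V n := ∏ i : Fin n, (1 - X i) ^ (r / 2 ^ (i : ℕ) % 2)

/-- `V_n^r = ⟨v_n^r, …, v_n^{2^n - 1}⟩`, which is `0` for `r ≥ 2^n`. -/
def VPow (n r : ℕ) : Submodule (ZMod 2) (V n) :=
  Submodule.span (ZMod 2) (v n '' Set.Ico r (2 ^ n))

/-- `φ` induces the isomorphism `α ⊕ β : N_m / N_{m+1} → V_m ⊕ V_{m-1}`: it is a surjective
homomorphism with kernel `N_{m+1}`, it maps `(1, …, x, …, 1) ∈ K_m` to the monomial of `V_m` given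
by the position of `x`, and `(1, …, x², …, 1) ∈ T_{m-1}` to the monomial of `V_{m-1}` given by the
position of `x²`. -/
structure IsAlphaBeta (m : ℕ) (φ : N m →* Multiplicative (V m × V (m - 1))) : Prop where
  surjective : Function.Surjective φ
  ker_map : φ.ker.map (N m).subtype = N (m + 1)
  alpha : ∀ σ : Fin m → ZMod 2, ∃ h : atVertex (List.ofFn σ) x ∈ N m,
    φ ⟨_, h⟩ = Multiplicative.ofAdd (monomial σ, 0)
  beta : ∀ σ : Fin (m - 1) → ZMod 2, ∃ h : atVertex (List.ofFn σ) (x ^ 2) ∈ N m,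
    φ ⟨_, h⟩ = Multiplicative.ofAdd (0, monomial σ)

/-- `α⁻¹(S)`: the union of the cosets of `N_{m+1}` in `N_m` that `α ⊕ β` maps into `S ⊕ 0`. -/
def alphaInv {m : ℕ} (φ : N m →* Multiplicative (V m × V (m - 1)))
    (S : Submodule (ZMod 2) (V m)) : Set (Equiv.Perm Word) :=
  {g | ∃ h : g ∈ N m, (φ ⟨g, h⟩).toAdd.1 ∈ S ∧ (φ ⟨g, h⟩).toAdd.2 = 0}

/-- `β⁻¹(S)`: the union of the cosets of `N_{m+1}` in `N_m` that `α ⊕ β` maps into `0 ⊕ S`. -/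
def betaInv {m : ℕ} (φ : N m →* Multiplicative (V m × V (m - 1)))
    (S : Submodule (ZMod 2) (V (m - 1))) : Set (Equiv.Perm Word) :=
  {g | ∃ h : g ∈ N m, (φ ⟨g, h⟩).toAdd.1 = 0 ∧ (φ ⟨g, h⟩).toAdd.2 ∈ S}

/-- The dimension series of Grigorchuk's group over `𝔽₂`, as subgroups of `Perm Σ*`. -/
def D (n : ℕ) : Subgroup (Equiv.Perm Word) := (dimSubgroup (ZMod 2) GG n).map GG.subtype

end Grigorchuk

end

/-!
The proof determines the dimension series `D n` of Grigorchuk's group by matching bounds from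
above and below, read off in the coordinates `α` and `β`. An element that fixes the first level is
written as the pair of its sections on the two subtrees.

*The isomorphism.* The abelianization of `𝔊` is given by sums of the portrait over the first three
levels. It yields additive functions `epsX` and `epsY` on `𝔊'` whose common kernel is `N₁`
(`mem_N_one_iff`), and `N_{m+2} = N_{m+1} × N_{m+1}` (`mem_N_succ`). Collecting the values of `epsX`
on the sections at level `m`, and those of `epsY` on the left sections below level `m - 1`, as
coefficients of monomials gives `α ⊕ β` on `N_m`, with kernel `N_{m+1}` (`mem_N_succ_iff`,
`isAlphaBeta`).

*The upper bound.* Write `diagonal A B` for the pairs in `𝔊` with sections in `A` that agree modulo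
`B`. Starting from `H₁ = 𝔊`, `H₂ = 𝔊'` and `H'₂ = K`, put `H₂ₙ = diagonal Hₙ Hₙ₊₁`,
`H'₂ₙ = diagonal H'ₙ H'ₙ₊₁` and `H₂ₙ₋₁ = H'₂ₙ₋₁ = diagonal Hₙ H'ₙ`. The auxiliary terms `H'ₙ` lie
between `Hₙ` and `Hₙ₊₁` and make an induction along this recursion possible, which shows
`[Hᵢ, Hⱼ] ≤ Hᵢ₊ⱼ` and `Hᵢ² ⊆ H₂ᵢ` (`isRestrictedSeries_H`). The terms have finite index, and every
such series with terms of finite index contains the dimension series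
(`dimSubgroup_le_of_isRestrictedSeries`): in a finite quotient, one builds the group by extensions
of index `2` and splits the elements of given weight in the group algebra accordingly
(`WeightSpan.decompose`). The same recursion bounds `α` and `β` on `H` (`alpha_beta_mem_VPow`),
because `(u₀, u₁) ↦ u₀ + X₁ u₁` turns "equal modulo the next step" into divisibility by `1 - X₁`
(`join_mem`).

*The lower bound.* Let `spread x m r` be the product of copies of `x` on level `m` placed according
to the support of `v_m^r`. A suitable commutator with a generator of `𝔊` turns it into
`spread x m (r + 1)`, up to conjugation and `T_m` (`exists_commutator_spread`), and
`spread x m (2 ^ m)` is `spread x (m + 1) 0`. As `x = [a, b]` has degree `2`, induction gives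
`spread x m r ∈ D (2 ^ m + 1 + r)` (`spread_mem_D`). These elements realize the basis `v_m^r` under
`α`, and the squares of those on level `m - 1` realize the basis `v_{m-1}^r` under `β`.

Together the bounds give `mem_D_iff`. Each step in `r` removes one coordinate of `α`, and every
second step also one coordinate of `β`; these are the ranks. Finally `N_m` acts trivially on words
of length less than `m - 1`, so the quotients by the dimension subgroups separate the elements
of `𝔊`.
-/

noncomputable section

/-! ### Dimension subgroups and restricted series -/

section Jennings

/-- A restricted `N`-series for the prime `2`: a descending series of subgroups with
`[Hᵢ, Hⱼ] ≤ Hᵢ₊ⱼ` and `Hᵢ² ⊆ H₂ᵢ`, starting with the whole group in degrees `0` and `1`. -/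
structure IsRestrictedSeries {G : Type*} [Group G] (H : ℕ → Subgroup G) : Prop where
  zero : H 0 = ⊤
  one : H 1 = ⊤
  anti : Antitone H
  comm : ∀ i j g h, g ∈ H i → h ∈ H j → ⁅g, h⁆ ∈ H (i + j)
  sq : ∀ i g, g ∈ H i → g ^ 2 ∈ H (2 * i)

variable {G : Type*} [Group G]

theorem IsRestrictedSeries.conj {H : ℕ → Subgroup G} (hH : IsRestrictedSeries H) {i : ℕ} {h : G}
    (hh : h ∈ H i) (g : G) : g * h * g⁻¹ ∈ H i := by
  have h1 : ⁅g, h⁆ ∈ H i := by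
    have := hH.comm 0 i g h (by simp [hH.zero]) hh
    simpa using this
  have : g * h * g⁻¹ = ⁅g, h⁆ * h := by simp [commutatorElement_def]
  rw [this]
  exact mul_mem h1 hh

/-- `WeightSpan H L k u`: the element `u` of the group algebra is a sum of products
`(h₁ - 1) ⋯ (hₛ - 1)` with `hⱼ ∈ L ∩ H (kⱼ)` and `k₁ + ⋯ + kₛ ≥ k`. -/
inductive WeightSpan (H : ℕ → Subgroup G) (L : Subgroup G) : ℕ → MonoidAlgebra (ZMod 2) G → Prop
  | zero (k : ℕ) : WeightSpan H L k 0
  | one : WeightSpan H L 0 1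
  | add {k : ℕ} {u v : MonoidAlgebra (ZMod 2) G} :
      WeightSpan H L k u → WeightSpan H L k v → WeightSpan H L k (u + v)
  | neg {k : ℕ} {u : MonoidAlgebra (ZMod 2) G} : WeightSpan H L k u → WeightSpan H L k (-u)
  | gen {i k : ℕ} {h : G} {u : MonoidAlgebra (ZMod 2) G} : h ∈ L → h ∈ H i → WeightSpan H L k u →
      WeightSpan H L (i + k) ((toAlg (ZMod 2) h - 1) * u)
  | mono {k l : ℕ} {u : MonoidAlgebra (ZMod 2) G} : k ≤ l → WeightSpan H L l u → WeightSpan H L k u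

namespace WeightSpan

variable {H : ℕ → Subgroup G} {L : Subgroup G}

theorem sub {k : ℕ} {u v : MonoidAlgebra (ZMod 2) G} (hu : WeightSpan H L k u)
    (hv : WeightSpan H L k v) : WeightSpan H L k (u - v) := by
  rw [sub_eq_add_neg]; exact hu.add hv.neg

theorem mul {i j : ℕ} {u v : MonoidAlgebra (ZMod 2) G} (hu : WeightSpan H L i u)
    (hv : WeightSpan H L j v) : WeightSpan H L (i + j) (u * v) := by
  induction hu with
  | zero => rw [zero_mul]; exact .zero _
  | one => rw [one_mul, zero_add]; exact hv
  | add _ _ h1 h2 => rw [add_mul]; exact h1.add h2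
  | neg _ h => rw [neg_mul]; exact h.neg
  | gen hL hH _ h => rw [mul_assoc, add_assoc]; exact .gen hL hH h
  | mono hkl _ h => exact h.mono (by lia)

theorem toAlg_sub_one {i : ℕ} {h : G} (hL : h ∈ L) (hi : h ∈ H i) :
    WeightSpan H L i (toAlg (ZMod 2) h - 1) := by
  simpa using WeightSpan.gen hL hi .one

theorem toAlg_mem {h : G} (hH : IsRestrictedSeries H) (hL : h ∈ L) :
    WeightSpan H L 0 (toAlg (ZMod 2) h) := by
  have := (toAlg_sub_one (H := H) (i := 0) hL (by simp [hH.zero])).add .one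
  simpa using this

/-- Elements of positive weight lie in the augmentation ideal. -/
theorem augmentation_eq_zero {k : ℕ} {u : MonoidAlgebra (ZMod 2) G} (hu : WeightSpan H L k u)
    (hk : 1 ≤ k) : augmentation (ZMod 2) G u = 0 := by
  induction hu with
  | zero => simp
  | one => lia
  | add _ _ h1 h2 => simp [h1 hk, h2 hk]
  | neg _ h => simp [h hk]
  | gen _ _ _ _ => simp [augmentation]
  | mono hkl _ h => exact h (hk.trans hkl)

theorem coeff_eq_zero {k : ℕ} {u : MonoidAlgebra (ZMod 2) G} (hu : WeightSpan H L k u) :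
    ∀ g, g ∉ L → u.coeff g = 0 := by
  induction hu with
  | zero => simp
  | one =>
    intro g hg
    classical
    rw [MonoidAlgebra.one_def, MonoidAlgebra.coeff_single, Finsupp.single_apply, if_neg]
    rintro rfl; exact hg (one_mem _)
  | add _ _ h1 h2 => intro g hg; simp [h1 g hg, h2 g hg]
  | neg _ h => intro g hg; simp [h g hg]
  | @gen i k h u hL _ _ ih =>
    intro g hg
    rw [sub_mul, one_mul, MonoidAlgebra.coeff_sub, Finsupp.sub_apply, ih g hg, toAlg,
      MonoidAlgebra.of_apply, MonoidAlgebra.coeff_single_mul_apply, ih, mul_zero, sub_zero]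
    intro h2
    exact hg (by simpa using mul_mem hL h2)
  | mono _ _ h => exact h

theorem toAlg_sub_one_sq (g : G) :
    (toAlg (ZMod 2) g - 1) * (toAlg (ZMod 2) g - 1) = toAlg (ZMod 2) (g ^ 2) - 1 := by
  have h2 : (toAlg (ZMod 2) g) + (toAlg (ZMod 2) g) = 0 := by
    rw [← two_smul (ZMod 2), show (2 : ZMod 2) = 0 from rfl, zero_smul]
  have h1 : (1 : MonoidAlgebra (ZMod 2) G) + 1 = 0 := by
    rw [← two_smul (ZMod 2), show (2 : ZMod 2) = 0 from rfl, zero_smul]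
  have e : (toAlg (ZMod 2) g - 1) * (toAlg (ZMod 2) g - 1) =
      toAlg (ZMod 2) (g ^ 2) - 1 - (toAlg (ZMod 2) g + toAlg (ZMod 2) g) + (1 + 1) := by
    simp only [toAlg, pow_two, map_mul]; noncomm_ring
  rw [e, h1, h2]; simp

/-- The extension step of the dimension theorem: if `L` has index `2` in `L'` and `g` has maximal
weight `w` among the elements of `L' ∖ L`, then every element of weight `k` over `L'` is
`e₀ + (g - 1) e₁` with `e₀` of weight `k` and `e₁` of weight `k - w` over `L`. -/
theorem decompose (hH : IsRestrictedSeries H) {L' : Subgroup G} {w : ℕ} {g : G} (hg : g ∈ H w)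
    (hgL' : ∀ h ∈ L, g⁻¹ * h * g ∈ L)
    (hg2 : g ^ 2 ∈ L) (hcos : ∀ h ∈ L', h ∉ L → g⁻¹ * h ∈ L)
    (hmax : ∀ h ∈ L', h ∉ L → ∀ k, h ∈ H k → k ≤ w) {k : ℕ} {u : MonoidAlgebra (ZMod 2) G}
    (hu : WeightSpan H L' k u) :
    ∃ e₀ e₁, WeightSpan H L k e₀ ∧ WeightSpan H L (k - w) e₁ ∧
      u = e₀ + (toAlg (ZMod 2) g - 1) * e₁ := by
  -- Left multiplication by `h - 1` with `h ∈ L`.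
  have left : ∀ {i k : ℕ} {h : G} {u : MonoidAlgebra (ZMod 2) G}, h ∈ L → h ∈ H i →
      (∃ e₀ e₁, WeightSpan H L k e₀ ∧ WeightSpan H L (k - w) e₁ ∧
        u = e₀ + (toAlg (ZMod 2) g - 1) * e₁) →
      ∃ e₀ e₁, WeightSpan H L (i + k) e₀ ∧ WeightSpan H L (i + k - w) e₁ ∧
        (toAlg (ZMod 2) h - 1) * u = e₀ + (toAlg (ZMod 2) g - 1) * e₁ := by
    rintro i k h u hL hi ⟨e₀, e₁, h0, h1, rfl⟩
    have hc : ⁅g⁻¹, h⁆ ∈ L := by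
      rw [commutatorElement_def, inv_inv]; exact mul_mem (hgL' h hL) (inv_mem hL)
    have hi' : g⁻¹ * h * g ∈ H i := by simpa using hH.conj hi g⁻¹
    refine ⟨(toAlg (ZMod 2) h - 1) * e₀ +
      (toAlg (ZMod 2) ⁅g⁻¹, h⁆ - 1) * (e₁ + (toAlg (ZMod 2) h - 1) * e₁),
      (toAlg (ZMod 2) (g⁻¹ * h * g) - 1) * e₁, ?_, ?_, ?_⟩
    · refine .add (.gen hL hi h0) ?_
      have := WeightSpan.gen hc (hH.comm w i g⁻¹ h (inv_mem hg) hi)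
        (h1.add ((WeightSpan.gen hL hi h1).mono (by lia)))
      exact this.mono (by lia)
    · exact (WeightSpan.gen (hgL' h hL) hi' h1).mono (by lia)
    · have e2 : toAlg (ZMod 2) ⁅g⁻¹, h⁆ * toAlg (ZMod 2) h = toAlg (ZMod 2) (g⁻¹ * h * g) := by
        rw [← map_mul]; congr 1; simp [commutatorElement_def]
      have e3 : toAlg (ZMod 2) g * toAlg (ZMod 2) (g⁻¹ * h * g) =
          toAlg (ZMod 2) h * toAlg (ZMod 2) g := by
        rw [← map_mul, ← map_mul]; congr 1; group
      have e4 : (toAlg (ZMod 2) ⁅g⁻¹, h⁆ - 1) * (e₁ + (toAlg (ZMod 2) h - 1) * e₁) =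
          toAlg (ZMod 2) ⁅g⁻¹, h⁆ * toAlg (ZMod 2) h * e₁ - toAlg (ZMod 2) h * e₁ := by
        noncomm_ring
      have e5 : (toAlg (ZMod 2) g - 1) * ((toAlg (ZMod 2) (g⁻¹ * h * g) - 1) * e₁) =
          toAlg (ZMod 2) g * toAlg (ZMod 2) (g⁻¹ * h * g) * e₁ - toAlg (ZMod 2) g * e₁ -
            toAlg (ZMod 2) (g⁻¹ * h * g) * e₁ + e₁ := by noncomm_ring
      rw [e4, e5, e2, e3]; noncomm_ring
  -- Left multiplication by `g - 1`.
  have leftg : ∀ {k : ℕ} {u : MonoidAlgebra (ZMod 2) G},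
      (∃ e₀ e₁, WeightSpan H L k e₀ ∧ WeightSpan H L (k - w) e₁ ∧
        u = e₀ + (toAlg (ZMod 2) g - 1) * e₁) →
      ∃ e₀ e₁, WeightSpan H L (w + k) e₀ ∧ WeightSpan H L (w + k - w) e₁ ∧
        (toAlg (ZMod 2) g - 1) * u = e₀ + (toAlg (ZMod 2) g - 1) * e₁ := by
    rintro k u ⟨e₀, e₁, h0, h1, rfl⟩
    refine ⟨(toAlg (ZMod 2) (g ^ 2) - 1) * e₁, e₀, ?_, h0.mono (by lia), ?_⟩
    · exact (WeightSpan.gen hg2 (hH.sq w g hg) h1).mono (by lia)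
    · rw [mul_add, ← mul_assoc, toAlg_sub_one_sq, add_comm]
  induction hu with
  | zero k => exact ⟨0, 0, .zero _, .zero _, by simp⟩
  | one => exact ⟨1, 0, .one, .zero _, by simp⟩
  | add _ _ h1 h2 =>
    obtain ⟨e₀, e₁, a0, a1, rfl⟩ := h1
    obtain ⟨f₀, f₁, b0, b1, rfl⟩ := h2
    exact ⟨e₀ + f₀, e₁ + f₁, a0.add b0, a1.add b1, by noncomm_ring⟩
  | neg _ h1 =>
    obtain ⟨e₀, e₁, a0, a1, rfl⟩ := h1
    exact ⟨-e₀, -e₁, a0.neg, a1.neg, by noncomm_ring⟩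
  | @gen i k h u hL hi _ ih =>
    by_cases hhL : h ∈ L
    · exact left hhL hi ih
    · have hiw := hmax h hL hhL i hi
      have hL1 := hcos h hL hhL
      have hi1 : g⁻¹ * h ∈ H i := mul_mem (inv_mem (hH.anti hiw hg)) hi
      have s1 := left hL1 hi1 ih
      have s2 := leftg ih
      have s3 := leftg s1
      obtain ⟨p₀, p₁, a0, a1, ea⟩ := s1
      obtain ⟨q₀, q₁, b0, b1, eb⟩ := s2
      obtain ⟨r₀, r₁, c0, c1, ec⟩ := s3
      refine ⟨p₀ + q₀ + r₀, p₁ + q₁ + r₁, ?_, ?_, ?_⟩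
      · exact (a0.add (b0.mono (by lia))).add (c0.mono (by lia))
      · exact (a1.add (b1.mono (by lia))).add (c1.mono (by lia))
      · have e : toAlg (ZMod 2) h = toAlg (ZMod 2) g * toAlg (ZMod 2) (g⁻¹ * h) := by
          rw [← map_mul]; congr 1; group
        have e' : (toAlg (ZMod 2) h - 1) * u = (toAlg (ZMod 2) (g⁻¹ * h) - 1) * u +
            (toAlg (ZMod 2) g - 1) * u +
            (toAlg (ZMod 2) g - 1) * ((toAlg (ZMod 2) (g⁻¹ * h) - 1) * u) := by
          rw [e]; noncomm_ring
        rw [e', ec, ea, eb]; noncomm_ring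
  | mono hkl _ h =>
    obtain ⟨e₀, e₁, a0, a1, rfl⟩ := h
    exact ⟨e₀, e₁, a0.mono hkl, a1.mono (by lia), rfl⟩

/-- One step of the dimension theorem, from `L` to `L'` of index `2` over `L`. -/
theorem mem_of_extend (hH : IsRestrictedSeries H) {L' : Subgroup G} {w : ℕ} {g : G} (hg : g ∈ H w)
    (hgn : g ∉ L)
    (hgL' : ∀ h ∈ L, g⁻¹ * h * g ∈ L)
    (hg2 : g ^ 2 ∈ L) (hcos : ∀ h ∈ L', h ∉ L → g⁻¹ * h ∈ L)
    (hmax : ∀ h ∈ L', h ∉ L → ∀ k, h ∈ H k → k ≤ w)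
    (ih : ∀ k, ∀ h ∈ L, WeightSpan H L k (toAlg (ZMod 2) h - 1) → h ∈ H k)
    {k : ℕ} {h : G} (hh : h ∈ L') (hu : WeightSpan H L' k (toAlg (ZMod 2) h - 1)) : h ∈ H k := by
  obtain ⟨e₀, e₁, h0, h1, e⟩ := decompose hH hg hgL' hg2 hcos hmax hu
  have z1 : WeightSpan H L 0 (1 : MonoidAlgebra (ZMod 2) G) := .one
  have h00 := h0.mono (Nat.zero_le _)
  have h10 := h1.mono (Nat.zero_le _)
  -- The cosets `L` and `gL` are disjoint, so elements supported on `L` are separated from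
  -- `g`-multiples.
  have sep : ∀ p q : MonoidAlgebra (ZMod 2) G, WeightSpan H L 0 p → WeightSpan H L 0 q →
      p = toAlg (ZMod 2) g * q → p = 0 ∧ q = 0 := by
    intro p q hp hq hpq
    have hp0 : p = 0 := by
      apply MonoidAlgebra.ext
      ext y
      by_cases hy : y ∈ L
      · rw [hpq, toAlg, MonoidAlgebra.of_apply, MonoidAlgebra.coeff_single_mul_apply,
          hq.coeff_eq_zero, mul_zero]; · rfl
        intro h2
        exact hgn (by simpa using mul_mem hy (inv_mem h2))
      · rw [hp.coeff_eq_zero y hy]; rfl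
    refine ⟨hp0, ?_⟩
    have : toAlg (ZMod 2) g⁻¹ * (toAlg (ZMod 2) g * q) = q := by
      rw [← mul_assoc, ← map_mul, inv_mul_cancel, map_one, one_mul]
    rw [← this, ← hpq, hp0, mul_zero]
  by_cases hhL : h ∈ L
  · have e' : toAlg (ZMod 2) h - 1 - e₀ + e₁ = toAlg (ZMod 2) g * e₁ := by
      rw [e]; noncomm_ring
    obtain ⟨_, r1⟩ := sep _ _ ((((toAlg_mem hH hhL).sub z1).sub h00).add h10) h10 e'
    refine ih k h hhL ?_
    rw [e, r1, mul_zero, add_zero]; exact h0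
  · have hL1 := hcos h hh hhL
    have eh : toAlg (ZMod 2) h = toAlg (ZMod 2) g * toAlg (ZMod 2) (g⁻¹ * h) := by
      rw [← map_mul]; congr 1; group
    have e' : 1 + e₀ - e₁ = toAlg (ZMod 2) g * (toAlg (ZMod 2) (g⁻¹ * h) - e₁) := by
      rw [mul_sub, ← eh, eq_sub_iff_add_eq]
      have e2 : toAlg (ZMod 2) h = 1 + (e₀ + (toAlg (ZMod 2) g - 1) * e₁) := by rw [← e]; abel
      rw [e2]; noncomm_ring
    obtain ⟨r0, r1⟩ := sep _ _ ((z1.add h00).sub h10) ((toAlg_mem hH hL1).sub h10) e'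
    have e1 : e₁ = toAlg (ZMod 2) (g⁻¹ * h) := (sub_eq_zero.mp r1).symm
    have e0 : e₀ = toAlg (ZMod 2) (g⁻¹ * h) - 1 := by
      rw [← e1, ← sub_eq_zero.mp r0]; abel
    have m0 := ih k _ hL1 (e0 ▸ h0)
    have hkw : k ≤ w := by
      by_contra hlt
      have := h1.augmentation_eq_zero (by lia)
      rw [e1] at this
      simp [augmentation] at this
    have := mul_mem (hH.anti hkw hg) m0
    simpa using this

/-- Over a finite group with a series that reaches `1`, the weight filtration detects the series. -/
theorem mem_of_sub_one [Finite G] (hH : IsRestrictedSeries H) {M : ℕ} (hM : H M = ⊥) :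
    ∀ (n : ℕ) (L : Subgroup G), Nat.card L = 2 ^ n → ∀ k, ∀ h ∈ L,
      WeightSpan H L k (toAlg (ZMod 2) h - 1) → h ∈ H k := by
  intro n
  induction n with
  | zero =>
    intro L hL k h hh _
    rw [pow_zero, Subgroup.card_eq_one] at hL
    subst hL
    rw [Subgroup.mem_bot.mp hh]; exact one_mem _
  | succ n ih =>
    intro L' hL' k h hh hu
    have : Fact (Nat.Prime 2) := ⟨Nat.prime_two⟩
    obtain ⟨L₀, hL₀⟩ := Sylow.exists_subgroup_card_pow_prime (G := L') 2 (n := n)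
      (by rw [hL']; exact pow_dvd_pow 2 (Nat.le_succ n))
    have hind : L₀.index = 2 := by
      have := L₀.card_mul_index
      rw [hL₀, hL', pow_succ] at this
      exact Nat.eq_of_mul_eq_mul_left (by positivity) this
    have hmem : ∀ y (hy : y ∈ L'), y ∈ L₀.map L'.subtype ↔ (⟨y, hy⟩ : L') ∈ L₀ := by
      intro y hy
      constructor
      · rintro ⟨z, hz, rfl⟩; exact hz
      · intro hz; exact ⟨_, hz, rfl⟩
    have hLL : L₀.map L'.subtype ≤ L' := by
      rintro _ ⟨z, _, rfl⟩; exact z.2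
    have mulm : ∀ y z, y ∈ L' → z ∈ L' → (y * z ∈ L₀.map L'.subtype ↔
        (y ∈ L₀.map L'.subtype ↔ z ∈ L₀.map L'.subtype)) := by
      intro y z hy hz
      rw [hmem _ (mul_mem hy hz), hmem _ hy, hmem _ hz]
      exact Subgroup.mul_mem_iff_of_index_two hind (a := ⟨y, hy⟩) (b := ⟨z, hz⟩)
    -- The weights that occur outside `L` are bounded by `M`; take the largest one.
    obtain ⟨g₀, hg₀, hg₀'⟩ : ∃ g ∈ L', g ∉ L₀.map L'.subtype := by
      by_contra! hcon
      have : L₀ = ⊤ := by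
        rw [eq_top_iff]; rintro ⟨z, hz⟩ _
        exact (hmem z hz).mp (hcon z hz)
      rw [this, Subgroup.index_top] at hind
      lia
    classical
    have hbound : ∀ w, (∃ g ∈ L', g ∉ L₀.map L'.subtype ∧ g ∈ H w) → w ≤ M := by
      rintro w ⟨g, _, hgn, hgw⟩
      by_contra hlt
      have : g ∈ H M := hH.anti (by lia) hgw
      rw [hM, Subgroup.mem_bot] at this
      exact hgn (this ▸ one_mem _)
    obtain ⟨g, hgL', hgn, hgw⟩ := Nat.findGreatest_spec
      (P := fun w => ∃ g ∈ L', g ∉ L₀.map L'.subtype ∧ g ∈ H w) (Nat.zero_le M)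
      ⟨g₀, hg₀, hg₀', by simp [hH.zero]⟩
    refine mem_of_extend hH (L := L₀.map L'.subtype) hgw hgn ?_ ?_ ?_ ?_ ?_ hh hu
    · intro h hh
      have := hLL hh
      rw [mulm _ _ (mul_mem (inv_mem hgL') this) hgL', mulm _ _ (inv_mem hgL') this, inv_mem_iff]
      tauto
    · rw [pow_two, mulm _ _ hgL' hgL']
    · intro h hh hhn
      rw [mulm _ _ (inv_mem hgL') hh, inv_mem_iff]
      tauto
    · intro h hh hhn k hk
      exact Nat.le_findGreatest (hbound k ⟨h, hh, hhn, hk⟩) ⟨h, hh, hhn, hk⟩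
    · intro k h hh
      exact ih _
        ((Nat.card_congr (L₀.equivMapOfInjective _ L'.subtype_injective).toEquiv).symm.trans hL₀)
        k h hh

end WeightSpan

/-- Every element of `Δⁿ` has weight at least `n`. -/
theorem weightSpan_of_mem_augIdeal_pow {H : ℕ → Subgroup G} (hH : IsRestrictedSeries H) (n : ℕ) :
    ∀ u ∈ augIdeal (ZMod 2) G ^ n, WeightSpan H ⊤ n u := by
  have smul : ∀ (r : ZMod 2) {k : ℕ} {u : MonoidAlgebra (ZMod 2) G},
      WeightSpan H ⊤ k u → WeightSpan H ⊤ k (r • u) := by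
    intro r k u hu
    have : r = 0 ∨ r = 1 := by revert r; decide
    rcases this with rfl | rfl
    · rw [zero_smul]; exact .zero _
    · rw [one_smul]; exact hu
  have all : ∀ u : MonoidAlgebra (ZMod 2) G,
      WeightSpan H ⊤ 1 (u - algebraMap (ZMod 2) _ (augmentation (ZMod 2) G u)) := by
    intro u
    induction u using MonoidAlgebra.induction_on with
    | of m =>
      have := WeightSpan.toAlg_sub_one (H := H) (L := ⊤) (i := 1) (h := m) trivial
        (by simp [hH.one])
      simpa [augmentation, MonoidAlgebra.one_def] using this
    | add p q hp hq =>
      have := hp.add hq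
      rw [map_add, map_add]
      convert this using 1; abel
    | smul r p hp =>
      have := smul r hp
      rw [map_smul, smul_eq_mul, map_mul, ← Algebra.smul_def, ← smul_sub]
      exact this
  have top : ∀ u : MonoidAlgebra (ZMod 2) G, WeightSpan H ⊤ 0 u := by
    intro u
    have := ((all u).mono (Nat.zero_le 1)).add (smul (augmentation (ZMod 2) G u) .one)
    rwa [Algebra.smul_def, mul_one, sub_add_cancel] at this
  induction n with
  | zero => intro u _; exact top u
  | succ n ih =>
    intro u hu
    rw [Submodule.pow_succ] at hu
    refine Submodule.mul_induction_on hu ?_ ?_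
    · intro p hp q hq
      refine (ih p hp).mul ?_
      have := all q
      rwa [show augmentation (ZMod 2) G q = 0 from hq, map_zero, sub_zero] at this
    · intro p q hp hq; exact hp.add hq

/-- The dimension series over `𝔽₂` is the fastest descending restricted `N`-series with finite
quotients: it lies below any other one. -/
theorem dimSubgroup_le_of_isRestrictedSeries {H : ℕ → Subgroup G} (hH : IsRestrictedSeries H)
    (hfin : ∀ n, (H n).FiniteIndex) (n : ℕ) : dimSubgroup (ZMod 2) G n ≤ H n := by
  have : (H n).Normal := ⟨fun h hh g => hH.conj hh g⟩
  have := hfin n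
  set π := QuotientGroup.mk' (H n) with hπ
  have hsurj : Function.Surjective π := QuotientGroup.mk'_surjective _
  have hser : IsRestrictedSeries fun i => (H i).map π := by
    refine ⟨?_, ?_, ?_, ?_, ?_⟩
    · simp only [hH.zero, ← MonoidHom.range_eq_map]; exact MonoidHom.range_eq_top.mpr hsurj
    · simp only [hH.one, ← MonoidHom.range_eq_map]; exact MonoidHom.range_eq_top.mpr hsurj
    · intro i j hij; exact Subgroup.map_mono (hH.anti hij)
    · rintro i j _ _ ⟨g, hg, rfl⟩ ⟨h, hh, rfl⟩
      exact ⟨⁅g, h⁆, hH.comm i j g h hg hh, map_commutatorElement π g h⟩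
    · rintro i _ ⟨g, hg, rfl⟩
      exact ⟨g ^ 2, hH.sq i g hg, map_pow π g 2⟩
  have hbot : (H n).map π = ⊥ := by
    rw [eq_bot_iff]
    rintro _ ⟨g, hg, rfl⟩
    exact (QuotientGroup.eq_one_iff g).mpr hg
  have : Fact (Nat.Prime 2) := ⟨Nat.prime_two⟩
  have hpow : ∀ k (q : G ⧸ H n), q ^ 2 ^ k ∈ (H (2 ^ k)).map π := by
    intro k q
    induction k with
    | zero => simp only [pow_zero]; rw [hser.one]; trivial
    | succ k ih =>
      have := hser.sq _ _ ih
      rwa [← pow_mul, ← pow_succ, ← pow_succ'] at this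
  have hp : IsPGroup 2 (G ⧸ H n) := by
    intro q
    refine ⟨n, ?_⟩
    have := hser.anti (Nat.lt_two_pow_self (n := n)).le (hpow n q)
    simp only [hbot, Subgroup.mem_bot] at this
    exact this
  obtain ⟨e, he⟩ := IsPGroup.iff_card.mp hp
  intro g hg
  -- The projection to the quotient maps `Δⁿ` into `Δⁿ`.
  have hmap : ∀ (m : ℕ) (u : MonoidAlgebra (ZMod 2) G), u ∈ augIdeal (ZMod 2) G ^ m →
      MonoidAlgebra.mapDomainAlgHom (ZMod 2) (ZMod 2) π u ∈ augIdeal (ZMod 2) (G ⧸ H n) ^ m := by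
    intro m
    induction m with
    | zero => intro u _; rw [Submodule.pow_zero]; simp
    | succ m ih =>
      intro u hu
      rw [Submodule.pow_succ] at hu ⊢
      refine Submodule.mul_induction_on hu ?_ ?_
      · intro p hp q hq
        rw [map_mul]
        refine Submodule.mul_mem_mul (ih p hp) ?_
        have hc : (augmentation (ZMod 2) (G ⧸ H n)).comp
            (MonoidAlgebra.mapDomainAlgHom (ZMod 2) (ZMod 2) π) = augmentation (ZMod 2) G := by
          ext y; simp [augmentation]
        change augmentation (ZMod 2) (G ⧸ H n) _ = 0
        rw [← AlgHom.comp_apply, hc]; exact hq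
      · intro p q hp hq; rw [map_add]; exact add_mem hp hq
  have hg' := hmap n _ hg
  have e1 : MonoidAlgebra.mapDomainAlgHom (ZMod 2) (ZMod 2) π (toAlg (ZMod 2) g - 1) =
      toAlg (ZMod 2) (π g) - 1 := by
    rw [map_sub, map_one]; simp [toAlg]
  rw [e1] at hg'
  have := WeightSpan.mem_of_sub_one hser hbot e ⊤
    (by rw [← he]; exact Nat.card_congr Subgroup.topEquiv.toEquiv) n (π g) trivial
    (weightSpan_of_mem_augIdeal_pow hser n _ hg')
  simp only [hbot, Subgroup.mem_bot] at this
  exact (QuotientGroup.eq_one_iff g).mp this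

end Jennings

end

noncomputable section

namespace Grigorchuk

/-! ### Tree automorphisms as pairs -/

/-- The underlying map of `pair`. -/
def pairFun (g₀ g₁ : Word → Word) : Word → Word
  | [] => []
  | s :: w => if s = 0 then 0 :: g₀ w else 1 :: g₁ w

theorem letter_cases (s : ZMod 2) : s = 0 ∨ s = 1 := by revert s; decide

theorem pairFun_comp {g₀ g₁ h₀ h₁ : Word → Word} (h : ∀ w, g₀ (h₀ w) = w)
    (h' : ∀ w, g₁ (h₁ w) = w) (w : Word) : pairFun g₀ g₁ (pairFun h₀ h₁ w) = w := by
  rcases w with _ | ⟨s, w⟩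
  · rfl
  · rcases letter_cases s with rfl | rfl <;> simp [pairFun, h, h']

/-- The automorphism `(g₀, g₁)`: it acts by `g₀` on the subtree at `0` and by `g₁` on the
subtree at `1`. -/
def pair (g₀ g₁ : Equiv.Perm Word) : Equiv.Perm Word where
  toFun := pairFun g₀ g₁
  invFun := pairFun g₀.symm g₁.symm
  left_inv := pairFun_comp g₀.symm_apply_apply g₁.symm_apply_apply
  right_inv := pairFun_comp g₀.apply_symm_apply g₁.apply_symm_apply

@[simp] theorem pair_nil (g₀ g₁ : Equiv.Perm Word) : pair g₀ g₁ [] = [] := rfl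
@[simp] theorem pair_zero (g₀ g₁ : Equiv.Perm Word) (w : Word) :
    pair g₀ g₁ (0 :: w) = 0 :: g₀ w := rfl
@[simp] theorem pair_one (g₀ g₁ : Equiv.Perm Word) (w : Word) :
    pair g₀ g₁ (1 :: w) = 1 :: g₁ w := rfl

/-- Extensionality on words, by the first letter. -/
theorem perm_ext {g h : Equiv.Perm Word} (hn : g [] = h []) (h0 : ∀ w, g (0 :: w) = h (0 :: w))
    (h1 : ∀ w, g (1 :: w) = h (1 :: w)) : g = h := by
  ext1 w
  rcases w with _ | ⟨s, w⟩
  · exact hn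
  · rcases letter_cases s with rfl | rfl
    · exact h0 w
    · exact h1 w

theorem pair_mul (g₀ g₁ h₀ h₁ : Equiv.Perm Word) :
    pair g₀ g₁ * pair h₀ h₁ = pair (g₀ * h₀) (g₁ * h₁) :=
  perm_ext rfl (fun _ => rfl) (fun _ => rfl)

theorem pair_inv (g₀ g₁ : Equiv.Perm Word) : (pair g₀ g₁)⁻¹ = pair g₀⁻¹ g₁⁻¹ := rfl

@[simp] theorem pair_one_one : pair 1 1 = 1 := perm_ext rfl (fun _ => rfl) (fun _ => rfl)

theorem pair_injective {g₀ g₁ h₀ h₁ : Equiv.Perm Word} (h : pair g₀ g₁ = pair h₀ h₁) :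
    g₀ = h₀ ∧ g₁ = h₁ := by
  constructor
  · ext1 w
    have := congrArg (fun f : Equiv.Perm Word => f (0 :: w)) h
    simpa using this
  · ext1 w
    have := congrArg (fun f : Equiv.Perm Word => f (1 :: w)) h
    simpa using this

theorem pair_pow_two (g₀ g₁ : Equiv.Perm Word) : pair g₀ g₁ ^ 2 = pair (g₀ ^ 2) (g₁ ^ 2) := by
  simp only [pow_two, pair_mul]

theorem pair_commutator (g₀ g₁ h₀ h₁ : Equiv.Perm Word) :
    ⁅pair g₀ g₁, pair h₀ h₁⁆ = pair ⁅g₀, h₀⁆ ⁅g₁, h₁⁆ := by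
  simp only [commutatorElement_def, pair_inv, pair_mul]

theorem pair_conj (u₀ u₁ g₀ g₁ : Equiv.Perm Word) :
    pair u₀ u₁ * pair g₀ g₁ * (pair u₀ u₁)⁻¹ = pair (u₀ * g₀ * u₀⁻¹) (u₁ * g₁ * u₁⁻¹) := by
  simp only [pair_inv, pair_mul]

theorem a_apply_cons (s : ZMod 2) (w : Word) : a (s :: w) = (1 - s) :: w := rfl

theorem a_mul_self : a * a = 1 := by
  ext1 w; exact aFun_invol w

theorem b_mul_self : b * b = 1 := by
  ext1 w; exact (bcdFun_invol w).1

theorem c_mul_self : c * c = 1 := by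
  ext1 w; exact (bcdFun_invol w).2.1

theorem d_mul_self : d * d = 1 := by
  ext1 w; exact (bcdFun_invol w).2.2

theorem a_inv : a⁻¹ = a := inv_eq_of_mul_eq_one_left a_mul_self
theorem b_inv : b⁻¹ = b := inv_eq_of_mul_eq_one_left b_mul_self
theorem c_inv : c⁻¹ = c := inv_eq_of_mul_eq_one_left c_mul_self
theorem d_inv : d⁻¹ = d := inv_eq_of_mul_eq_one_left d_mul_self

theorem b_eq : b = pair a c := by
  refine perm_ext ?_ (fun w => ?_) (fun w => ?_)
  · exact bFun.eq_1
  · change bFun (0 :: w) = _; rw [bFun]; rfl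
  · change bFun (1 :: w) = _; rw [bFun]; rfl

theorem c_eq : c = pair a d := by
  refine perm_ext ?_ (fun w => ?_) (fun w => ?_)
  · exact cFun.eq_1
  · change cFun (0 :: w) = _; rw [cFun]; rfl
  · change cFun (1 :: w) = _; rw [cFun]; rfl

theorem d_eq : d = pair 1 b := by
  refine perm_ext ?_ (fun w => ?_) (fun w => ?_)
  · exact dFun.eq_1
  · change dFun (0 :: w) = _; rw [dFun]; rfl
  · change dFun (1 :: w) = _; rw [dFun]; rfl

theorem a_mul_pair (g₀ g₁ : Equiv.Perm Word) : a * pair g₀ g₁ = pair g₁ g₀ * a := by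
  refine perm_ext rfl (fun w => ?_) (fun w => ?_)
  · simp [Equiv.Perm.mul_apply, a_apply_cons]
  · simp [Equiv.Perm.mul_apply, a_apply_cons]

theorem a_conj_pair (g₀ g₁ : Equiv.Perm Word) : a * pair g₀ g₁ * a = pair g₁ g₀ := by
  rw [a_mul_pair, mul_assoc, a_mul_self, mul_one]

theorem a_mul_pair_a_mul (g₀ g₁ : Equiv.Perm Word) (h : Equiv.Perm Word) :
    a * (pair g₀ g₁ * h) = pair g₁ g₀ * (a * h) := by
  rw [← mul_assoc, a_mul_pair, mul_assoc]

/-- The Klein four-group relations between `b`, `c` and `d`. -/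
theorem klein : b * c = d ∧ c * d = b ∧ d * b = c := by
  have key : ∀ w : Word, b (c w) = d w ∧ c (d w) = b w ∧ d (b w) = c w := by
    intro w
    induction w with
    | nil =>
      have hb : b [] = [] := bFun.eq_1
      have hc : c [] = [] := cFun.eq_1
      have hd : d [] = [] := dFun.eq_1
      simp [hb, hc, hd]
    | cons s w ih =>
      obtain ⟨h1, h2, h3⟩ := ih
      have ha : ∀ w, a (a w) = w := fun w => aFun_invol w
      rcases letter_cases s with rfl | rfl
      · rw [b_eq, c_eq, d_eq]; simp [ha]
      · have hb : ∀ w, b (1 :: w) = 1 :: c w := fun w => by rw [b_eq]; rfl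
        have hc : ∀ w, c (1 :: w) = 1 :: d w := fun w => by rw [c_eq]; rfl
        have hd : ∀ w, d (1 :: w) = 1 :: b w := fun w => by rw [d_eq]; rfl
        simp only [hb, hc, hd, h1, h2, h3, and_self]
  exact ⟨Equiv.ext fun w => (key w).1, Equiv.ext fun w => (key w).2.1,
    Equiv.ext fun w => (key w).2.2⟩

theorem bc : b * c = d := klein.1
theorem cd : c * d = b := klein.2.1
theorem db : d * b = c := klein.2.2

theorem cb : c * b = d := by
  rw [← d_inv, ← bc, mul_inv_rev, b_inv, c_inv]
theorem dc : d * c = b := by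
  rw [← b_inv, ← cd, mul_inv_rev, c_inv, d_inv]
theorem bd : b * d = c := by
  rw [← c_inv, ← db, mul_inv_rev, d_inv, b_inv]

theorem a_mem : a ∈ GG := Subgroup.subset_closure (by simp)
theorem b_mem : b ∈ GG := Subgroup.subset_closure (by simp)
theorem c_mem : c ∈ GG := Subgroup.subset_closure (by simp)
theorem d_mem : d ∈ GG := Subgroup.subset_closure (by simp)

/-- Every element of Grigorchuk's group is `(g₀, g₁)` or `(g₀, g₁) a`. -/
theorem exists_pair {g : Equiv.Perm Word} (hg : g ∈ GG) :
    ∃ g₀ ∈ GG, ∃ g₁ ∈ GG, g = pair g₀ g₁ ∨ g = pair g₀ g₁ * a := by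
  induction hg using Subgroup.closure_induction with
  | mem y hy =>
    simp only [Set.mem_insert_iff, Set.mem_singleton_iff] at hy
    rcases hy with rfl | rfl | rfl | rfl
    · exact ⟨1, one_mem _, 1, one_mem _, Or.inr (by simp)⟩
    · exact ⟨a, a_mem, c, c_mem, Or.inl b_eq⟩
    · exact ⟨a, a_mem, d, d_mem, Or.inl c_eq⟩
    · exact ⟨1, one_mem _, b, b_mem, Or.inl d_eq⟩
  | one => exact ⟨1, one_mem _, 1, one_mem _, Or.inl (by simp)⟩
  | mul y z _ _ hy hz =>
    obtain ⟨g₀, m0, g₁, m1, rfl | rfl⟩ := hy <;> obtain ⟨h₀, n0, h₁, n1, rfl | rfl⟩ := hz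
    · exact ⟨_, mul_mem m0 n0, _, mul_mem m1 n1, Or.inl (pair_mul _ _ _ _)⟩
    · exact ⟨_, mul_mem m0 n0, _, mul_mem m1 n1, Or.inr (by rw [← mul_assoc, pair_mul])⟩
    · exact ⟨_, mul_mem m0 n1, _, mul_mem m1 n0,
        Or.inr (by rw [mul_assoc, a_mul_pair, ← mul_assoc, pair_mul])⟩
    · exact ⟨_, mul_mem m0 n1, _, mul_mem m1 n0, Or.inl (by
        rw [mul_assoc, a_mul_pair_a_mul, a_mul_self, mul_one, pair_mul])⟩
  | inv y _ hy =>
    obtain ⟨g₀, m0, g₁, m1, rfl | rfl⟩ := hy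
    · exact ⟨_, inv_mem m0, _, inv_mem m1, Or.inl (pair_inv _ _)⟩
    · exact ⟨_, inv_mem m1, _, inv_mem m0, Or.inr (by
        rw [mul_inv_rev, a_inv, pair_inv, a_mul_pair])⟩

/-- The portrait of `g` at the vertex `w`: the amount by which `g` changes the letter that
follows `w`. -/
def bit (g : Equiv.Perm Word) (w : Word) : ZMod 2 := (g (w ++ [0])).getD w.length 0

@[simp] theorem bit_pair_nil (g₀ g₁ : Equiv.Perm Word) : bit (pair g₀ g₁) [] = 0 := rfl
@[simp] theorem bit_pair_zero (g₀ g₁ : Equiv.Perm Word) (w : Word) :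
    bit (pair g₀ g₁) (0 :: w) = bit g₀ w := by simp [bit]
@[simp] theorem bit_pair_one (g₀ g₁ : Equiv.Perm Word) (w : Word) :
    bit (pair g₀ g₁) (1 :: w) = bit g₁ w := by simp [bit]
@[simp] theorem bit_pair_mul_a_nil (g₀ g₁ : Equiv.Perm Word) : bit (pair g₀ g₁ * a) [] = 1 := by
  simp [bit, a_apply_cons]
@[simp] theorem bit_pair_mul_a_zero (g₀ g₁ : Equiv.Perm Word) (w : Word) :
    bit (pair g₀ g₁ * a) (0 :: w) = bit g₁ w := by simp [bit, a_apply_cons]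
@[simp] theorem bit_pair_mul_a_one (g₀ g₁ : Equiv.Perm Word) (w : Word) :
    bit (pair g₀ g₁ * a) (1 :: w) = bit g₀ w := by simp [bit, a_apply_cons]


/-- The sum of the portrait of `g` over level `1`. -/
def bitSum₁ (g : Equiv.Perm Word) : ZMod 2 := bit g [0] + bit g [1]

/-- The sum of the portrait of `g` over level `2`. -/
def bitSum₂ (g : Equiv.Perm Word) : ZMod 2 :=
  bit g [0, 0] + bit g [0, 1] + (bit g [1, 0] + bit g [1, 1])

@[simp] theorem bitSum₁_pair (g₀ g₁ : Equiv.Perm Word) :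
    bitSum₁ (pair g₀ g₁) = bit g₀ [] + bit g₁ [] := by simp [bitSum₁]
@[simp] theorem bitSum₁_pair_mul_a (g₀ g₁ : Equiv.Perm Word) :
    bitSum₁ (pair g₀ g₁ * a) = bit g₀ [] + bit g₁ [] := by simp [bitSum₁, add_comm]
@[simp] theorem bitSum₂_pair (g₀ g₁ : Equiv.Perm Word) :
    bitSum₂ (pair g₀ g₁) = bitSum₁ g₀ + bitSum₁ g₁ := by simp [bitSum₁, bitSum₂]
@[simp] theorem bitSum₂_pair_mul_a (g₀ g₁ : Equiv.Perm Word) :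
    bitSum₂ (pair g₀ g₁ * a) = bitSum₁ g₀ + bitSum₁ g₁ := by simp [bitSum₁, bitSum₂, add_comm]

theorem pair_mul_a_mul_pair (g₀ g₁ h₀ h₁ : Equiv.Perm Word) :
    pair g₀ g₁ * a * pair h₀ h₁ = pair (g₀ * h₁) (g₁ * h₀) * a := by
  rw [mul_assoc, a_mul_pair, ← mul_assoc, pair_mul]

theorem pair_mul_a_mul_pair_mul_a (g₀ g₁ h₀ h₁ : Equiv.Perm Word) :
    pair g₀ g₁ * a * (pair h₀ h₁ * a) = pair (g₀ * h₁) (g₁ * h₀) := by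
  rw [mul_assoc, a_mul_pair_a_mul, a_mul_self, mul_one, pair_mul]

theorem pair_mul_pair_mul_a (g₀ g₁ h₀ h₁ : Equiv.Perm Word) :
    pair g₀ g₁ * (pair h₀ h₁ * a) = pair (g₀ * h₀) (g₁ * h₁) * a := by
  rw [← mul_assoc, pair_mul]

theorem bit_mul {g h : Equiv.Perm Word} (hg : g ∈ GG) (hh : h ∈ GG) :
    bit (g * h) [] = bit g [] + bit h [] := by
  obtain ⟨g₀, -, g₁, -, rfl | rfl⟩ := exists_pair hg <;>
    obtain ⟨h₀, -, h₁, -, rfl | rfl⟩ := exists_pair hh <;>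
    simp [pair_mul, pair_mul_a_mul_pair, pair_mul_a_mul_pair_mul_a, pair_mul_pair_mul_a]
  decide

/-- If `f` is additive on `𝔊`, then so is any function that is the sum of the values of `f` at
the two sections. -/
theorem additive_of_sections {f f' : Equiv.Perm Word → ZMod 2}
    (hf : ∀ g ∈ GG, ∀ h ∈ GG, f (g * h) = f g + f h)
    (h1 : ∀ g₀ g₁, f' (pair g₀ g₁) = f g₀ + f g₁)
    (h2 : ∀ g₀ g₁, f' (pair g₀ g₁ * a) = f g₀ + f g₁) {g h : Equiv.Perm Word}
    (hg : g ∈ GG) (hh : h ∈ GG) : f' (g * h) = f' g + f' h := by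
  obtain ⟨g₀, m0, g₁, m1, rfl | rfl⟩ := exists_pair hg <;>
    obtain ⟨h₀, n0, h₁, n1, rfl | rfl⟩ := exists_pair hh
  · rw [pair_mul, h1, h1, h1, hf _ m0 _ n0, hf _ m1 _ n1]; abel
  · rw [pair_mul_pair_mul_a, h1, h2, h2, hf _ m0 _ n0, hf _ m1 _ n1]; abel
  · rw [pair_mul_a_mul_pair, h1, h2, h2, hf _ m0 _ n1, hf _ m1 _ n0]; abel
  · rw [pair_mul_a_mul_pair_mul_a, h1, h2, h2, hf _ m0 _ n1, hf _ m1 _ n0]; abel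

theorem bitSum₁_mul {g h : Equiv.Perm Word} (hg : g ∈ GG) (hh : h ∈ GG) :
    bitSum₁ (g * h) = bitSum₁ g + bitSum₁ h :=
  additive_of_sections (f := fun g => bit g []) (fun _ h1 _ h2 => bit_mul h1 h2)
    bitSum₁_pair bitSum₁_pair_mul_a hg hh

theorem bitSum₂_mul {g h : Equiv.Perm Word} (hg : g ∈ GG) (hh : h ∈ GG) :
    bitSum₂ (g * h) = bitSum₂ g + bitSum₂ h :=
  additive_of_sections (fun _ h1 _ h2 => bitSum₁_mul h1 h2)
    bitSum₂_pair bitSum₂_pair_mul_a hg hh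

/-- The abelianization of Grigorchuk's group: the sums of the portrait over the levels `0`, `1`
and `2`. -/
def abel : GG →* Multiplicative (ZMod 2 × ZMod 2 × ZMod 2) where
  toFun g := Multiplicative.ofAdd (bit g [], bitSum₁ g, bitSum₂ g)
  map_one' := by
    change Multiplicative.ofAdd (bit 1 [], bitSum₁ 1, bitSum₂ 1) = _
    simp [bitSum₁, bitSum₂, bit]
  map_mul' g h := by
    rw [← ofAdd_add, Prod.mk_add_mk, Prod.mk_add_mk, ← bit_mul g.2 h.2, ← bitSum₁_mul g.2 h.2,
      ← bitSum₂_mul g.2 h.2]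
    rfl

theorem bits_one : bit 1 [] = 0 ∧ bitSum₁ 1 = 0 ∧ bitSum₂ 1 = 0 := by
  simp [bitSum₁, bitSum₂, bit]

theorem bits_a : bit a [] = 1 ∧ bitSum₁ a = 0 ∧ bitSum₂ a = 0 := by
  simp [bitSum₁, bitSum₂, bit, a_apply_cons]

theorem bits_b : bit b [] = 0 ∧ bitSum₁ b = 1 ∧ bitSum₂ b = 1 := by
  rw [b_eq, c_eq, d_eq]
  refine ⟨rfl, ?_, ?_⟩
  · rw [bitSum₁_pair, bits_a.1]; rfl
  · rw [bitSum₂_pair, bits_a.2.1, bitSum₁_pair, bits_a.1]; rfl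

theorem bits_c : bit c [] = 0 ∧ bitSum₁ c = 1 ∧ bitSum₂ c = 0 := by
  rw [c_eq, d_eq]
  refine ⟨rfl, ?_, ?_⟩
  · rw [bitSum₁_pair, bits_a.1]; rfl
  · rw [bitSum₂_pair, bits_a.2.1, bitSum₁_pair, bits_b.1, bits_one.1]; rfl

theorem bits_d : bit d [] = 0 ∧ bitSum₁ d = 0 ∧ bitSum₂ d = 1 := by
  rw [d_eq]
  refine ⟨rfl, ?_, ?_⟩
  · rw [bitSum₁_pair, bits_b.1, bits_one.1]; rfl
  · rw [bitSum₂_pair, bits_b.2.1, bits_one.2.1]; rfl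

/-- The sum of the three coordinates of the abelianization. -/
def bitSum (g : Equiv.Perm Word) : ZMod 2 := bit g [] + bitSum₁ g + bitSum₂ g

theorem bitSum_mul {g h : Equiv.Perm Word} (hg : g ∈ GG) (hh : h ∈ GG) :
    bitSum (g * h) = bitSum g + bitSum h := by
  simp only [bitSum, bit_mul hg hh, bitSum₁_mul hg hh, bitSum₂_mul hg hh]; abel

theorem bitSum_inv {g : Equiv.Perm Word} (hg : g ∈ GG) : bitSum g⁻¹ = bitSum g := by
  have h1 := bitSum_mul (inv_mem hg) hg
  rw [inv_mul_cancel] at h1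
  have h0 : bitSum 1 = 0 := by simp [bitSum, bits_one]
  rw [h0] at h1
  revert h1; generalize bitSum g⁻¹ = p; generalize bitSum g = q; revert p q; decide

/-- The two sections of an element of `𝔊` agree under `bitSum`; the image of the stabilizer of
level `1` in `𝔊 × 𝔊` is a proper subgroup. -/
theorem exists_pair_bitSum {g : Equiv.Perm Word} (hg : g ∈ GG) :
    ∃ g₀ ∈ GG, ∃ g₁ ∈ GG, bitSum g₀ = bitSum g₁ ∧ (g = pair g₀ g₁ ∨ g = pair g₀ g₁ * a) := by
  induction hg using Subgroup.closure_induction with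
  | mem y hy =>
    simp only [Set.mem_insert_iff, Set.mem_singleton_iff] at hy
    rcases hy with rfl | rfl | rfl | rfl
    · exact ⟨1, one_mem _, 1, one_mem _, rfl, Or.inr (by simp)⟩
    · exact ⟨a, a_mem, c, c_mem, by simp [bitSum, bits_a, bits_c], Or.inl b_eq⟩
    · exact ⟨a, a_mem, d, d_mem, by simp [bitSum, bits_a, bits_d], Or.inl c_eq⟩
    · exact ⟨1, one_mem _, b, b_mem, by simp [bitSum, bits_b, bits_one]; decide, Or.inl d_eq⟩
  | one => exact ⟨1, one_mem _, 1, one_mem _, rfl, Or.inl (by simp)⟩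
  | mul y z _ _ hy hz =>
    obtain ⟨g₀, m0, g₁, m1, e, rfl | rfl⟩ := hy <;> obtain ⟨h₀, n0, h₁, n1, f, rfl | rfl⟩ := hz
    · exact ⟨_, mul_mem m0 n0, _, mul_mem m1 n1, by rw [bitSum_mul m0 n0, bitSum_mul m1 n1, e, f],
        Or.inl (pair_mul _ _ _ _)⟩
    · exact ⟨_, mul_mem m0 n0, _, mul_mem m1 n1, by rw [bitSum_mul m0 n0, bitSum_mul m1 n1, e, f],
        Or.inr (pair_mul_pair_mul_a _ _ _ _)⟩
    · exact ⟨_, mul_mem m0 n1, _, mul_mem m1 n0, by rw [bitSum_mul m0 n1, bitSum_mul m1 n0, e, f],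
        Or.inr (pair_mul_a_mul_pair _ _ _ _)⟩
    · exact ⟨_, mul_mem m0 n1, _, mul_mem m1 n0, by rw [bitSum_mul m0 n1, bitSum_mul m1 n0, e, f],
        Or.inl (pair_mul_a_mul_pair_mul_a _ _ _ _)⟩
  | inv y _ hy =>
    obtain ⟨g₀, m0, g₁, m1, e, rfl | rfl⟩ := hy
    · exact ⟨_, inv_mem m0, _, inv_mem m1, by rw [bitSum_inv m0, bitSum_inv m1, e],
        Or.inl (pair_inv _ _)⟩
    · exact ⟨_, inv_mem m1, _, inv_mem m0, by rw [bitSum_inv m0, bitSum_inv m1, e], Or.inr (by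
        rw [mul_inv_rev, a_inv, pair_inv, a_mul_pair])⟩

theorem pair_ne_pair_mul_a (g₀ g₁ h₀ h₁ : Equiv.Perm Word) : pair g₀ g₁ ≠ pair h₀ h₁ * a := by
  intro h
  have := congrArg (fun f => bit f []) h
  simp at this

theorem mem_of_pair_mem {g₀ g₁ : Equiv.Perm Word} (h : pair g₀ g₁ ∈ GG) :
    g₀ ∈ GG ∧ g₁ ∈ GG ∧ bitSum g₀ = bitSum g₁ := by
  obtain ⟨h₀, m0, h₁, m1, e, h' | h'⟩ := exists_pair_bitSum h
  · obtain ⟨rfl, rfl⟩ := pair_injective h'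
    exact ⟨m0, m1, e⟩
  · exact absurd h' (pair_ne_pair_mul_a _ _ _ _)

theorem exists_pair_of_bit {g : Equiv.Perm Word} (hg : g ∈ GG) (h0 : bit g [] = 0) :
    ∃ g₀ g₁, g = pair g₀ g₁ := by
  obtain ⟨g₀, -, g₁, -, rfl | rfl⟩ := exists_pair hg
  · exact ⟨_, _, rfl⟩
  · simp at h0

theorem pair_swap_mem {g₀ g₁ : Equiv.Perm Word} (h : pair g₀ g₁ ∈ GG) : pair g₁ g₀ ∈ GG := by
  rw [← a_conj_pair]
  exact mul_mem (mul_mem a_mem h) a_mem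

/-- The stabilizer of level `1` projects onto `𝔊` in the first coordinate. -/
theorem exists_pair_left {g : Equiv.Perm Word} (hg : g ∈ GG) : ∃ h, pair g h ∈ GG := by
  induction hg using Subgroup.closure_induction with
  | mem y hy =>
    simp only [Set.mem_insert_iff, Set.mem_singleton_iff] at hy
    rcases hy with rfl | rfl | rfl | rfl
    · exact ⟨c, b_eq ▸ b_mem⟩
    · exact ⟨1, pair_swap_mem (d_eq ▸ d_mem)⟩
    · exact ⟨a, pair_swap_mem (b_eq ▸ b_mem)⟩
    · exact ⟨a, pair_swap_mem (c_eq ▸ c_mem)⟩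
  | one => exact ⟨1, by simp⟩
  | mul y z _ _ hy hz =>
    obtain ⟨h, hh⟩ := hy
    obtain ⟨k, hk⟩ := hz
    exact ⟨h * k, by rw [← pair_mul]; exact mul_mem hh hk⟩
  | inv y _ hy =>
    obtain ⟨h, hh⟩ := hy
    exact ⟨h⁻¹, by rw [← pair_inv]; exact inv_mem hh⟩

/-! ### Levels and vertices -/

theorem level_zero (Q : Subgroup (Equiv.Perm Word)) : level Q 0 = Q := by
  ext g
  constructor
  · rintro ⟨-, h⟩
    obtain ⟨q, hq, e⟩ := h [] rfl
    have : g = q := Equiv.ext e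
    rwa [this]
  · intro hg
    refine ⟨fun w hw => absurd hw (Nat.not_lt_zero _), fun σ hσ => ⟨g, hg, fun w => ?_⟩⟩
    rw [List.length_eq_zero_iff.mp hσ]; rfl

theorem pair_mem_level_succ {Q : Subgroup (Equiv.Perm Word)} {m : ℕ} {g₀ g₁ : Equiv.Perm Word} :
    pair g₀ g₁ ∈ level Q (m + 1) ↔ g₀ ∈ level Q m ∧ g₁ ∈ level Q m := by
  constructor
  · rintro ⟨h1, h2⟩
    refine ⟨⟨fun w hw => ?_, fun σ hσ => ?_⟩, ⟨fun w hw => ?_, fun σ hσ => ?_⟩⟩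
    · simpa using h1 (0 :: w) (by simpa using hw)
    · obtain ⟨q, hq, e⟩ := h2 (0 :: σ) (by simpa using hσ)
      exact ⟨q, hq, fun w => by simpa using e w⟩
    · simpa using h1 (1 :: w) (by simpa using hw)
    · obtain ⟨q, hq, e⟩ := h2 (1 :: σ) (by simpa using hσ)
      exact ⟨q, hq, fun w => by simpa using e w⟩
  · rintro ⟨⟨h1, h2⟩, ⟨k1, k2⟩⟩
    refine ⟨fun w hw => ?_, fun σ hσ => ?_⟩
    · rcases w with _ | ⟨s, w⟩
      · rfl
      · rcases letter_cases s with rfl | rfl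
        · rw [pair_zero, h1 w (by simpa using hw)]
        · rw [pair_one, k1 w (by simpa using hw)]
    · rcases σ with _ | ⟨s, σ⟩
      · simp at hσ
      · rcases letter_cases s with rfl | rfl
        · obtain ⟨q, hq, e⟩ := h2 σ (by simpa using hσ)
          exact ⟨q, hq, fun w => by rw [List.cons_append, pair_zero, e]; rfl⟩
        · obtain ⟨q, hq, e⟩ := k2 σ (by simpa using hσ)
          exact ⟨q, hq, fun w => by rw [List.cons_append, pair_one, e]; rfl⟩

theorem exists_pair_of_preserves {g : Equiv.Perm Word} (hn : g [] = [])
    (h : ∀ s w, ∃ w', g (s :: w) = s :: w') (h' : ∀ s w, ∃ w', g⁻¹ (s :: w) = s :: w') :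
    ∃ g₀ g₁, g = pair g₀ g₁ := by
  have key : ∀ s : ZMod 2, ∃ k : Equiv.Perm Word, ∀ w, g (s :: w) = s :: k w := by
    intro s
    have e1 : ∀ w, g (s :: w) = s :: (g (s :: w)).tail := fun w => by
      obtain ⟨w', hw⟩ := h s w; rw [hw]; rfl
    have e2 : ∀ w, g⁻¹ (s :: w) = s :: (g⁻¹ (s :: w)).tail := fun w => by
      obtain ⟨w', hw⟩ := h' s w; rw [hw]; rfl
    refine ⟨⟨fun w => (g (s :: w)).tail, fun w => (g⁻¹ (s :: w)).tail, fun w => ?_, fun w => ?_⟩,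
      e1⟩
    · change (g⁻¹ (s :: (g (s :: w)).tail)).tail = w
      rw [← e1]; simp
    · change (g (s :: (g⁻¹ (s :: w)).tail)).tail = w
      rw [← e2]; simp
  obtain ⟨k₀, e0⟩ := key 0
  obtain ⟨k₁, e1⟩ := key 1
  exact ⟨k₀, k₁, perm_ext hn e0 e1⟩

/-- `Q_{m+1} = Q_m × Q_m`. -/
theorem mem_level_succ {Q : Subgroup (Equiv.Perm Word)} {m : ℕ} {g : Equiv.Perm Word} :
    g ∈ level Q (m + 1) ↔ ∃ g₀ ∈ level Q m, ∃ g₁ ∈ level Q m, g = pair g₀ g₁ := by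
  constructor
  · intro hg
    have pres : ∀ g ∈ level Q (m + 1), ∀ s w, ∃ w', g (s :: w) = s :: w' := by
      rintro g ⟨h1, h2⟩ s w
      by_cases hw : w.length < m
      · exact ⟨w, h1 _ (by simpa using hw)⟩
      · obtain ⟨q, -, e⟩ := h2 (s :: w.take m) (by simp; lia)
        have := e (w.drop m)
        rw [List.cons_append, List.take_append_drop] at this
        exact ⟨_, this⟩
    obtain ⟨g₀, g₁, rfl⟩ := exists_pair_of_preserves (hg.1 [] (by simp)) (pres g hg)
      (pres _ (inv_mem hg))
    obtain ⟨m0, m1⟩ := pair_mem_level_succ.mp hg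
    exact ⟨g₀, m0, g₁, m1, rfl⟩
  · rintro ⟨g₀, h0, g₁, h1, rfl⟩
    exact pair_mem_level_succ.mpr ⟨h0, h1⟩

theorem atVertex_nil (g : Equiv.Perm Word) : atVertex [] g = g := rfl

theorem atVertex_zero_cons (σ : Word) (g : Equiv.Perm Word) :
    atVertex (0 :: σ) g = pair (atVertex σ g) 1 := by
  refine perm_ext rfl (fun w => ?_) (fun w => ?_)
  · change atVertexFun g (0 :: σ) (0 :: w) = _; simp [atVertexFun]; rfl
  · change atVertexFun g (0 :: σ) (1 :: w) = _; simp [atVertexFun]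

theorem atVertex_one_cons (σ : Word) (g : Equiv.Perm Word) :
    atVertex (1 :: σ) g = pair 1 (atVertex σ g) := by
  refine perm_ext rfl (fun w => ?_) (fun w => ?_)
  · change atVertexFun g (1 :: σ) (0 :: w) = _; simp [atVertexFun]
  · change atVertexFun g (1 :: σ) (1 :: w) = _; simp [atVertexFun]; rfl

/-- `𝔊` acts transitively on the levels of the tree, with arbitrary sections: any vertex can be
moved to any other vertex of its level, acting by any prescribed `g ∈ 𝔊` on the subtree. -/
theorem exists_conj_atVertex {g : Equiv.Perm Word} (hg : g ∈ GG) :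
    ∀ {σ τ : Word}, σ.length = τ.length → ∃ u ∈ GG, ∀ k,
      u * atVertex σ k * u⁻¹ = atVertex τ (g * k * g⁻¹)
  | [], [], _ => ⟨g, hg, fun _ => rfl⟩
  | s :: σ, t :: τ, h => by
    obtain ⟨u, hu, e⟩ := exists_conj_atVertex hg (σ := σ) (τ := τ) (by simpa using h)
    obtain ⟨v, hv⟩ := exists_pair_left hu
    have e00 : ∀ k, pair u v * atVertex (0 :: σ) k * (pair u v)⁻¹ =
        atVertex (0 :: τ) (g * k * g⁻¹) := by
      intro k
      rw [atVertex_zero_cons, atVertex_zero_cons, pair_conj, e, mul_one, mul_inv_cancel]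
    have ha : ∀ ρ k, a * atVertex (0 :: ρ) k * a⁻¹ = atVertex (1 :: ρ) k := by
      intro ρ k
      rw [atVertex_zero_cons, atVertex_one_cons, a_inv, a_conj_pair]
    have ha' : ∀ ρ k, a * atVertex (1 :: ρ) k * a⁻¹ = atVertex (0 :: ρ) k := by
      intro ρ k
      rw [atVertex_zero_cons, atVertex_one_cons, a_inv, a_conj_pair]
    rcases letter_cases s with rfl | rfl <;> rcases letter_cases t with rfl | rfl
    · exact ⟨_, hv, e00⟩
    · refine ⟨a * pair u v, mul_mem a_mem hv, fun k => ?_⟩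
      rw [← ha, ← e00]; group
    · refine ⟨pair u v * a, mul_mem hv a_mem, fun k => ?_⟩
      rw [← e00, ← ha' σ k]; group
    · refine ⟨a * pair u v * a, mul_mem (mul_mem a_mem hv) a_mem, fun k => ?_⟩
      rw [← ha τ, ← e00, ← ha' σ k]; group

theorem atVertex_mul (σ : Word) (g h : Equiv.Perm Word) :
    atVertex σ (g * h) = atVertex σ g * atVertex σ h := by
  induction σ with
  | nil => rfl
  | cons s σ ih =>
    rcases letter_cases s with rfl | rfl
    · rw [atVertex_zero_cons, atVertex_zero_cons, atVertex_zero_cons, pair_mul, ih, mul_one]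
    · rw [atVertex_one_cons, atVertex_one_cons, atVertex_one_cons, pair_mul, ih, mul_one]

/-- `atVertex σ` as a homomorphism. -/
def atVertexHom (σ : Word) : Equiv.Perm Word →* Equiv.Perm Word :=
  MonoidHom.mk' (atVertex σ) (atVertex_mul σ)

theorem atVertex_mem_level {Q : Subgroup (Equiv.Perm Word)} {q : Equiv.Perm Word} (hq : q ∈ Q) :
    ∀ σ : Word, atVertex σ q ∈ level Q σ.length
  | [] => by rw [atVertex_nil, List.length_nil, level_zero]; exact hq
  | s :: σ => by
    rw [List.length_cons, mem_level_succ]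
    rcases letter_cases s with rfl | rfl
    · exact ⟨_, atVertex_mem_level hq σ, 1, one_mem _, atVertex_zero_cons σ q⟩
    · exact ⟨1, one_mem _, _, atVertex_mem_level hq σ, atVertex_one_cons σ q⟩

/-- `pair` as a homomorphism on the direct product. -/
def pairHom : Equiv.Perm Word × Equiv.Perm Word →* Equiv.Perm Word :=
  MonoidHom.mk' (fun p => pair p.1 p.2) (fun _ _ => (pair_mul _ _ _ _).symm)

/-- `Q_m` is generated by the elements with a single nontrivial coordinate. -/
theorem level_le_of_atVertex {Q : Subgroup (Equiv.Perm Word)} :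
    ∀ {m : ℕ} {R : Subgroup (Equiv.Perm Word)},
      (∀ σ : Word, σ.length = m → ∀ q ∈ Q, atVertex σ q ∈ R) → level Q m ≤ R
  | 0, R, h => by rw [level_zero]; intro q hq; exact h [] rfl q hq
  | m + 1, R, h => by
    intro g hg
    obtain ⟨g₀, h0, g₁, h1, rfl⟩ := mem_level_succ.mp hg
    have l0 : level Q m ≤ R.comap (pairHom.comp (MonoidHom.inl _ _)) :=
      level_le_of_atVertex fun σ hσ q hq => by
        have := h (0 :: σ) (by simpa using hσ) q hq
        rwa [atVertex_zero_cons] at this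
    have l1 : level Q m ≤ R.comap (pairHom.comp (MonoidHom.inr _ _)) :=
      level_le_of_atVertex fun σ hσ q hq => by
        have := h (1 :: σ) (by simpa using hσ) q hq
        rwa [atVertex_one_cons] at this
    have e : pair g₀ g₁ = pair g₀ 1 * pair 1 g₁ := by rw [pair_mul, mul_one, one_mul]
    rw [e]
    exact mul_mem (l0 h0) (l1 h1)

end Grigorchuk

end

noncomputable section

namespace Grigorchuk

/-! ### Normal subgroups of Grigorchuk's group -/

/-- A subgroup of `𝔊` that is normal in `𝔊`, seen in the group of all permutations of `Σ*`. -/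
structure IsGNormal (A : Subgroup (Equiv.Perm Word)) : Prop where
  le : A ≤ GG
  conj : ∀ {u h : Equiv.Perm Word}, u ∈ GG → h ∈ A → u * h * u⁻¹ ∈ A

theorem isGNormal_GG : IsGNormal GG :=
  ⟨le_rfl, fun hu hh => mul_mem (mul_mem hu hh) (inv_mem hu)⟩

theorem commutator_mem_GG {g h : Equiv.Perm Word} (hg : g ∈ GG) (hh : h ∈ GG) : ⁅g, h⁆ ∈ GG :=
  mul_mem (mul_mem (mul_mem hg hh) (inv_mem hg)) (inv_mem hh)

theorem commutator_mem_comm {A : Subgroup (Equiv.Perm Word)} {g h : Equiv.Perm Word} :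
    ⁅g, h⁆ ∈ A ↔ ⁅h, g⁆ ∈ A := by
  rw [← commutatorElement_inv, inv_mem_iff]

theorem mul_inv_mem_symm {A : Subgroup (Equiv.Perm Word)} {g h : Equiv.Perm Word}
    (hB : g * h⁻¹ ∈ A) : h * g⁻¹ ∈ A := by
  simpa using inv_mem hB

namespace IsGNormal

variable {A B C : Subgroup (Equiv.Perm Word)} {g h u : Equiv.Perm Word}

theorem conj' (hA : IsGNormal A) (hu : u ∈ GG) (h : g ∈ A) : u⁻¹ * g * u ∈ A := by
  simpa using hA.conj (inv_mem hu) h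

theorem commutator_mem (hA : IsGNormal A) (hu : u ∈ GG) (h : g ∈ A) : ⁅u, g⁆ ∈ A :=
  mul_mem (hA.conj hu h) (inv_mem h)

theorem of_commutator (hA : A ≤ GG) (h : ∀ u ∈ GG, ∀ g ∈ A, ⁅u, g⁆ ∈ A) : IsGNormal A := by
  refine ⟨hA, fun {u g} hu hg => ?_⟩
  have : u * g * u⁻¹ = ⁅u, g⁆ * g := by simp [commutatorElement_def]
  rw [this]; exact mul_mem (h u hu g hg) hg

theorem commutator_mul_left (hA : IsGNormal A) (hg : g ∈ GG) (h1 : ⁅g, u⁆ ∈ A) (h2 : ⁅h, u⁆ ∈ A) :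
    ⁅g * h, u⁆ ∈ A := by
  have : ⁅g * h, u⁆ = (g * ⁅h, u⁆ * g⁻¹) * ⁅g, u⁆ := by simp only [commutatorElement_def]; group
  rw [this]; exact mul_mem (hA.conj hg h2) h1

theorem commutator_inv_left (hA : IsGNormal A) (hg : g ∈ GG) (h1 : ⁅g, u⁆ ∈ A) : ⁅g⁻¹, u⁆ ∈ A := by
  have : ⁅g⁻¹, u⁆ = g⁻¹ * ⁅g, u⁆⁻¹ * g := by simp only [commutatorElement_def]; group
  rw [this]; exact hA.conj' hg (inv_mem h1)

theorem mul_inv_mem_swap (hB : IsGNormal B) (h0 : g ∈ GG) (hgh : g * h⁻¹ ∈ B) :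
    h⁻¹ * g ∈ B := by
  have := hB.conj' h0 hgh
  have e : h⁻¹ * g = g⁻¹ * (g * h⁻¹) * g := by group
  rwa [e]

/-- Commutators of congruent elements are congruent. -/
theorem commutator_congr (hA : IsGNormal A) (hB : IsGNormal B) (hC : IsGNormal C)
    {g₀ g₁ h₀ h₁ : Equiv.Perm Word} (m0 : g₀ ∈ GG)
    (m1 : g₁ ∈ GG) (n0 : h₀ ∈ GG) (n1 : h₁ ∈ GG) (hg : g₀ * g₁⁻¹ ∈ B) (hh : h₀ * h₁⁻¹ ∈ C)
    (hBA : ∀ δ ∈ B, ⁅δ, h₀⁆ ∈ A) (hCA : ∀ δ ∈ C, ⁅g₁, δ⁆ ∈ A) :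
    ⁅g₀, h₀⁆ * ⁅g₁, h₁⁆⁻¹ ∈ A := by
  have e : ⁅g₀, h₀⁆ * ⁅g₁, h₁⁆⁻¹ = (g₁ * ⁅g₁⁻¹ * g₀, h₀⁆ * g₁⁻¹) *
      (⁅g₁, h₁⁆ * (h₁ * ⁅g₁, h₁⁻¹ * h₀⁆ * h₁⁻¹) * ⁅g₁, h₁⁆⁻¹) := by
    simp only [commutatorElement_def]; group
  rw [e]
  exact mul_mem (hA.conj m1 (hBA _ (hB.mul_inv_mem_swap m0 hg)))
    (hA.conj (commutator_mem_GG m1 n1) (hA.conj n1 (hCA _ (hC.mul_inv_mem_swap n0 hh))))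

/-- The elements of `𝔊` that commute with `u` modulo `A`. -/
def centralizer (hA : IsGNormal A) (u : Equiv.Perm Word) : Subgroup (Equiv.Perm Word) where
  carrier := {g | g ∈ GG ∧ ⁅g, u⁆ ∈ A}
  one_mem' := ⟨one_mem _, by rw [commutatorElement_one_left]; exact one_mem _⟩
  mul_mem' h1 h2 := ⟨mul_mem h1.1 h2.1, hA.commutator_mul_left h1.1 h1.2 h2.2⟩
  inv_mem' h1 := ⟨inv_mem h1.1, hA.commutator_inv_left h1.1 h1.2⟩

theorem GG_le_centralizer (hA : IsGNormal A) (ha : ⁅a, h⁆ ∈ A) (hb : ⁅b, h⁆ ∈ A)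
    (hd : ⁅d, h⁆ ∈ A) : GG ≤ hA.centralizer h := by
  have mb : b ∈ hA.centralizer h := ⟨b_mem, hb⟩
  have md : d ∈ hA.centralizer h := ⟨d_mem, hd⟩
  refine (Subgroup.closure_le _).mpr ?_
  rintro y (rfl | rfl | rfl | rfl)
  · exact ⟨a_mem, ha⟩
  · exact mb
  · rw [← bd]; exact mul_mem mb md
  · exact md

end IsGNormal

/-- The subgroup of all `(g₀, g₁) ∈ 𝔊` with `g₀, g₁ ∈ A` that agree modulo `B`. The congruence is
imposed on all conjugates of `g₀ g₁⁻¹`, so that this is a subgroup for arbitrary `B`. -/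
def diagonal (A B : Subgroup (Equiv.Perm Word)) : Subgroup (Equiv.Perm Word) where
  carrier := {g | g ∈ GG ∧ ∃ g₀ ∈ A, ∃ g₁ ∈ A,
    (∀ u ∈ GG, u * (g₀ * g₁⁻¹) * u⁻¹ ∈ B) ∧ g = pair g₀ g₁}
  one_mem' := ⟨one_mem _, 1, one_mem _, 1, one_mem _, by simp, by simp⟩
  mul_mem' := by
    rintro _ _ ⟨hg, g₀, m0, g₁, m1, e, rfl⟩ ⟨hh, h₀, n0, h₁, n1, f, rfl⟩
    refine ⟨mul_mem hg hh, _, mul_mem m0 n0, _, mul_mem m1 n1, fun u hu => ?_, pair_mul _ _ _ _⟩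
    have : u * (g₀ * h₀ * (g₁ * h₁)⁻¹) * u⁻¹ =
      ((u * g₀) * (h₀ * h₁⁻¹) * (u * g₀)⁻¹) * (u * (g₀ * g₁⁻¹) * u⁻¹) := by group
    rw [this]; exact mul_mem (f _ (mul_mem hu (mem_of_pair_mem hg).1)) (e u hu)
  inv_mem' := by
    rintro _ ⟨hg, g₀, m0, g₁, m1, e, rfl⟩
    refine ⟨inv_mem hg, _, inv_mem m0, _, inv_mem m1, fun u hu => ?_, pair_inv _ _⟩
    have := inv_mem (e (u * g₀⁻¹) (mul_mem hu (inv_mem (mem_of_pair_mem hg).1)))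
    convert this using 1
    group

theorem diagonal_le_GG (A B : Subgroup (Equiv.Perm Word)) : diagonal A B ≤ GG := fun _ h => h.1

theorem diagonal_mono {A A' B B' : Subgroup (Equiv.Perm Word)} (hA : A ≤ A') (hB : B ≤ B') :
    diagonal A B ≤ diagonal A' B' := by
  rintro _ ⟨hg, g₀, m0, g₁, m1, e, rfl⟩
  exact ⟨hg, g₀, hA m0, g₁, hA m1, fun u hu => hB (e u hu), rfl⟩

theorem pair_mem_diagonal {A B : Subgroup (Equiv.Perm Word)} {g₀ g₁ : Equiv.Perm Word}
    (hB : IsGNormal B) (hg : pair g₀ g₁ ∈ GG) (h0 : g₀ ∈ A) (h1 : g₁ ∈ A) (e : g₀ * g₁⁻¹ ∈ B) :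
    pair g₀ g₁ ∈ diagonal A B :=
  ⟨hg, g₀, h0, g₁, h1, fun _ hu => hB.conj hu e, rfl⟩

theorem exists_of_mem_diagonal {A B : Subgroup (Equiv.Perm Word)} {g : Equiv.Perm Word}
    (h : g ∈ diagonal A B) : ∃ g₀ ∈ A, ∃ g₁ ∈ A, g₀ ∈ GG ∧ g₁ ∈ GG ∧ g₀ * g₁⁻¹ ∈ B ∧
      g = pair g₀ g₁ := by
  obtain ⟨hg, g₀, h0, g₁, h1, e, rfl⟩ := h
  obtain ⟨m0, m1, -⟩ := mem_of_pair_mem hg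
  exact ⟨g₀, h0, g₁, h1, m0, m1, by simpa using e 1 (one_mem _), rfl⟩

/-! ### The subgroups `K` and `𝔊'` -/

theorem conjClosure_isGNormal {g : Equiv.Perm Word} (hg : g ∈ GG) : IsGNormal (conjClosure g) := by
  refine ⟨(Subgroup.closure_le _).mpr ?_, fun {u h} hu hh => ?_⟩
  · rintro _ ⟨u, hu, rfl⟩
    exact mul_mem (mul_mem hu hg) (inv_mem hu)
  · induction hh using Subgroup.closure_induction with
    | mem y hy =>
      obtain ⟨v, hv, rfl⟩ := hy
      exact Subgroup.subset_closure ⟨u * v, mul_mem hu hv, by group⟩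
    | one => simp
    | mul y z _ _ h1 h2 =>
      have : u * (y * z) * u⁻¹ = (u * y * u⁻¹) * (u * z * u⁻¹) := by group
      rw [this]; exact mul_mem h1 h2
    | inv y _ h1 =>
      have : u * y⁻¹ * u⁻¹ = (u * y * u⁻¹)⁻¹ := by group
      rw [this]; exact inv_mem h1

theorem mem_conjClosure_self (g : Equiv.Perm Word) : g ∈ conjClosure g :=
  Subgroup.subset_closure ⟨1, one_mem _, by simp⟩

theorem conjClosure_le {A : Subgroup (Equiv.Perm Word)} {g : Equiv.Perm Word}
    (hA : ∀ u ∈ GG, u * g * u⁻¹ ∈ A) : conjClosure g ≤ A := by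
  refine (Subgroup.closure_le _).mpr ?_
  rintro _ ⟨u, hu, rfl⟩
  exact hA u hu

theorem x_mem_GG : x ∈ GG := commutator_mem_GG a_mem b_mem

theorem K_isGNormal : IsGNormal K := conjClosure_isGNormal x_mem_GG

theorem T_isGNormal : IsGNormal T := conjClosure_isGNormal (pow_mem x_mem_GG 2)

theorem x_mem_K : x ∈ K := mem_conjClosure_self x

theorem T_le_K : T ≤ K := conjClosure_le fun _ hu => K_isGNormal.conj hu (pow_mem x_mem_K 2)

/-- The subgroup of `𝔊` on which the abelianization vanishes. -/
def derived : Subgroup (Equiv.Perm Word) := abel.ker.map GG.subtype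

theorem mem_derived {g : Equiv.Perm Word} :
    g ∈ derived ↔ g ∈ GG ∧ bit g [] = 0 ∧ bitSum₁ g = 0 ∧ bitSum₂ g = 0 := by
  constructor
  · rintro ⟨g, hg, rfl⟩
    have h : (bit g.1 [], bitSum₁ g.1, bitSum₂ g.1) = (0, 0, 0) := hg
    simp only [Prod.mk.injEq] at h
    exact ⟨g.2, h⟩
  · rintro ⟨hg, h1, h2, h3⟩
    refine ⟨⟨g, hg⟩, ?_, rfl⟩
    change (bit g [], bitSum₁ g, bitSum₂ g) = (0, 0, 0)
    rw [h1, h2, h3]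

theorem commutator_mem_derived {g h : Equiv.Perm Word} (hg : g ∈ GG) (hh : h ∈ GG) :
    ⁅g, h⁆ ∈ derived := by
  refine ⟨⁅(⟨g, hg⟩ : GG), ⟨h, hh⟩⁆, ?_, rfl⟩
  rw [SetLike.mem_coe, MonoidHom.mem_ker, map_commutatorElement,
    commutatorElement_eq_one_iff_mul_comm, mul_comm]

theorem derived_le : derived ≤ GG := fun _ h => (mem_derived.mp h).1

theorem derived_isGNormal : IsGNormal derived :=
  .of_commutator derived_le fun _ hu _ hg => commutator_mem_derived hu (derived_le hg)

theorem sq_mem_derived {g : Equiv.Perm Word} (hg : g ∈ GG) : g ^ 2 ∈ derived := by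
  refine ⟨⟨g, hg⟩ ^ 2, ?_, rfl⟩
  rw [SetLike.mem_coe, MonoidHom.mem_ker, map_pow]
  generalize abel ⟨g, hg⟩ = y
  revert y; decide

theorem K_le_derived : K ≤ derived :=
  conjClosure_le fun _ hu => derived_isGNormal.conj hu (commutator_mem_derived a_mem b_mem)

/-- The group `𝔊'` consists of the pairs in `𝔊` whose two sections agree modulo `𝔊'`. -/
theorem derived_eq_diagonal : derived = diagonal GG derived := by
  ext g
  constructor
  · intro h
    obtain ⟨hg, h0, h1, h2⟩ := mem_derived.mp h
    obtain ⟨g₀, g₁, rfl⟩ := exists_pair_of_bit hg h0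
    obtain ⟨m0, m1, e⟩ := mem_of_pair_mem hg
    refine pair_mem_diagonal derived_isGNormal hg m0 m1 ?_
    rw [bitSum₁_pair] at h1
    rw [bitSum₂_pair] at h2
    have key : abel (⟨g₀, m0⟩ * ⟨g₁, m1⟩⁻¹) = 1 := by
      rw [map_mul, map_inv, mul_inv_eq_one]
      change (bit g₀ [], bitSum₁ g₀, bitSum₂ g₀) = (bit g₁ [], bitSum₁ g₁, bitSum₂ g₁)
      unfold bitSum at e
      revert e h1 h2
      generalize bit g₀ [] = p
      generalize bit g₁ [] = p'
      generalize bitSum₁ g₀ = q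
      generalize bitSum₁ g₁ = q'
      generalize bitSum₂ g₀ = r
      generalize bitSum₂ g₁ = r'
      revert p p' q q' r r'
      decide
    exact ⟨_, key, rfl⟩
  · intro h
    obtain ⟨g₀, m0, g₁, m1, -, -, e, rfl⟩ := exists_of_mem_diagonal h
    obtain ⟨e0, e1, e2, e3⟩ := mem_derived.mp e
    have key : abel ⟨g₀, m0⟩ = abel ⟨g₁, m1⟩ := by
      rw [← mul_inv_eq_one, ← map_inv, ← map_mul]
      exact Prod.ext e1 (Prod.ext e2 e3)
    have k1 : bit g₀ [] = bit g₁ [] := congrArg (fun y => y.toAdd.1) key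
    have k2 : bitSum₁ g₀ = bitSum₁ g₁ := congrArg (fun y => y.toAdd.2.1) key
    refine mem_derived.mpr ⟨h.1, rfl, ?_, ?_⟩
    · rw [bitSum₁_pair, k1]; exact CharTwo.add_self_eq_zero _
    · rw [bitSum₂_pair, k2]; exact CharTwo.add_self_eq_zero _

/-- On `𝔊'`, the additive function that vanishes exactly on `K`. -/
def epsY (g : Equiv.Perm Word) : ZMod 2 := bit g [0] + (bit g [0, 0] + bit g [0, 1])

/-- An additive function on `𝔊'` that is `1` on `x` and on `z = [a, d]`; together with `epsY` it
detects the quotient `𝔊' / N₁`. -/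
def epsX (g : Equiv.Perm Word) : ZMod 2 := bit g [0, 0] + bit g [0, 1]

theorem epsY_pair (g₀ g₁ : Equiv.Perm Word) : epsY (pair g₀ g₁) = bit g₀ [] + bitSum₁ g₀ := by
  simp [epsY, bitSum₁]

theorem epsX_pair (g₀ g₁ : Equiv.Perm Word) : epsX (pair g₀ g₁) = bitSum₁ g₀ := by
  simp [epsX, bitSum₁]

theorem exists_pair_of_mem_derived {g : Equiv.Perm Word} (h : g ∈ derived) :
    ∃ g₀ ∈ GG, ∃ g₁ ∈ GG, g = pair g₀ g₁ ∧ bit g₀ [] = bit g₁ [] ∧ bitSum₁ g₀ = bitSum₁ g₁ := by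
  obtain ⟨hg, h0, h1, h2⟩ := mem_derived.mp h
  obtain ⟨g₀, g₁, rfl⟩ := exists_pair_of_bit hg h0
  obtain ⟨m0, m1, -⟩ := mem_of_pair_mem hg
  rw [bitSum₁_pair] at h1
  rw [bitSum₂_pair] at h2
  exact ⟨g₀, m0, g₁, m1, rfl, CharTwo.add_eq_zero.mp h1, CharTwo.add_eq_zero.mp h2⟩

theorem epsY_mul {g h : Equiv.Perm Word} (hg : g ∈ derived) (hh : h ∈ derived) :
    epsY (g * h) = epsY g + epsY h := by
  obtain ⟨g₀, m0, g₁, m1, rfl, -⟩ := exists_pair_of_mem_derived hg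
  obtain ⟨h₀, n0, h₁, n1, rfl, -⟩ := exists_pair_of_mem_derived hh
  rw [pair_mul, epsY_pair, epsY_pair, epsY_pair, bit_mul m0 n0, bitSum₁_mul m0 n0]; abel

theorem epsX_mul {g h : Equiv.Perm Word} (hg : g ∈ derived) (hh : h ∈ derived) :
    epsX (g * h) = epsX g + epsX h := by
  obtain ⟨g₀, m0, g₁, m1, rfl, -⟩ := exists_pair_of_mem_derived hg
  obtain ⟨h₀, n0, h₁, n1, rfl, -⟩ := exists_pair_of_mem_derived hh
  rw [pair_mul, epsX_pair, epsX_pair, epsX_pair, bitSum₁_mul m0 n0]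

theorem add_conj_eq {f : Equiv.Perm Word → ZMod 2}
    (hf : ∀ g ∈ GG, ∀ h ∈ GG, f (g * h) = f g + f h) {u g : Equiv.Perm Word} (hu : u ∈ GG)
    (hg : g ∈ GG) : f (u * g * u⁻¹) = f g := by
  have h1 := hf _ (mul_mem (mul_mem hu hg) (inv_mem hu)) u hu
  rw [inv_mul_cancel_right, hf u hu g hg, add_comm] at h1
  exact (add_right_cancel h1).symm

theorem epsY_conj {u g : Equiv.Perm Word} (hu : u ∈ GG) (hg : g ∈ derived) :
    epsY (u * g * u⁻¹) = epsY g := by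
  obtain ⟨g₀, m0, g₁, m1, rfl, e0, e1⟩ := exists_pair_of_mem_derived hg
  obtain ⟨u₀, n0, u₁, n1, rfl | rfl⟩ := exists_pair hu
  · rw [pair_conj, epsY_pair, epsY_pair,
      add_conj_eq (f := fun g => bit g []) (fun _ h1 _ h2 => bit_mul h1 h2) n0 m0,
      add_conj_eq (fun _ h1 _ h2 => bitSum₁_mul h1 h2) n0 m0]
  · have : pair u₀ u₁ * a * pair g₀ g₁ * (pair u₀ u₁ * a)⁻¹ =
        pair u₀ u₁ * pair g₁ g₀ * (pair u₀ u₁)⁻¹ := by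
      rw [← a_conj_pair g₀ g₁, mul_inv_rev, a_inv]; group
    rw [this, pair_conj, epsY_pair, epsY_pair,
      add_conj_eq (f := fun g => bit g []) (fun _ h1 _ h2 => bit_mul h1 h2) n0 m1,
      add_conj_eq (fun _ h1 _ h2 => bitSum₁_mul h1 h2) n0 m1, e0, e1]

theorem epsY_inv {g : Equiv.Perm Word} (hg : g ∈ derived) : epsY g⁻¹ = epsY g := by
  have h1 := epsY_mul (inv_mem hg) hg
  rw [inv_mul_cancel] at h1
  have h0 : epsY 1 = 0 := by simp [epsY, bit]
  rw [h0] at h1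
  exact CharTwo.add_eq_zero.mp h1.symm

theorem epsY_commutator {u g : Equiv.Perm Word} (hu : u ∈ GG) (hg : g ∈ derived) :
    epsY ⁅u, g⁆ = 0 := by
  rw [commutatorElement_def, epsY_mul (derived_isGNormal.conj hu hg) (inv_mem hg),
    epsY_conj hu hg, epsY_inv hg]
  exact CharTwo.add_self_eq_zero _

theorem x_eq : x = pair (c * a) (a * c) := by
  have h : x = (a * b * a) * b := by
    simp only [x, commutatorElement_def, a_inv, b_inv]
  rw [h]
  conv_lhs => rw [b_eq]
  rw [a_conj_pair, pair_mul]

/-- The element `z = [a, d] = (b, b)`. -/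
def z : Equiv.Perm Word := ⁅a, d⁆

theorem z_eq : z = pair b b := by
  have h : z = (a * d * a) * d := by
    simp only [z, commutatorElement_def, a_inv, d_inv]
  rw [h]
  conv_lhs => rw [d_eq]
  rw [a_conj_pair, pair_mul, mul_one, one_mul]

theorem z_mul_self : z * z = 1 := by rw [z_eq, pair_mul, b_mul_self, pair_one_one]

theorem z_inv : z⁻¹ = z := inv_eq_of_mul_eq_one_left z_mul_self

theorem z_mem : z ∈ derived := commutator_mem_derived a_mem d_mem

theorem epsY_x : epsY x = 0 := by
  rw [x_eq, epsY_pair, bit_mul c_mem a_mem, bitSum₁_mul c_mem a_mem, bits_c.1, bits_c.2.1,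
    bits_a.1, bits_a.2.1]; decide

theorem epsX_x : epsX x = 1 := by
  rw [x_eq, epsX_pair, bitSum₁_mul c_mem a_mem, bits_c.2.1, bits_a.2.1]; decide

theorem epsY_z : epsY z = 1 := by
  rw [z_eq, epsY_pair, bits_b.1, bits_b.2.1]; decide

theorem epsX_z : epsX z = 1 := by
  rw [z_eq, epsX_pair, bits_b.2.1]

theorem epsY_K {g : Equiv.Perm Word} (hg : g ∈ K) : epsY g = 0 := by
  induction hg using Subgroup.closure_induction with
  | mem y hy =>
    obtain ⟨u, hu, rfl⟩ := hy
    rw [epsY_conj hu (K_le_derived x_mem_K), epsY_x]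
  | one => simp [epsY, bit]
  | mul y w h1 h2 e1 e2 => rw [epsY_mul (K_le_derived h1) (K_le_derived h2), e1, e2, add_zero]
  | inv y h1 e1 => rw [epsY_inv (K_le_derived h1), e1]

theorem commutator_d_x : ⁅d, x⁆ = pair 1 x⁻¹ := by
  have e : b * (a * c) * b * (a * c)⁻¹ = x⁻¹ := by
    have h1 : b * (a * c) * b * (a * c)⁻¹ = b * a * (c * b * c) * a := by
      rw [mul_inv_rev, a_inv, c_inv]; group
    have h2 : c * b * c = b := by rw [cb, dc]
    rw [h1, h2, x, commutatorElement_inv, commutatorElement_def, a_inv, b_inv]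
  have h := pair_commutator 1 b (c * a) (a * c)
  rwa [← x_eq, ← d_eq, commutatorElement_one_left, commutatorElement_def b, b_inv, e] at h

theorem pair_one_x_mem_K : pair 1 x ∈ K := by
  have h : pair 1 x⁻¹ ∈ K := commutator_d_x ▸ K_isGNormal.commutator_mem d_mem x_mem_K
  have := inv_mem h
  rwa [pair_inv, inv_one, inv_inv] at this

theorem K_level_one_le : level K 1 ≤ K := by
  refine level_le_of_atVertex fun σ hσ => ?_
  have : K ≤ K.comap (atVertexHom σ) := by
    refine conjClosure_le fun u hu => ?_
    obtain ⟨v, hv, e⟩ := exists_conj_atVertex hu (σ := [1]) (τ := σ) (by simpa using hσ.symm)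
    have e' := e x
    rw [atVertex_one_cons, atVertex_nil] at e'
    rw [Subgroup.mem_comap]
    change atVertex σ _ ∈ K
    rw [← e']
    exact K_isGNormal.conj hv pair_one_x_mem_K
  exact fun q hq => this hq

theorem pair_mem_K {g₀ g₁ : Equiv.Perm Word} (h0 : g₀ ∈ K) (h1 : g₁ ∈ K) : pair g₀ g₁ ∈ K :=
  K_level_one_le (pair_mem_level_succ.mpr ⟨by rwa [level_zero], by rwa [level_zero]⟩)

/-- `𝔊' = K ∪ zK`. -/
theorem mem_K_or_z_mul_mem_K {g : Equiv.Perm Word} (hg : g ∈ derived) : g ∈ K ∨ z * g ∈ K := by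
  have zconj : ∀ {y}, y ∈ K → z * y * z ∈ K := fun {y} hy => by
    have := K_isGNormal.conj (derived_le z_mem) hy
    rwa [z_inv] at this
  have zK : ∀ {y}, z * y ∈ K ↔ y * z ∈ K := fun {y} => by
    constructor
    · intro h
      have := zconj h
      rwa [← mul_assoc, z_mul_self, one_mul] at this
    · intro h
      have := zconj h
      rwa [mul_assoc, mul_assoc, z_mul_self, mul_one] at this
  let P : Subgroup (Equiv.Perm Word) :=
    { carrier := {g | g ∈ K ∨ z * g ∈ K}
      one_mem' := Or.inl (one_mem _)
      mul_mem' := by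
        rintro g h (hg | hg) (hh | hh)
        · exact Or.inl (mul_mem hg hh)
        · refine Or.inr ?_
          have := mul_mem (zconj hg) hh
          rwa [mul_assoc, ← mul_assoc z z h, z_mul_self, one_mul, mul_assoc] at this
        · refine Or.inr ?_
          rw [← mul_assoc]; exact mul_mem hg hh
        · refine Or.inl ?_
          have := mul_mem (zK.mp hg) hh
          rwa [mul_assoc, ← mul_assoc z z h, z_mul_self, one_mul] at this
      inv_mem' := by
        rintro g (hg | hg)
        · exact Or.inl (inv_mem hg)
        · refine Or.inr ?_
          have := inv_mem (zK.mp hg)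
          rwa [mul_inv_rev, z_inv] at this }
  have hKP : K ≤ P := fun _ h => Or.inl h
  have hzP : z ∈ P := Or.inr (by rw [z_mul_self]; exact one_mem _)
  have hPGG : P ≤ GG := by
    rintro g (h | h)
    · exact K_isGNormal.le h
    · have := mul_mem (derived_le z_mem) (K_isGNormal.le h)
      rwa [← mul_assoc, z_mul_self, one_mul] at this
  have hbz : ⁅b, z⁆ ∈ K := by
    have h := pair_commutator a c b b
    have : ⁅c, b⁆ = 1 := by
      rw [commutatorElement_eq_one_iff_mul_comm, cb, bc]
    rw [← z_eq, ← b_eq, this] at h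
    rw [h]
    exact pair_mem_K x_mem_K (one_mem _)
  have haz : ⁅a, z⁆ = 1 := by
    rw [commutatorElement_eq_one_iff_mul_comm, z_eq, a_mul_pair]
  have hdz : ⁅d, z⁆ = 1 := by
    rw [z_eq, d_eq, pair_commutator, commutatorElement_one_left, commutatorElement_self,
      pair_one_one]
  have hcomm : ∀ u ∈ GG, ⁅u, z⁆ ∈ K := fun u hu =>
    (K_isGNormal.GG_le_centralizer (haz ▸ one_mem _) hbz (hdz ▸ one_mem _) hu).2
  have hP : IsGNormal P := by
    refine ⟨hPGG, ?_⟩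
    rintro u g hu (hg | hg)
    · exact Or.inl (K_isGNormal.conj hu hg)
    · refine Or.inr ?_
      have h1 := mul_mem (inv_mem (hcomm u hu)) (K_isGNormal.conj hu hg)
      have e : ⁅u, z⁆⁻¹ * (u * (z * g) * u⁻¹) = z * (u * g * u⁻¹) := by
        simp only [commutatorElement_def]; group
      rwa [e] at h1
  -- Modulo `P` the generators commute, so every element has the normal form `α β δ p`.
  have hda : ⁅d, a⁆ ∈ P := by
    rw [commutator_mem_comm]; exact hzP
  have hba : ⁅b, a⁆ ∈ P := by
    rw [commutator_mem_comm]; exact hKP x_mem_K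
  have hdb : ⁅d, b⁆ ∈ P := by
    have : ⁅d, b⁆ = 1 := by rw [commutatorElement_eq_one_iff_mul_comm, db, bd]
    rw [this]; exact one_mem _
  have push : ∀ {u v w y : Equiv.Perm Word}, u ∈ GG → v ∈ GG → w ∈ GG → y ∈ P → ⁅u, v⁆ ∈ P →
      ∃ y' ∈ P, u * v * w * y = v * u * w * y' := by
    intro u v w y hu hv hw hy huv
    refine ⟨(v * u * w)⁻¹ * ⁅u, v⁆ * (v * u * w) * y, mul_mem
      (hP.conj' (mul_mem (mul_mem hv hu) hw) huv) hy, ?_⟩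
    simp only [commutatorElement_def]; group
  have nf : ∀ g ∈ GG, ∃ α β δ : Equiv.Perm Word, (α = 1 ∨ α = a) ∧ (β = 1 ∨ β = b) ∧
      (δ = 1 ∨ δ = d) ∧ ∃ p ∈ P, g = α * β * δ * p := by
    have ga : ∀ g, (∃ α β δ : Equiv.Perm Word, (α = 1 ∨ α = a) ∧ (β = 1 ∨ β = b) ∧
      (δ = 1 ∨ δ = d) ∧ ∃ p ∈ P, g = α * β * δ * p) → ∃ α β δ : Equiv.Perm Word,
      (α = 1 ∨ α = a) ∧ (β = 1 ∨ β = b) ∧ (δ = 1 ∨ δ = d) ∧ ∃ p ∈ P, a * g = α * β * δ * p := by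
      rintro _ ⟨α, β, δ, hα | hα, hβ, hδ, p, hp, rfl⟩
      · exact ⟨a, β, δ, Or.inr rfl, hβ, hδ, p, hp, by rw [hα]; group⟩
      · refine ⟨1, β, δ, Or.inl rfl, hβ, hδ, p, hp, ?_⟩
        rw [hα, ← mul_assoc, ← mul_assoc, ← mul_assoc, a_mul_self]
    have gb : ∀ g, (∃ α β δ : Equiv.Perm Word, (α = 1 ∨ α = a) ∧ (β = 1 ∨ β = b) ∧
      (δ = 1 ∨ δ = d) ∧ ∃ p ∈ P, g = α * β * δ * p) → ∃ α β δ : Equiv.Perm Word,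
      (α = 1 ∨ α = a) ∧ (β = 1 ∨ β = b) ∧ (δ = 1 ∨ δ = d) ∧ ∃ p ∈ P, b * g = α * β * δ * p := by
      rintro _ ⟨α, β, δ, hα, hβ, hδ, p, hp, rfl⟩
      have hδ' : δ ∈ GG := by
        rcases hδ with rfl | rfl
        exacts [one_mem _, d_mem]
      have hα' : α ∈ GG ∧ ⁅b, α⁆ ∈ P := by
        rcases hα with rfl | rfl
        · exact ⟨one_mem _, by simp⟩
        · exact ⟨a_mem, hba⟩
      have hβ' : β ∈ GG := by
        rcases hβ with rfl | rfl
        exacts [one_mem _, b_mem]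
      obtain ⟨p', hp', e⟩ := push b_mem hα'.1 (mul_mem hβ' hδ') hp hα'.2
      have e' : b * (α * β * δ * p) = α * (b * β) * δ * p' := by
        rw [show b * (α * β * δ * p) = b * α * (β * δ) * p by group, e]; group
      rcases hβ with rfl | rfl
      · exact ⟨α, b, δ, hα, Or.inr rfl, hδ, p', hp', by rw [e', mul_one]⟩
      · exact ⟨α, 1, δ, hα, Or.inl rfl, hδ, p', hp', by rw [e', b_mul_self]⟩
    have gd : ∀ g, (∃ α β δ : Equiv.Perm Word, (α = 1 ∨ α = a) ∧ (β = 1 ∨ β = b) ∧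
      (δ = 1 ∨ δ = d) ∧ ∃ p ∈ P, g = α * β * δ * p) → ∃ α β δ : Equiv.Perm Word,
      (α = 1 ∨ α = a) ∧ (β = 1 ∨ β = b) ∧ (δ = 1 ∨ δ = d) ∧ ∃ p ∈ P, d * g = α * β * δ * p := by
      rintro _ ⟨α, β, δ, hα, hβ, hδ, p, hp, rfl⟩
      have hδ' : δ ∈ GG := by
        rcases hδ with rfl | rfl
        exacts [one_mem _, d_mem]
      have hαβ : α * β ∈ GG ∧ ⁅d, α * β⁆ ∈ P := by
        have h1 : α ∈ GG ∧ ⁅α, d⁆ ∈ P := by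
          rcases hα with rfl | rfl
          · exact ⟨one_mem _, by simp⟩
          · exact ⟨a_mem, commutator_mem_comm.mp hda⟩
        have h2 : β ∈ GG ∧ ⁅β, d⁆ ∈ P := by
          rcases hβ with rfl | rfl
          · exact ⟨one_mem _, by simp⟩
          · exact ⟨b_mem, commutator_mem_comm.mp hdb⟩
        exact ⟨mul_mem h1.1 h2.1, commutator_mem_comm.mp (hP.commutator_mul_left h1.1 h1.2 h2.2)⟩
      obtain ⟨p', hp', e⟩ := push d_mem hαβ.1 hδ' hp hαβ.2
      have e' : d * (α * β * δ * p) = α * β * (d * δ) * p' := by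
        rw [show d * (α * β * δ * p) = d * (α * β) * δ * p by group, e]; group
      rcases hδ with rfl | rfl
      · exact ⟨α, β, d, hα, hβ, Or.inr rfl, p', hp', by rw [e', mul_one]⟩
      · exact ⟨α, β, 1, hα, hβ, Or.inl rfl, p', hp', by rw [e', d_mul_self]⟩
    intro g hg
    have gen : ∀ y ∈ ({a, b, c, d} : Set (Equiv.Perm Word)), ∀ g,
        (∃ α β δ : Equiv.Perm Word, (α = 1 ∨ α = a) ∧ (β = 1 ∨ β = b) ∧
        (δ = 1 ∨ δ = d) ∧ ∃ p ∈ P, g = α * β * δ * p) → ∃ α β δ : Equiv.Perm Word,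
        (α = 1 ∨ α = a) ∧ (β = 1 ∨ β = b) ∧ (δ = 1 ∨ δ = d) ∧ ∃ p ∈ P, y * g = α * β * δ * p := by
      rintro y (rfl | rfl | rfl | rfl) g h
      · exact ga g h
      · exact gb g h
      · rw [← bd, mul_assoc]; exact gb _ (gd g h)
      · exact gd g h
    induction hg using Subgroup.closure_induction_left with
    | one => exact ⟨1, 1, 1, Or.inl rfl, Or.inl rfl, Or.inl rfl, 1, one_mem _, by simp⟩
    | mul_left y hy g _ ih => exact gen y hy g ih
    | inv_mul_cancel y hy g _ ih =>
      have : y⁻¹ = y := by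
        rcases hy with rfl | rfl | rfl | rfl
        exacts [a_inv, b_inv, c_inv, d_inv]
      rw [this]; exact gen y hy g ih
  obtain ⟨hgG, e0, e1, e2⟩ := mem_derived.mp hg
  obtain ⟨α, β, δ, hα, hβ, hδ, p, hp, rfl⟩ := nf g hgG
  have mα : α ∈ GG := by rcases hα with rfl | rfl; exacts [one_mem _, a_mem]
  have mβ : β ∈ GG := by rcases hβ with rfl | rfl; exacts [one_mem _, b_mem]
  have mδ : δ ∈ GG := by rcases hδ with rfl | rfl; exacts [one_mem _, d_mem]
  have hpd : p ∈ derived := by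
    rcases hp with h | h
    · exact K_le_derived h
    · have := mul_mem z_mem (K_le_derived h)
      rwa [← mul_assoc, z_mul_self, one_mul] at this
  obtain ⟨-, p0, p1, p2⟩ := mem_derived.mp hpd
  rw [bit_mul (mul_mem (mul_mem mα mβ) mδ) (hPGG hp), bit_mul (mul_mem mα mβ) mδ, bit_mul mα mβ,
    p0] at e0
  rw [bitSum₁_mul (mul_mem (mul_mem mα mβ) mδ) (hPGG hp), bitSum₁_mul (mul_mem mα mβ) mδ,
    bitSum₁_mul mα mβ, p1] at e1
  rw [bitSum₂_mul (mul_mem (mul_mem mα mβ) mδ) (hPGG hp), bitSum₂_mul (mul_mem mα mβ) mδ,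
    bitSum₂_mul mα mβ, p2] at e2
  rcases hα with rfl | rfl <;> rcases hβ with rfl | rfl <;> rcases hδ with rfl | rfl <;>
    simp [bits_one, bits_a, bits_b, bits_d] at e0 e1 e2
  change p ∈ K ∨ z * p ∈ K at hp
  simpa using hp

/-- Inside `𝔊'`, the subgroup `K` is the kernel of `epsY`. -/
theorem mem_K_iff {g : Equiv.Perm Word} (hg : g ∈ derived) : g ∈ K ↔ epsY g = 0 := by
  refine ⟨epsY_K, fun h => ?_⟩
  rcases mem_K_or_z_mul_mem_K hg with h1 | h1
  · exact h1
  · have := epsY_K h1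
    rw [epsY_mul z_mem hg, epsY_z, h] at this
    simp at this

end Grigorchuk

end

noncomputable section

namespace Grigorchuk

/-! ### A restricted series for Grigorchuk's group -/

section Diagonal

variable {A B : Subgroup (Equiv.Perm Word)}

/-- A criterion for `[𝔊, (h₀, h₁)]` to lie in `diagonal A B`. For elements `(g₀, g₁) a`, which
interchange the subtrees, the difference `h₁ h₀⁻¹` of the sections enters; its square controls
the quotient of the two sections of the commutator. -/
theorem commutator_mem_diagonal (hB : IsGNormal B) (hBA : B ≤ A) {h₀ h₁ : Equiv.Perm Word}
    (hh : pair h₀ h₁ ∈ GG) (c0 : ∀ g ∈ GG, ⁅g, h₀⁆ ∈ B) (c1 : ∀ g ∈ GG, ⁅g, h₁⁆ ∈ B)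
    (hA : h₁ * h₀⁻¹ ∈ A) (hs : (h₁ * h₀⁻¹) ^ 2 ∈ B) {g : Equiv.Perm Word} (hg : g ∈ GG) :
    ⁅g, pair h₀ h₁⁆ ∈ diagonal A B := by
  have hG := commutator_mem_GG hg hh
  obtain ⟨g₀, m0, g₁, m1, rfl | rfl⟩ := exists_pair hg
  · rw [pair_commutator] at hG ⊢
    exact pair_mem_diagonal hB hG (hBA (c0 _ m0)) (hBA (c1 _ m1))
      (mul_mem (c0 _ m0) (inv_mem (c1 _ m1)))
  · have e : ⁅pair g₀ g₁ * a, pair h₀ h₁⁆ =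
        pair (⁅g₀, h₁⁆ * (h₁ * h₀⁻¹)) (⁅g₁, h₀⁆ * (h₁ * h₀⁻¹)⁻¹) := by
      have e1 : pair g₀ g₁ * a * pair h₀ h₁ * (pair g₀ g₁ * a)⁻¹ =
          pair (g₀ * h₁ * g₀⁻¹) (g₁ * h₀ * g₁⁻¹) := by
        rw [← pair_conj, ← a_conj_pair h₀ h₁, mul_inv_rev, a_inv]; group
      rw [commutatorElement_def, e1, pair_inv, pair_mul]
      congr 1 <;> (simp only [commutatorElement_def]; group)
    rw [e] at hG ⊢
    refine pair_mem_diagonal hB hG (mul_mem (hBA (c1 _ m0)) hA)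
      (mul_mem (hBA (c0 _ m1)) (inv_mem hA)) ?_
    have e2 : ⁅g₀, h₁⁆ * (h₁ * h₀⁻¹) * (⁅g₁, h₀⁆ * (h₁ * h₀⁻¹)⁻¹)⁻¹ =
        ⁅g₀, h₁⁆ * (h₁ * h₀⁻¹) ^ 2 * ⁅g₁, h₀⁆⁻¹ := by
      rw [pow_two]; group
    rw [e2]
    exact mul_mem (mul_mem (c1 _ m0) hs) (inv_mem (c0 _ m1))

/-- If `A / B` is central in `𝔊 / B`, then `diagonal A B` is normal. -/
theorem diagonal_isGNormal (hA : IsGNormal A) (hB : IsGNormal B)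
    (hAB : ∀ g ∈ GG, ∀ h ∈ A, ⁅g, h⁆ ∈ B) : IsGNormal (diagonal A B) := by
  refine ⟨diagonal_le_GG A B, fun {u h} hu hh => ?_⟩
  have hG := mul_mem (mul_mem hu (diagonal_le_GG A B hh)) (inv_mem hu)
  obtain ⟨h₀, m0, h₁, m1, n0, n1, e, rfl⟩ := exists_of_mem_diagonal hh
  -- Conjugating by `u` changes `h₀ h₁⁻¹` by commutators with `A`.
  have key : ∀ {u₀ u₁ h₀ h₁ : Equiv.Perm Word}, u₀ ∈ GG → u₁ ∈ GG → h₀ ∈ A → h₁ ∈ A →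
      h₀ * h₁⁻¹ ∈ B → u₀ * h₀ * u₀⁻¹ * (u₁ * h₁ * u₁⁻¹)⁻¹ ∈ B := by
    intro u₀ u₁ h₀ h₁ k0 k1 m0 m1 e
    have : u₀ * h₀ * u₀⁻¹ * (u₁ * h₁ * u₁⁻¹)⁻¹ = ⁅u₀, h₀⁆ * (h₀ * h₁⁻¹) * ⁅u₁, h₁⁆⁻¹ := by
      simp only [commutatorElement_def]; group
    rw [this]
    exact mul_mem (mul_mem (hAB _ k0 _ m0) e) (inv_mem (hAB _ k1 _ m1))
  obtain ⟨u₀, k0, u₁, k1, rfl | rfl⟩ := exists_pair hu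
  · rw [pair_conj] at hG ⊢
    exact pair_mem_diagonal hB hG (hA.conj k0 m0) (hA.conj k1 m1) (key k0 k1 m0 m1 e)
  · have e1 : pair u₀ u₁ * a * pair h₀ h₁ * (pair u₀ u₁ * a)⁻¹ =
        pair (u₀ * h₁ * u₀⁻¹) (u₁ * h₀ * u₁⁻¹) := by
      rw [← pair_conj, ← a_conj_pair h₀ h₁, mul_inv_rev, a_inv]; group
    rw [e1] at hG ⊢
    exact pair_mem_diagonal hB hG (hA.conj k0 m1) (hA.conj k1 m0)
      (key k0 k1 m1 m0 (mul_inv_mem_symm e))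

/-- The squares of `g₀` and `g₁` agree modulo `B` as soon as the square of `g₀ g₁⁻¹` and
its commutator with `g₁` lie in `B`. -/
theorem sq_mul_inv_mem (hB : IsGNormal B) {g₀ g₁ : Equiv.Perm Word} (h0 : g₀ ∈ GG) (h1 : g₁ ∈ GG)
    (hc : ⁅g₁, g₀ * g₁⁻¹⁆ ∈ B) (hs : (g₀ * g₁⁻¹) ^ 2 ∈ B) : g₀ ^ 2 * (g₁ ^ 2)⁻¹ ∈ B := by
  have e : g₀ ^ 2 * (g₁ ^ 2)⁻¹ =
      ((g₀ * g₁⁻¹) * ⁅g₁, g₀ * g₁⁻¹⁆ * (g₀ * g₁⁻¹)⁻¹) * (g₀ * g₁⁻¹) ^ 2 := by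
    simp only [commutatorElement_def, pow_two]; group
  rw [e]
  exact mul_mem (hB.conj (mul_mem h0 (inv_mem h1)) hc) hs

end Diagonal

theorem commutator_mem_K {g h : Equiv.Perm Word} (hg : g ∈ GG) (hh : h ∈ derived) : ⁅g, h⁆ ∈ K :=
  (mem_K_iff (derived_isGNormal.commutator_mem hg hh)).mpr (epsY_commutator hg hh)

theorem sq_mem_K {h : Equiv.Perm Word} (hh : h ∈ derived) : h ^ 2 ∈ K := by
  rw [mem_K_iff (pow_mem hh 2), pow_two, epsY_mul hh hh]
  exact CharTwo.add_self_eq_zero _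

theorem diagonal_derived_K_isGNormal : IsGNormal (diagonal derived K) :=
  diagonal_isGNormal derived_isGNormal K_isGNormal fun _ hg _ hh => commutator_mem_K hg hh

theorem pair_mem_diagonal_derived_K {g₀ g₁ : Equiv.Perm Word} (h0 : g₀ ∈ K) (h1 : g₁ ∈ K) :
    pair g₀ g₁ ∈ diagonal derived K :=
  pair_mem_diagonal K_isGNormal (K_isGNormal.le (pair_mem_K h0 h1)) (K_le_derived h0)
    (K_le_derived h1) (mul_mem h0 (inv_mem h1))

theorem sq_mem_diagonal_derived_K {h : Equiv.Perm Word} (hh : h ∈ derived) :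
    h ^ 2 ∈ diagonal derived K := by
  have hG := pow_mem (derived_le hh) 2
  rw [derived_eq_diagonal] at hh
  obtain ⟨g₀, -, g₁, -, m0, m1, e, rfl⟩ := exists_of_mem_diagonal hh
  rw [pair_pow_two] at hG ⊢
  exact pair_mem_diagonal K_isGNormal hG (sq_mem_derived m0) (sq_mem_derived m1)
    (sq_mul_inv_mem K_isGNormal m0 m1 (commutator_mem_K m1 e) (sq_mem_K e))

theorem commutator_a_x : ⁅a, x⁆ = (x ^ 2)⁻¹ := by
  have e : a * x * a⁻¹ = x⁻¹ := by
    simp only [x, commutatorElement_def, mul_inv_rev, a_inv, b_inv, mul_assoc]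
    rw [← mul_assoc a a, a_mul_self, one_mul]
  rw [commutatorElement_def, e, pow_two, mul_inv_rev]

theorem commutator_b_x : ⁅b, x⁆ = (x ^ 2)⁻¹ := by
  have e : b * x * b⁻¹ = x⁻¹ := by
    simp only [x, commutatorElement_def, mul_inv_rev, a_inv, b_inv, mul_assoc]
    rw [b_mul_self, mul_one]
  rw [commutatorElement_def, e, pow_two, mul_inv_rev]

/-- Since `𝔊'` is generated by the conjugates of `x` together with `z`, commutators of an element
with `𝔊'` need only be checked on these. -/
theorem commutator_mem_of_forall_x_z {A : Subgroup (Equiv.Perm Word)} (hA : IsGNormal A)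
    {h : Equiv.Perm Word} (hx : ∀ u ∈ GG, ⁅u * x * u⁻¹, h⁆ ∈ A) (hz : ⁅z, h⁆ ∈ A) :
    ∀ g ∈ derived, ⁅g, h⁆ ∈ A := by
  have hK : K ≤ hA.centralizer h := conjClosure_le fun u hu =>
    ⟨mul_mem (mul_mem hu x_mem_GG) (inv_mem hu), hx u hu⟩
  have hz' : z ∈ hA.centralizer h := ⟨derived_le z_mem, hz⟩
  intro g hg
  rcases mem_K_or_z_mul_mem_K hg with h1 | h1
  · exact (hK h1).2
  · have := mul_mem hz' (hK h1)
    rw [← mul_assoc, z_mul_self, one_mul] at this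
    exact this.2

theorem commutator_b_z : ⁅b, z⁆ = pair x 1 := by
  have h := pair_commutator a c b b
  have : ⁅c, b⁆ = 1 := by
    rw [commutatorElement_eq_one_iff_mul_comm, cb, bc]
  rwa [← z_eq, ← b_eq, this] at h

/-- `[𝔊, 𝔊'] ≤ N₁`, by a check on generators. -/
theorem commutator_mem_diagonal_derived_K {g h : Equiv.Perm Word} (hg : g ∈ GG)
    (hh : h ∈ derived) : ⁅g, h⁆ ∈ diagonal derived K := by
  have hN := diagonal_derived_K_isGNormal
  have hx2 := sq_mem_diagonal_derived_K (K_le_derived x_mem_K)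
  have hdx : ⁅d, x⁆ ∈ diagonal derived K :=
    commutator_d_x ▸ pair_mem_diagonal_derived_K (one_mem _) (inv_mem x_mem_K)
  have hx : ∀ g ∈ GG, ⁅g, x⁆ ∈ diagonal derived K := fun g hg =>
    (hN.GG_le_centralizer (commutator_a_x ▸ inv_mem hx2) (commutator_b_x ▸ inv_mem hx2) hdx hg).2
  have haz : ⁅a, z⁆ = 1 := by
    rw [commutatorElement_eq_one_iff_mul_comm, z_eq, a_mul_pair]
  have hdz : ⁅d, z⁆ = 1 := by
    rw [z_eq, d_eq, pair_commutator, commutatorElement_one_left, commutatorElement_self,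
      pair_one_one]
  have hz : ∀ g ∈ GG, ⁅g, z⁆ ∈ diagonal derived K := fun g hg =>
    (hN.GG_le_centralizer (haz ▸ one_mem _)
      (commutator_b_z ▸ pair_mem_diagonal_derived_K x_mem_K (one_mem _)) (hdz ▸ one_mem _) hg).2
  rw [commutator_mem_comm]
  refine commutator_mem_of_forall_x_z hN (fun u hu => ?_) (commutator_mem_comm.mp (hz g hg)) h hh
  have e : ⁅u * x * u⁻¹, g⁆ = u * ⁅x, u⁻¹ * g * u⁆ * u⁻¹ := by
    simp only [commutatorElement_def]; group
  rw [e]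
  exact hN.conj hu (commutator_mem_comm.mp (hx _ (mul_mem (mul_mem (inv_mem hu) hg) hu)))

theorem diagonal_derived_K_le : diagonal derived K ≤ K := by
  intro g hg
  have hG := diagonal_le_GG _ _ hg
  obtain ⟨g₀, m0, g₁, m1, -, -, -, rfl⟩ := exists_of_mem_diagonal hg
  obtain ⟨-, a0, a1, -⟩ := mem_derived.mp m0
  obtain ⟨-, b0, b1, -⟩ := mem_derived.mp m1
  have hd : pair g₀ g₁ ∈ derived := by
    refine mem_derived.mpr ⟨hG, rfl, ?_, ?_⟩
    · rw [bitSum₁_pair, a0, b0, add_zero]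
    · rw [bitSum₂_pair, a1, b1, add_zero]
  rw [mem_K_iff hd, epsY_pair, a0, a1, add_zero]

/-- `[𝔊', 𝔊'] ≤ diagonal K N₁`, which is the term `H'₄` of the auxiliary series below and not
only `H₄`; this starts the induction for `[Hᵢ, Hⱼ] ≤ Hᵢ₊ⱼ`. -/
theorem commutator_derived_mem {g h : Equiv.Perm Word} (hg : g ∈ derived) (hh : h ∈ derived) :
    ⁅g, h⁆ ∈ diagonal K (diagonal derived K) := by
  have hN := diagonal_derived_K_isGNormal
  have hM : IsGNormal (diagonal K (diagonal derived K)) :=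
    diagonal_isGNormal K_isGNormal hN fun _ hg _ hh =>
      commutator_mem_diagonal_derived_K hg (K_le_derived hh)
  -- `[𝔊', H₃]` lies in the target.
  have c3 : ∀ g ∈ derived, ∀ h ∈ diagonal derived K, ⁅g, h⁆ ∈ diagonal K (diagonal derived K) := by
    intro g hg h hh
    have hG := commutator_mem_GG (derived_le hg) (diagonal_le_GG _ _ hh)
    rw [derived_eq_diagonal] at hg
    obtain ⟨g₀, -, g₁, -, m0, m1, -, rfl⟩ := exists_of_mem_diagonal hg
    obtain ⟨h₀, n0, h₁, n1, -, -, -, rfl⟩ := exists_of_mem_diagonal hh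
    rw [pair_commutator] at hG ⊢
    have k0 := commutator_mem_diagonal_derived_K m0 n0
    have k1 := commutator_mem_diagonal_derived_K m1 n1
    exact pair_mem_diagonal hN hG (diagonal_derived_K_le k0) (diagonal_derived_K_le k1)
      (mul_mem k0 (inv_mem k1))
  have hxd := K_le_derived x_mem_K
  have hzx : ⁅x, z⁆ ∈ diagonal K (diagonal derived K) := by
    have e : ⁅x, z⁆ = pair (c * x * c⁻¹) x := by
      have e1 : ⁅c * a, b⁆ = c * x * c⁻¹ := by
        have h1 : ⁅c * a, b⁆ = c * a * b * a * (c * b) := by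
          simp only [commutatorElement_def, mul_inv_rev, a_inv, b_inv, c_inv]; group
        have h2 : c * x * c⁻¹ = c * a * b * a * (b * c) := by
          simp only [x, commutatorElement_def, a_inv, b_inv, c_inv]; group
        rw [h1, h2, cb, bc]
      have e2 : ⁅a * c, b⁆ = x := by
        have h1 : ⁅a * c, b⁆ = a * (c * b * c) * a * b := by
          simp only [commutatorElement_def, mul_inv_rev, a_inv, b_inv, c_inv]; group
        have h2 : c * b * c = b := by rw [cb, dc]
        rw [h1, h2]
        simp only [x, commutatorElement_def, a_inv, b_inv]
      have h := pair_commutator (c * a) (a * c) b b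
      rwa [← x_eq, ← z_eq, e1, e2] at h
    have hG := commutator_mem_GG x_mem_GG (derived_le z_mem)
    rw [e] at hG ⊢
    refine pair_mem_diagonal hN hG (K_isGNormal.conj c_mem x_mem_K) x_mem_K ?_
    exact commutator_mem_diagonal_derived_K c_mem hxd
  have conjx : ∀ h ∈ derived, ⁅x, h⁆ ∈ diagonal K (diagonal derived K) → ∀ u ∈ GG,
      ⁅u * x * u⁻¹, h⁆ ∈ diagonal K (diagonal derived K) := by
    intro h hh hx u hu
    have e : u * x * u⁻¹ = ⁅u, x⁆ * x := by simp [commutatorElement_def]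
    rw [e]
    refine hM.commutator_mul_left (commutator_mem_GG hu x_mem_GG) ?_ hx
    rw [commutator_mem_comm]
    exact c3 _ hh _ (commutator_mem_diagonal_derived_K hu hxd)
  have hx : ∀ g ∈ derived, ⁅g, x⁆ ∈ diagonal K (diagonal derived K) :=
    commutator_mem_of_forall_x_z hM (conjx x hxd (by simp)) (commutator_mem_comm.mp hzx)
  have hz : ∀ g ∈ derived, ⁅g, z⁆ ∈ diagonal K (diagonal derived K) :=
    commutator_mem_of_forall_x_z hM (conjx z z_mem hzx) (by simp)
  exact commutator_mem_of_forall_x_z hM (conjx h hh (commutator_mem_comm.mp (hx h hh)))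
    (commutator_mem_comm.mp (hz h hh)) g hg

/-- The candidate for the dimension series, together with an auxiliary series: the first component
`Hₙ` and the second component `H'ₙ` satisfy `Hₙ ≥ H'ₙ ≥ Hₙ₊₁`, and they are given by
`H₂ₙ = diagonal Hₙ Hₙ₊₁`, `H'₂ₙ = diagonal H'ₙ H'ₙ₊₁` and
`H₂ₙ₋₁ = H'₂ₙ₋₁ = diagonal Hₙ H'ₙ`. -/
def series : ℕ → Subgroup (Equiv.Perm Word) × Subgroup (Equiv.Perm Word)
  | 0 => (GG, GG)
  | 1 => (GG, GG)
  | 2 => (derived, K)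
  | n + 3 =>
    if (n + 3) % 2 = 0 then
      (diagonal (series ((n + 3) / 2)).1 (series ((n + 3) / 2 + 1)).1,
        diagonal (series ((n + 3) / 2)).2 (series ((n + 3) / 2 + 1)).2)
    else
      (diagonal (series ((n + 3) / 2 + 1)).1 (series ((n + 3) / 2 + 1)).2,
        diagonal (series ((n + 3) / 2 + 1)).1 (series ((n + 3) / 2 + 1)).2)
termination_by n => n
decreasing_by all_goals omega

/-- The series `Hₙ`. -/
def H (n : ℕ) : Subgroup (Equiv.Perm Word) := (series n).1

/-- The auxiliary series `H'ₙ`. -/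
def H' (n : ℕ) : Subgroup (Equiv.Perm Word) := (series n).2

theorem H_zero : H 0 = GG := by rw [H, series]
theorem H_one : H 1 = GG := by rw [H, series]
theorem H_two : H 2 = derived := by rw [H, series]
theorem H'_two : H' 2 = K := by rw [H', series]

theorem H_even {k : ℕ} (hk : 2 ≤ k) : H (2 * k) = diagonal (H k) (H (k + 1)) := by
  obtain ⟨n, hn⟩ : ∃ n, 2 * k = n + 3 := ⟨2 * k - 3, by omega⟩
  have h2 : (n + 3) / 2 = k := by omega
  rw [H, hn, series, if_pos (by omega), h2]; rfl

theorem H'_even {k : ℕ} (hk : 2 ≤ k) : H' (2 * k) = diagonal (H' k) (H' (k + 1)) := by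
  obtain ⟨n, hn⟩ : ∃ n, 2 * k = n + 3 := ⟨2 * k - 3, by omega⟩
  have h2 : (n + 3) / 2 = k := by omega
  rw [H', hn, series, if_pos (by omega), h2]; rfl

theorem H_odd {k : ℕ} (hk : 1 ≤ k) : H (2 * k + 1) = diagonal (H (k + 1)) (H' (k + 1)) := by
  obtain ⟨n, hn⟩ : ∃ n, 2 * k + 1 = n + 3 := ⟨2 * k - 2, by omega⟩
  have h2 : (n + 3) / 2 = k := by omega
  rw [H, hn, series, if_neg (by omega), h2]; rfl

theorem H'_odd {k : ℕ} (hk : 1 ≤ k) : H' (2 * k + 1) = diagonal (H (k + 1)) (H' (k + 1)) := by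
  obtain ⟨n, hn⟩ : ∃ n, 2 * k + 1 = n + 3 := ⟨2 * k - 2, by omega⟩
  have h2 : (n + 3) / 2 = k := by omega
  rw [H', hn, series, if_neg (by omega), h2]; rfl

theorem H_three : H 3 = diagonal derived K := by
  rw [show 3 = 2 * 1 + 1 from rfl, H_odd le_rfl, H_two, H'_two]

theorem H'_three : H' 3 = diagonal derived K := by
  rw [show 3 = 2 * 1 + 1 from rfl, H'_odd le_rfl, H_two, H'_two]

theorem H'_four : H' 4 = diagonal K (diagonal derived K) := by
  rw [show 4 = 2 * 2 from rfl, H'_even le_rfl, H'_two, H'_three]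

/-- Induction along the recursive description of the series. -/
theorem series_induction {P : ℕ → Prop} (h2 : P 2)
    (even : ∀ k, 2 ≤ k → (∀ j, 2 ≤ j → j < 2 * k → P j) → P (2 * k))
    (odd : ∀ k, 1 ≤ k → (∀ j, 2 ≤ j → j < 2 * k + 1 → P j) → P (2 * k + 1)) :
    ∀ n, 2 ≤ n → P n := by
  intro n
  induction n using Nat.strong_induction_on with
  | _ n ih =>
    intro hn
    obtain ⟨k, rfl | rfl⟩ : ∃ k, n = 2 * k ∨ n = 2 * k + 1 := ⟨n / 2, by omega⟩
    · rcases Nat.lt_or_ge k 2 with hk | hk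
      · obtain rfl : k = 1 := by omega
        exact h2
      · exact even k hk fun j hj hlt => ih j hlt hj
    · exact odd k (by omega) fun j hj hlt => ih j hlt hj

theorem H_le_GG (n : ℕ) : H n ≤ GG := by
  rcases Nat.lt_or_ge n 2 with hn | hn
  · have : n = 0 ∨ n = 1 := by omega
    rcases this with rfl | rfl
    · rw [H_zero]
    · rw [H_one]
  · refine series_induction (P := fun n => H n ≤ GG) ?_ (fun k hk _ => ?_) (fun k hk _ => ?_) n hn
    · rw [H_two]; exact derived_le
    · rw [H_even hk]; exact diagonal_le_GG _ _
    · rw [H_odd hk]; exact diagonal_le_GG _ _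

theorem H_chain : ∀ n, 2 ≤ n → H' n ≤ H n ∧ H (n + 1) ≤ H' n := by
  refine series_induction ?_ (fun k hk ih => ?_) (fun k hk ih => ?_)
  · rw [H_two, H'_two, H_three]
    exact ⟨K_le_derived, diagonal_derived_K_le⟩
  · obtain ⟨h1, h2⟩ := ih k hk (by omega)
    obtain ⟨h3, h4⟩ := ih (k + 1) (by omega) (by omega)
    rw [H_even hk, H'_even hk, H_odd (by omega)]
    exact ⟨diagonal_mono h1 h3, diagonal_mono h2 le_rfl⟩
  · obtain ⟨h1, h2⟩ := ih (k + 1) (by omega) (by omega)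
    rw [H_odd hk, H'_odd hk, show 2 * k + 1 + 1 = 2 * (k + 1) by ring, H_even (by omega)]
    exact ⟨le_rfl, diagonal_mono le_rfl h2⟩

theorem H'_le {n : ℕ} (hn : 2 ≤ n) : H' n ≤ H n := (H_chain n hn).1
theorem H_succ_le {n : ℕ} (hn : 2 ≤ n) : H (n + 1) ≤ H' n := (H_chain n hn).2
theorem H'_succ_le {n : ℕ} (hn : 2 ≤ n) : H' (n + 1) ≤ H' n :=
  (H'_le (by omega)).trans (H_succ_le hn)

theorem H_antitone : Antitone H := by
  refine antitone_nat_of_succ_le fun n => ?_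
  rcases Nat.lt_or_ge n 2 with hn | hn
  · have : n = 0 ∨ n = 1 := by omega
    rcases this with rfl | rfl
    · rw [H_zero]; exact H_le_GG _
    · rw [H_one]; exact H_le_GG _
  · exact (H_succ_le hn).trans (H'_le hn)

/-- The series is central, and its layers have exponent `2`. -/
theorem H_central : ∀ n, 2 ≤ n → (IsGNormal (H n) ∧ IsGNormal (H' n)) ∧
    (∀ g ∈ GG, ∀ h ∈ H n, ⁅g, h⁆ ∈ H' (n + 1)) ∧ ∀ h ∈ H n, h ^ 2 ∈ H' (n + 1) := by
  -- Normality follows from centrality.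
  have norm : ∀ n, 2 ≤ n → (∀ g ∈ GG, ∀ h ∈ H n, ⁅g, h⁆ ∈ H' (n + 1)) →
      IsGNormal (H n) ∧ IsGNormal (H' n) := by
    intro n hn hc
    have hle := H'_succ_le hn
    refine ⟨.of_commutator (H_le_GG n) fun g hg h hh => H'_le hn (hle (hc g hg h hh)),
      .of_commutator ((H'_le hn).trans (H_le_GG n)) fun g hg h hh =>
        hle (hc g hg h (H'_le hn hh))⟩
  refine series_induction ?_ (fun k hk ih => ?_) (fun k hk ih => ?_)
  · rw [H_two, H'_two, H'_three]
    exact ⟨⟨derived_isGNormal, K_isGNormal⟩,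
      fun g hg h hh => commutator_mem_diagonal_derived_K hg hh,
      fun h hh => sq_mem_diagonal_derived_K hh⟩
  · obtain ⟨-, c0, s0⟩ := ih k hk (by omega)
    obtain ⟨⟨-, hN⟩, c1, s1⟩ := ih (k + 1) (by omega) (by omega)
    have hle : H' (k + 1) ≤ H (k + 1) := H'_le (by omega)
    have hc : ∀ g ∈ GG, ∀ h ∈ H (2 * k), ⁅g, h⁆ ∈ H' (2 * k + 1) := by
      intro g hg h hh
      rw [H_even hk] at hh
      rw [H'_odd (by omega)]
      have hG := diagonal_le_GG _ _ hh
      obtain ⟨h₀, m0, h₁, m1, -, -, e, rfl⟩ := exists_of_mem_diagonal hh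
      have e' := mul_inv_mem_symm e
      exact commutator_mem_diagonal hN hle hG (fun g hg => c0 g hg _ m0)
        (fun g hg => c0 g hg _ m1) e' (H'_succ_le (by omega) (s1 _ e')) hg
    refine ⟨norm _ (by omega) hc, hc, fun h hh => ?_⟩
    rw [H_even hk] at hh
    rw [H'_odd (by omega)]
    have hG := pow_mem (diagonal_le_GG _ _ hh) 2
    obtain ⟨h₀, m0, h₁, m1, -, -, e, rfl⟩ := exists_of_mem_diagonal hh
    rw [pair_pow_two] at hG ⊢
    exact pair_mem_diagonal hN hG (hle (s0 _ m0)) (hle (s0 _ m1))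
      (mul_mem (s0 _ m0) (inv_mem (s0 _ m1)))
  · obtain ⟨-, c1, s1⟩ := ih (k + 1) (by omega) (by omega)
    have hN : IsGNormal (H' (k + 2)) := by
      rcases Nat.lt_or_ge k 2 with h | h
      · obtain rfl : k = 1 := by omega
        rw [H'_three]; exact diagonal_derived_K_isGNormal
      · exact (ih (k + 2) (by omega) (by omega)).1.2
    have hle : H' (k + 2) ≤ H' (k + 1) := H'_succ_le (by omega)
    have hle' : H' (k + 1) ≤ H (k + 1) := H'_le (by omega)
    have hc : ∀ g ∈ GG, ∀ h ∈ H (2 * k + 1), ⁅g, h⁆ ∈ H' (2 * k + 1 + 1) := by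
      intro g hg h hh
      rw [H_odd hk] at hh
      rw [show 2 * k + 1 + 1 = 2 * (k + 1) by ring, H'_even (by omega)]
      have hG := diagonal_le_GG _ _ hh
      obtain ⟨h₀, m0, h₁, m1, -, -, e, rfl⟩ := exists_of_mem_diagonal hh
      have e' := mul_inv_mem_symm e
      exact commutator_mem_diagonal hN hle hG (fun g hg => c1 g hg _ m0)
        (fun g hg => c1 g hg _ m1) e' (s1 _ (hle' e')) hg
    refine ⟨norm _ (by omega) hc, hc, fun h hh => ?_⟩
    rw [H_odd hk] at hh
    rw [show 2 * k + 1 + 1 = 2 * (k + 1) by ring, H'_even (by omega)]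
    have hG := pow_mem (diagonal_le_GG _ _ hh) 2
    obtain ⟨h₀, m0, h₁, m1, -, -, e, rfl⟩ := exists_of_mem_diagonal hh
    rw [pair_pow_two] at hG ⊢
    exact pair_mem_diagonal hN hG (hle (s1 _ m0)) (hle (s1 _ m1))
      (mul_mem (s1 _ m0) (inv_mem (s1 _ m1)))

theorem H_isGNormal (n : ℕ) : IsGNormal (H n) := by
  rcases Nat.lt_or_ge n 2 with hn | hn
  · have : n = 0 ∨ n = 1 := by omega
    rcases this with rfl | rfl
    · rw [H_zero]; exact isGNormal_GG
    · rw [H_one]; exact isGNormal_GG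
  · exact (H_central n hn).1.1

theorem H'_isGNormal {n : ℕ} (hn : 2 ≤ n) : IsGNormal (H' n) := (H_central n hn).1.2

theorem commutator_GG_mem {n : ℕ} (hn : 2 ≤ n) {g h : Equiv.Perm Word} (hg : g ∈ GG)
    (hh : h ∈ H n) : ⁅g, h⁆ ∈ H' (n + 1) := (H_central n hn).2.1 g hg h hh

/-- `[H₂, Hₙ] ≤ H'ₙ₊₂`. -/
theorem commutator_H_two_mem : ∀ n, 2 ≤ n → ∀ g ∈ H 2, ∀ h ∈ H n, ⁅g, h⁆ ∈ H' (n + 2) := by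
  refine series_induction ?_ (fun k hk ih => ?_) (fun k hk ih => ?_)
  · rw [H_two, H'_four]
    exact fun g hg h hh => commutator_derived_mem hg hh
  · intro g hg h hh
    have hG := commutator_mem_GG (H_le_GG _ hg) (H_le_GG _ hh)
    rw [H_two, derived_eq_diagonal, ← H_two] at hg
    rw [H_even hk] at hh
    obtain ⟨g₀, -, g₁, -, m0, m1, e, rfl⟩ := exists_of_mem_diagonal hg
    obtain ⟨h₀, n0, h₁, n1, k0, k1, f, rfl⟩ := exists_of_mem_diagonal hh
    rw [show 2 * k + 2 = 2 * (k + 1) by ring, H'_even (by omega)]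
    rw [pair_commutator] at hG ⊢
    have hN : IsGNormal (H' (k + 2)) := H'_isGNormal (by omega)
    exact pair_mem_diagonal hN hG (commutator_GG_mem hk m0 n0) (commutator_GG_mem hk m1 n1)
      (hN.commutator_congr (H_isGNormal 2) (H_isGNormal (k + 1)) m0 m1 k0 k1 e f
        (fun δ hδ => ih k hk (by omega) δ hδ _ n0)
        (fun δ hδ => commutator_GG_mem (by omega) m1 hδ))
  · intro g hg h hh
    have hG := commutator_mem_GG (H_le_GG _ hg) (H_le_GG _ hh)
    rw [H_two, derived_eq_diagonal, ← H_two] at hg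
    rw [H_odd hk] at hh
    obtain ⟨g₀, -, g₁, -, m0, m1, e, rfl⟩ := exists_of_mem_diagonal hg
    obtain ⟨h₀, n0, h₁, n1, k0, k1, f, rfl⟩ := exists_of_mem_diagonal hh
    rw [show 2 * k + 1 + 2 = 2 * (k + 1) + 1 by ring, H'_odd (by omega)]
    rw [pair_commutator] at hG ⊢
    have c0 : ⁅g₀, h₀⁆ ∈ H' (k + 2) := commutator_GG_mem (by omega) m0 n0
    have c1 : ⁅g₁, h₁⁆ ∈ H' (k + 2) := commutator_GG_mem (by omega) m1 n1
    exact pair_mem_diagonal (H'_isGNormal (by omega)) hG (H'_le (by omega) c0)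
      (H'_le (by omega) c1) (mul_mem c0 (inv_mem c1))

/-- `[Hᵢ, Hⱼ] ≤ Hᵢ₊ⱼ` and `[Hᵢ, H'ⱼ] ≤ H'ᵢ₊ⱼ`. -/
theorem commutator_H_mem_aux : ∀ N i j, i + j = N → 2 ≤ i → 2 ≤ j →
    (∀ g ∈ H i, ∀ h ∈ H j, ⁅g, h⁆ ∈ H (i + j)) ∧ ∀ g ∈ H i, ∀ h ∈ H' j, ⁅g, h⁆ ∈ H' (i + j) := by
  intro N
  induction N using Nat.strong_induction_on with
  | _ N ih =>
    intro i j hN hi hj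
    have C : ∀ i j, i + j < N → 2 ≤ i → 2 ≤ j → ∀ g ∈ H i, ∀ h ∈ H j, ⁅g, h⁆ ∈ H (i + j) :=
      fun i j h hi hj => (ih _ h i j rfl hi hj).1
    have C' : ∀ i j, i + j < N → 2 ≤ i → 2 ≤ j → ∀ g ∈ H i, ∀ h ∈ H' j, ⁅g, h⁆ ∈ H' (i + j) :=
      fun i j h hi hj => (ih _ h i j rfl hi hj).2
    have C'' : ∀ i j, i + j < N → 2 ≤ i → 2 ≤ j → ∀ g ∈ H' i, ∀ h ∈ H j, ⁅g, h⁆ ∈ H' (i + j) := by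
      intro i j h hi hj g hg k hk
      rw [commutator_mem_comm, add_comm]
      exact C' j i (by omega) hj hi k hk g hg
    rcases Nat.lt_or_ge i 3 with hi3 | hi3
    · obtain rfl : i = 2 := by omega
      have := commutator_H_two_mem j hj
      rw [add_comm]
      exact ⟨fun g hg h hh => H'_le (by omega) (this g hg h hh),
        fun g hg h hh => this g hg h (H'_le hj hh)⟩
    rcases Nat.lt_or_ge j 3 with hj3 | hj3
    · obtain rfl : j = 2 := by omega
      have := commutator_H_two_mem i hi
      refine ⟨fun g hg h hh => ?_, fun g hg h hh => ?_⟩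
      · rw [commutator_mem_comm]
        exact H'_le (by omega) (this h hh g hg)
      · rw [commutator_mem_comm]
        exact this h (H'_le le_rfl hh) g hg
    obtain ⟨n, rfl | rfl⟩ : ∃ n, i = 2 * n ∨ i = 2 * n + 1 := ⟨i / 2, by omega⟩ <;>
      obtain ⟨m, rfl | rfl⟩ : ∃ m, j = 2 * m ∨ j = 2 * m + 1 := ⟨j / 2, by omega⟩
    · rw [H_even (k := n) (by omega), H_even (k := m) (by omega), H'_even (k := m) (by omega),
        show 2 * n + 2 * m = 2 * (n + m) by ring, H_even (by omega), H'_even (by omega)]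
      constructor
      · intro g hg h hh
        have hG := commutator_mem_GG (diagonal_le_GG _ _ hg) (diagonal_le_GG _ _ hh)
        obtain ⟨g₀, a0, g₁, a1, m0, m1, e, rfl⟩ := exists_of_mem_diagonal hg
        obtain ⟨h₀, b0, h₁, b1, k0, k1, f, rfl⟩ := exists_of_mem_diagonal hh
        rw [pair_commutator] at hG ⊢
        refine pair_mem_diagonal (H_isGNormal _) hG
          (C n m (by omega) (by omega) (by omega) _ a0 _ b0)
          (C n m (by omega) (by omega) (by omega) _ a1 _ b1) ?_
        refine (H_isGNormal _).commutator_congr (H_isGNormal _) (H_isGNormal _) m0 m1 k0 k1 e f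
          (fun δ hδ => ?_)
          (fun δ hδ => C n (m + 1) (by omega) (by omega) (by omega) _ a1 _ hδ)
        have := C (n + 1) m (by omega) (by omega) (by omega) δ hδ _ b0
        rwa [show n + 1 + m = n + m + 1 by ring] at this
      · intro g hg h hh
        have hG := commutator_mem_GG (diagonal_le_GG _ _ hg) (diagonal_le_GG _ _ hh)
        obtain ⟨g₀, a0, g₁, a1, m0, m1, e, rfl⟩ := exists_of_mem_diagonal hg
        obtain ⟨h₀, b0, h₁, b1, k0, k1, f, rfl⟩ := exists_of_mem_diagonal hh
        rw [pair_commutator] at hG ⊢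
        refine pair_mem_diagonal (H'_isGNormal (by omega)) hG
          (C' n m (by omega) (by omega) (by omega) _ a0 _ b0)
          (C' n m (by omega) (by omega) (by omega) _ a1 _ b1) ?_
        refine (H'_isGNormal (by omega)).commutator_congr (H_isGNormal _) (H'_isGNormal (by omega))
          m0 m1 k0 k1 e f (fun δ hδ => ?_)
          (fun δ hδ => C' n (m + 1) (by omega) (by omega) (by omega) _ a1 _ hδ)
        have := C' (n + 1) m (by omega) (by omega) (by omega) δ hδ _ b0
        rwa [show n + 1 + m = n + m + 1 by ring] at this
    · have key : ∀ g ∈ H (2 * n), ∀ h ∈ H (2 * m + 1), ⁅g, h⁆ ∈ H (2 * (n + m) + 1) := by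
        rw [H_even (k := n) (by omega), H_odd (k := m) (by omega), H_odd (by omega)]
        intro g hg h hh
        have hG := commutator_mem_GG (diagonal_le_GG _ _ hg) (diagonal_le_GG _ _ hh)
        obtain ⟨g₀, a0, g₁, a1, m0, m1, e, rfl⟩ := exists_of_mem_diagonal hg
        obtain ⟨h₀, b0, h₁, b1, k0, k1, f, rfl⟩ := exists_of_mem_diagonal hh
        rw [pair_commutator] at hG ⊢
        refine pair_mem_diagonal (H'_isGNormal (by omega)) hG
          (C n (m + 1) (by omega) (by omega) (by omega) _ a0 _ b0)
          (C n (m + 1) (by omega) (by omega) (by omega) _ a1 _ b1) ?_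
        refine (H'_isGNormal (by omega)).commutator_congr (H_isGNormal _) (H'_isGNormal (by omega))
          m0 m1 k0 k1 e f (fun δ hδ => ?_)
          (fun δ hδ => C' n (m + 1) (by omega) (by omega) (by omega) _ a1 _ hδ)
        have := C (n + 1) (m + 1) (by omega) (by omega) (by omega) δ hδ _ b0
        rw [show n + 1 + (m + 1) = n + m + 1 + 1 by ring] at this
        exact H_succ_le (by omega) this
      rw [show 2 * n + (2 * m + 1) = 2 * (n + m) + 1 by ring, H'_odd (by omega), ← H_odd (by omega),
        H'_odd (by omega), ← H_odd (by omega)]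
      exact ⟨key, key⟩
    · have hS : 2 * n + 1 + 2 * m = 2 * (n + m) + 1 := by ring
      have key : ∀ g ∈ H (2 * n + 1), ∀ h ∈ H (2 * m), ⁅g, h⁆ ∈ H (2 * (n + m) + 1) := by
        rw [H_odd (k := n) (by omega), H_even (k := m) (by omega), H_odd (by omega)]
        intro g hg h hh
        have hG := commutator_mem_GG (diagonal_le_GG _ _ hg) (diagonal_le_GG _ _ hh)
        obtain ⟨g₀, a0, g₁, a1, m0, m1, e, rfl⟩ := exists_of_mem_diagonal hg
        obtain ⟨h₀, b0, h₁, b1, k0, k1, f, rfl⟩ := exists_of_mem_diagonal hh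
        have en : n + m + 1 = n + 1 + m := by ring
        rw [en]
        rw [pair_commutator] at hG ⊢
        refine pair_mem_diagonal (H'_isGNormal (by omega)) hG
          (C (n + 1) m (by omega) (by omega) (by omega) _ a0 _ b0)
          (C (n + 1) m (by omega) (by omega) (by omega) _ a1 _ b1) ?_
        refine (H'_isGNormal (by omega)).commutator_congr (H'_isGNormal (by omega)) (H_isGNormal _)
          m0 m1 k0 k1 e f
          (fun δ hδ => C'' (n + 1) m (by omega) (by omega) (by omega) _ hδ _ b0) (fun δ hδ => ?_)
        have := C (n + 1) (m + 1) (by omega) (by omega) (by omega) _ a1 δ hδ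
        rw [show n + 1 + (m + 1) = n + 1 + m + 1 by ring] at this
        exact H_succ_le (by omega) this
      rw [hS]
      refine ⟨key, fun g hg h hh => ?_⟩
      rw [H'_odd (by omega), ← H_odd (by omega)]
      exact key g hg h (H'_le (by omega) hh)
    · rw [H_odd (k := n) (by omega), H_odd (k := m) (by omega), H'_odd (k := m) (by omega),
        show 2 * n + 1 + (2 * m + 1) = 2 * (n + m + 1) by ring, H_even (by omega),
        H'_even (by omega)]
      have es : n + 1 + (m + 1) = n + m + 1 + 1 := by ring
      have cc : ∀ g ∈ H (n + 1), ∀ h ∈ H (m + 1), ⁅g, h⁆ ∈ H (n + m + 1 + 1) := by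
        rw [← es]; exact C (n + 1) (m + 1) (by omega) (by omega) (by omega)
      constructor
      · intro g hg h hh
        have hG := commutator_mem_GG (diagonal_le_GG _ _ hg) (diagonal_le_GG _ _ hh)
        obtain ⟨g₀, a0, g₁, a1, m0, m1, e, rfl⟩ := exists_of_mem_diagonal hg
        obtain ⟨h₀, b0, h₁, b1, k0, k1, f, rfl⟩ := exists_of_mem_diagonal hh
        rw [pair_commutator] at hG ⊢
        have c0 := cc _ a0 _ b0
        have c1 := cc _ a1 _ b1
        exact pair_mem_diagonal (H_isGNormal _) hG (H_antitone (Nat.le_succ _) c0)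
          (H_antitone (Nat.le_succ _) c1) (mul_mem c0 (inv_mem c1))
      · intro g hg h hh
        have hG := commutator_mem_GG (diagonal_le_GG _ _ hg) (diagonal_le_GG _ _ hh)
        obtain ⟨g₀, a0, g₁, a1, m0, m1, e, rfl⟩ := exists_of_mem_diagonal hg
        obtain ⟨h₀, b0, h₁, b1, k0, k1, f, rfl⟩ := exists_of_mem_diagonal hh
        rw [pair_commutator] at hG ⊢
        refine pair_mem_diagonal (H'_isGNormal (by omega)) hG
          (H_succ_le (by omega) (cc _ a0 _ b0)) (H_succ_le (by omega) (cc _ a1 _ b1)) ?_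
        rw [← es]
        exact (H'_isGNormal (by omega)).commutator_congr (H'_isGNormal (by omega))
          (H'_isGNormal (by omega)) m0 m1 k0 k1 e f
          (fun δ hδ => C'' _ _ (by omega) (by omega) (by omega) _ hδ _ b0)
          (fun δ hδ => C' _ _ (by omega) (by omega) (by omega) _ a1 _ hδ)

theorem commutator_H_mem {i j : ℕ} (hi : 2 ≤ i) (hj : 2 ≤ j) {g h : Equiv.Perm Word}
    (hg : g ∈ H i) (hh : h ∈ H j) : ⁅g, h⁆ ∈ H (i + j) :=
  (commutator_H_mem_aux _ i j rfl hi hj).1 g hg h hh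

/-- `Hₙ² ⊆ H₂ₙ`. -/
theorem sq_mem_H : ∀ n, 2 ≤ n → ∀ h ∈ H n, h ^ 2 ∈ H (2 * n) := by
  refine series_induction ?_ (fun k hk ih => ?_) (fun k hk ih => ?_)
  · intro h hh
    rw [H_two, derived_eq_diagonal] at hh
    have hG := pow_mem (diagonal_le_GG _ _ hh) 2
    obtain ⟨h₀, -, h₁, -, m0, m1, e, rfl⟩ := exists_of_mem_diagonal hh
    rw [H_even le_rfl, H_two, H_three]
    rw [pair_pow_two] at hG ⊢
    exact pair_mem_diagonal diagonal_derived_K_isGNormal hG (sq_mem_derived m0) (sq_mem_derived m1)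
      (sq_mul_inv_mem diagonal_derived_K_isGNormal m0 m1 (commutator_mem_diagonal_derived_K m1 e)
        (sq_mem_diagonal_derived_K e))
  · intro h hh
    rw [H_even hk] at hh
    have hG := pow_mem (diagonal_le_GG _ _ hh) 2
    obtain ⟨h₀, a0, h₁, a1, m0, m1, e, rfl⟩ := exists_of_mem_diagonal hh
    rw [H_even (by omega)]
    rw [pair_pow_two] at hG ⊢
    refine pair_mem_diagonal (H_isGNormal _) hG (ih k hk (by omega) _ a0) (ih k hk (by omega) _ a1)
      (sq_mul_inv_mem (H_isGNormal _) m0 m1 ?_ ?_)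
    · have := commutator_H_mem hk (by omega) a1 e
      rwa [show k + (k + 1) = 2 * k + 1 by ring] at this
    · exact H_antitone (by omega) (ih (k + 1) (by omega) (by omega) _ e)
  · intro h hh
    rw [H_odd hk] at hh
    have hG := pow_mem (diagonal_le_GG _ _ hh) 2
    obtain ⟨h₀, a0, h₁, a1, m0, m1, e, rfl⟩ := exists_of_mem_diagonal hh
    rw [H_even (by omega)]
    rw [pair_pow_two] at hG ⊢
    have s0 := ih (k + 1) (by omega) (by omega) _ a0
    have s1 := ih (k + 1) (by omega) (by omega) _ a1
    rw [show 2 * (k + 1) = 2 * k + 1 + 1 by ring] at s0 s1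
    exact pair_mem_diagonal (H_isGNormal _) hG (H_antitone (Nat.le_succ _) s0)
      (H_antitone (Nat.le_succ _) s1) (mul_mem s0 (inv_mem s1))

theorem isRestrictedSeries_H : IsRestrictedSeries fun n => (H n).subgroupOf GG := by
  refine ⟨?_, ?_, ?_, ?_, ?_⟩
  · simp only [H_zero, Subgroup.subgroupOf_self]
  · simp only [H_one, Subgroup.subgroupOf_self]
  · intro i j hij g hg; exact H_antitone hij hg
  · intro i j g h hg hh
    change ⁅(g : Equiv.Perm Word), (h : Equiv.Perm Word)⁆ ∈ H (i + j)
    have hg' : (g : Equiv.Perm Word) ∈ H i := hg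
    have hh' : (h : Equiv.Perm Word) ∈ H j := hh
    rcases Nat.eq_zero_or_pos i with rfl | hi
    · rw [zero_add]; exact (H_isGNormal j).commutator_mem g.2 hh'
    rcases Nat.eq_zero_or_pos j with rfl | hj
    · rw [add_zero, commutator_mem_comm]; exact (H_isGNormal i).commutator_mem h.2 hg'
    rcases Nat.lt_or_ge i 2 with hi2 | hi2
    · obtain rfl : i = 1 := by omega
      rcases Nat.lt_or_ge j 2 with hj2 | hj2
      · obtain rfl : j = 1 := by omega
        rw [H_two]; exact commutator_mem_derived g.2 h.2
      · rw [add_comm]; exact H'_le (by omega) (commutator_GG_mem hj2 g.2 hh')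
    · rcases Nat.lt_or_ge j 2 with hj2 | hj2
      · obtain rfl : j = 1 := by omega
        rw [commutator_mem_comm]; exact H'_le (by omega) (commutator_GG_mem hi2 h.2 hg')
      · exact commutator_H_mem hi2 hj2 hg' hh'
  · intro i g hg
    change (g : Equiv.Perm Word) ^ 2 ∈ H (2 * i)
    rcases Nat.lt_or_ge i 2 with hi | hi
    · have : i = 0 ∨ i = 1 := by omega
      rcases this with rfl | rfl
      · rw [mul_zero, H_zero]; exact pow_mem g.2 2
      · rw [mul_one, H_two]; exact sq_mem_derived g.2
    · exact sq_mem_H i hi _ hg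

end Grigorchuk

end

noncomputable section

namespace Grigorchuk

/-! ### The subgroups `N_m` -/

theorem level_mono {Q R : Subgroup (Equiv.Perm Word)} (h : Q ≤ R) (m : ℕ) :
    level Q m ≤ level R m := fun _ hg =>
  ⟨hg.1, fun σ hσ => let ⟨q, hq, e⟩ := hg.2 σ hσ; ⟨q, h hq, e⟩⟩

theorem level_K_le : ∀ m, level K m ≤ K
  | 0 => (level_zero K).le
  | m + 1 => by
    intro g hg
    obtain ⟨g₀, h0, g₁, h1, rfl⟩ := mem_level_succ.1 hg
    exact pair_mem_K (level_K_le m h0) (level_K_le m h1)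

theorem level_isGNormal {Q : Subgroup (Equiv.Perm Word)} (hQ : IsGNormal Q) (hK : Q ≤ K) :
    ∀ m, IsGNormal (level Q m)
  | 0 => by rwa [level_zero]
  | m + 1 => by
    have ih := level_isGNormal hQ hK m
    refine ⟨(level_mono hK _).trans ((level_K_le _).trans K_isGNormal.le), fun {u h} hu hh => ?_⟩
    obtain ⟨h₀, m0, h₁, m1, rfl⟩ := mem_level_succ.1 hh
    obtain ⟨u₀, k0, u₁, k1, rfl | rfl⟩ := exists_pair hu
    · rw [pair_conj]
      exact pair_mem_level_succ.2 ⟨ih.conj k0 m0, ih.conj k1 m1⟩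
    · have e : pair u₀ u₁ * a * pair h₀ h₁ * (pair u₀ u₁ * a)⁻¹ =
          pair (u₀ * h₁ * u₀⁻¹) (u₁ * h₀ * u₁⁻¹) := by
        rw [← pair_conj, ← a_conj_pair h₀ h₁, mul_inv_rev, a_inv]; group
      rw [e]
      exact pair_mem_level_succ.2 ⟨ih.conj k0 m1, ih.conj k1 m0⟩

/-- The product of a subgroup of `𝔊` with a normal subgroup of `𝔊` is a subgroup. -/
theorem coe_sup_eq_mul {A B : Subgroup (Equiv.Perm Word)} (hA : A ≤ GG) (hB : IsGNormal B) :
    ((A ⊔ B : Subgroup (Equiv.Perm Word)) : Set (Equiv.Perm Word)) = A * B := by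
  refine Subgroup.coe_mul_of_left_le_normalizer_right A B fun u hu => ?_
  rw [Subgroup.mem_normalizer_iff]
  refine fun g => ⟨hB.conj (hA hu), fun h => ?_⟩
  have := hB.conj' (hA hu) h
  rwa [show u⁻¹ * (u * g * u⁻¹) * u = g by group] at this

theorem coe_N (m : ℕ) : (N m : Set (Equiv.Perm Word)) = (level K m : Set (Equiv.Perm Word)) *
    (level T (m - 1) : Set (Equiv.Perm Word)) :=
  coe_sup_eq_mul (level_isGNormal K_isGNormal le_rfl m).le (level_isGNormal T_isGNormal T_le_K _)

theorem x_sq_eq : x ^ 2 = pair ((c * a) ^ 2) ((c * a) ^ 2)⁻¹ := by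
  rw [x_eq, pair_pow_two]
  simp only [pow_two, mul_inv_rev, a_inv, c_inv]

theorem ca_sq_eq : (c * a) ^ 2 = pair (a * d) (d * a) := by
  rw [pow_two, mul_assoc, ← mul_assoc a, ← mul_assoc, mul_assoc c]
  conv_lhs => rw [c_eq]
  rw [a_conj_pair, pair_mul]

theorem ca_sq_mem : (c * a) ^ 2 ∈ derived := sq_mem_derived (mul_mem c_mem a_mem)

theorem epsY_ca_sq : epsY ((c * a) ^ 2) = 1 := by
  rw [ca_sq_eq, epsY_pair, bit_mul a_mem d_mem, bitSum₁_mul a_mem d_mem, bits_a.1, bits_a.2.1,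
    bits_d.1, bits_d.2.1]
  rfl

/-- The elements of `N₁ = K₁ T` are the pairs with sections in `𝔊'` that agree modulo `K`. The two
sections of `x²` lie outside `K`, so `x²` supplies the pairs whose sections are not in `K`. -/
theorem N_one : N 1 = diagonal derived K := by
  refine le_antisymm (sup_le (fun g hg => ?_) ?_) fun g hg => ?_
  · obtain ⟨g₀, h0, g₁, h1, rfl⟩ := mem_level_succ.1 hg
    rw [level_zero] at h0 h1
    exact pair_mem_diagonal_derived_K h0 h1
  · rw [level_zero]
    exact conjClosure_le fun u hu => diagonal_derived_K_isGNormal.conj hu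
      (sq_mem_diagonal_derived_K (K_le_derived x_mem_K))
  · obtain ⟨g₀, h0, g₁, h1, n0, n1, e, rfl⟩ := exists_of_mem_diagonal hg
    have key : epsY g₀ = epsY g₁ := by
      have := epsY_K e
      rwa [epsY_mul h0 (inv_mem h1), epsY_inv h1, CharTwo.add_eq_zero] at this
    have hpair : ∀ {k₀ k₁ : Equiv.Perm Word}, k₀ ∈ K → k₁ ∈ K → pair k₀ k₁ ∈ N 1 := by
      intro k₀ k₁ h0 h1
      refine Subgroup.mem_sup_left (pair_mem_level_succ.2 ?_)
      rw [level_zero]; exact ⟨h0, h1⟩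
    have hx : x ^ 2 ∈ N 1 := Subgroup.mem_sup_right (by
      rw [level_zero]; exact mem_conjClosure_self _)
    rcases letter_cases (epsY g₀) with h | h
    · exact hpair ((mem_K_iff h0).2 h) ((mem_K_iff h1).2 (key ▸ h))
    · -- Both sections lie outside `K`, as do those of `x ^ 2`.
      have hy := ca_sq_mem
      refine (Subgroup.mul_mem_cancel_left _ (inv_mem hx)).1 ?_
      rw [x_sq_eq, pair_inv, pair_mul, inv_inv]
      refine hpair ((mem_K_iff (mul_mem (inv_mem hy) h0)).2 ?_)
        ((mem_K_iff (mul_mem hy h1)).2 ?_)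
      · rw [epsY_mul (inv_mem hy) h0, epsY_inv hy, epsY_ca_sq, h]; rfl
      · rw [epsY_mul hy h1, epsY_ca_sq, ← key, h]; rfl

/-- `N_{m+2} = N_{m+1} × N_{m+1}`. -/
theorem mem_N_succ {m : ℕ} {g : Equiv.Perm Word} : g ∈ N (m + 2) ↔
    ∃ g₀ ∈ N (m + 1), ∃ g₁ ∈ N (m + 1), g = pair g₀ g₁ := by
  constructor
  · intro hg
    suffices h : N (m + 2) ≤ ((N (m + 1)).prod (N (m + 1))).map pairHom by
      obtain ⟨⟨g₀, g₁⟩, h, rfl⟩ := h hg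
      exact ⟨g₀, h.1, g₁, h.2, rfl⟩
    refine sup_le ?_ ?_ <;> intro g hg <;> obtain ⟨g₀, h0, g₁, h1, rfl⟩ := mem_level_succ.1 hg
    · exact ⟨(g₀, g₁), ⟨Subgroup.mem_sup_left h0, Subgroup.mem_sup_left h1⟩, rfl⟩
    · exact ⟨(g₀, g₁), ⟨Subgroup.mem_sup_right h0, Subgroup.mem_sup_right h1⟩, rfl⟩
  · rintro ⟨g₀, h0, g₁, h1, rfl⟩
    rw [← SetLike.mem_coe, coe_N] at h0 h1
    obtain ⟨p, hp, q, hq, rfl⟩ := h0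
    obtain ⟨p', hp', q', hq', rfl⟩ := h1
    simp only
    rw [← pair_mul]
    exact mul_mem (Subgroup.mem_sup_left (pair_mem_level_succ.2 ⟨hp, hp'⟩))
      (Subgroup.mem_sup_right (pair_mem_level_succ.2 ⟨hq, hq'⟩))

theorem pair_mem_N {m : ℕ} {g₀ g₁ : Equiv.Perm Word} (h0 : g₀ ∈ N (m + 1))
    (h1 : g₁ ∈ N (m + 1)) : pair g₀ g₁ ∈ N (m + 2) := mem_N_succ.2 ⟨g₀, h0, g₁, h1, rfl⟩

/-- By the recursion for odd degrees, both sections of an element of degree `2 ^ (m + 2) + 1` have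
degree `2 ^ (m + 1) + 1`, and `H₃ = N₁`. -/
theorem H_le_N : ∀ m, H (2 ^ (m + 1) + 1) ≤ N (m + 1)
  | 0 => by rw [zero_add, N_one, pow_one, H_three]
  | m + 1 => by
    intro g hg
    rw [pow_succ', H_odd Nat.one_le_two_pow] at hg
    obtain ⟨g₀, h0, g₁, h1, -, -, -, rfl⟩ := exists_of_mem_diagonal hg
    exact pair_mem_N (H_le_N m h0) (H_le_N m h1)

/-- `𝔊₂ = ⟨x, z⟩ N₁`, where `x` and `z` are separated by `epsX` and `epsY`. -/
theorem mem_N_one_iff {g : Equiv.Perm Word} (hg : g ∈ derived) :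
    g ∈ N 1 ↔ epsX g = 0 ∧ epsY g = 0 := by
  have fwd : ∀ {g}, g ∈ N 1 → epsX g = 0 ∧ epsY g = 0 := by
    intro g hg
    rw [N_one] at hg
    refine ⟨?_, epsY_K (diagonal_derived_K_le hg)⟩
    obtain ⟨g₀, h0, g₁, h1, n0, n1, e, rfl⟩ := exists_of_mem_diagonal hg
    rw [epsX_pair, (mem_derived.1 h0).2.2.1]
  refine ⟨fwd, fun ⟨hX, hY⟩ => ?_⟩
  have hK : g ∈ K := (mem_K_iff hg).2 hY
  have hN := diagonal_derived_K_isGNormal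
  rw [← N_one] at hN
  have hx := K_le_derived x_mem_K
  have hor : ∀ g ∈ K, g ∈ N 1 ∨ x * g ∈ N 1 := by
    intro g hg
    have hsub : K ≤ N 1 ⊔ Subgroup.zpowers x := conjClosure_le fun u hu => by
      have : u * x * u⁻¹ = ⁅u, x⁆ * x := by simp only [commutatorElement_def]; group
      rw [this]
      refine mul_mem (Subgroup.mem_sup_left ?_)
        (Subgroup.mem_sup_right (Subgroup.mem_zpowers x))
      rw [N_one]
      exact commutator_mem_diagonal_derived_K hu hx
    have := hsub hg
    rw [sup_comm, ← SetLike.mem_coe, coe_sup_eq_mul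
      (Subgroup.zpowers_le.2 x_mem_GG) hN] at this
    obtain ⟨p, ⟨n, rfl⟩, q, hq, rfl⟩ := this
    have hx2 : x ^ (2 : ℤ) ∈ N 1 := by
      rw [N_one]; exact_mod_cast sq_mem_diagonal_derived_K hx
    rcases Int.even_or_odd' n with ⟨k, rfl | rfl⟩
    · left
      refine mul_mem ?_ hq
      simp only [zpow_mul]
      exact zpow_mem hx2 k
    · right
      simp only
      rw [← mul_assoc, ← zpow_one_add, show 1 + (2 * k + 1) = 2 * (k + 1) by ring, zpow_mul]
      exact mul_mem (zpow_mem hx2 _) hq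
  rcases hor g hK with h | h
  · exact h
  · have := (fwd h).1
    rw [epsX_mul hx hg, epsX_x, hX] at this
    exact absurd this (by decide)

/-! ### Finiteness of the indices -/

/-- If `A` has finite index in `B`, then `A × A` has finite index in `B × B`. -/
theorem relIndex_prod_ne_zero {G : Type*} [Group G] {A B : Subgroup G}
    (h : A.relIndex B ≠ 0) : (A.prod A).relIndex (B.prod B) ≠ 0 := by
  have e : (A.prod A) = A.comap (MonoidHom.fst G G) ⊓ A.comap (MonoidHom.snd G G) := by
    ext ⟨g, h⟩; rfl
  rw [e]
  refine Subgroup.relIndex_inf_ne_zero ?_ ?_ <;> rw [Subgroup.relIndex_comap] <;>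
    refine mt (Subgroup.relIndex_eq_zero_of_le_right ?_) h <;> rintro _ ⟨⟨g, h⟩, hg, rfl⟩
  · exact hg.1
  · exact hg.2

theorem derived_relIndex_ne_zero : derived.relIndex GG ≠ 0 := by
  rw [Subgroup.relIndex, Subgroup.subgroupOf, derived,
    Subgroup.comap_map_eq_self_of_injective GG.subtype_injective, Subgroup.index_ker]
  exact Nat.card_pos.ne'

/-- `diagonal A B` contains `(B × B) ∩ 𝔊'`, and both `B × B` and `𝔊'` have finite index. -/
theorem diagonal_relIndex_ne_zero {A B : Subgroup (Equiv.Perm Word)} (hB : IsGNormal B)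
    (hBA : B ≤ A) (h : B.relIndex GG ≠ 0) : (diagonal A B).relIndex GG ≠ 0 := by
  have hinj : Function.Injective pairHom := fun p q hpq =>
    Prod.ext (pair_injective hpq).1 (pair_injective hpq).2
  have h1 := relIndex_prod_ne_zero h
  rw [← Subgroup.relIndex_map_map_of_injective _ _ hinj] at h1
  have h2 : derived ≤ (GG.prod GG).map pairHom := fun g hg => by
    obtain ⟨g₀, h0, g₁, h1, rfl, -⟩ := exists_pair_of_mem_derived hg
    exact ⟨(g₀, g₁), ⟨h0, h1⟩, rfl⟩
  have h3 := mt (Subgroup.relIndex_eq_zero_of_le_right h2) h1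
  have h4 := Subgroup.relIndex_inf_ne_zero h3
    (Subgroup.relIndex_eq_one.2 derived_le ▸ one_ne_zero : GG.relIndex derived ≠ 0)
  refine Subgroup.relIndex_ne_zero_trans (mt (Subgroup.relIndex_eq_zero_of_le_left ?_) h4)
    derived_relIndex_ne_zero
  rintro _ ⟨⟨⟨g₀, g₁⟩, h, rfl⟩, hG⟩
  exact pair_mem_diagonal hB hG (hBA h.1) (hBA h.2) (mul_mem h.1 (inv_mem h.2))

theorem H_relIndex_ne_zero : ∀ n, 2 ≤ n → (H n).relIndex GG ≠ 0 ∧ (H' n).relIndex GG ≠ 0 := by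
  have base : K.relIndex GG ≠ 0 := by
    refine Subgroup.relIndex_ne_zero_trans (K := derived) ?_ derived_relIndex_ne_zero
    let f : derived →* Multiplicative (ZMod 2) := MonoidHom.mk'
      (fun g => Multiplicative.ofAdd (epsY g)) fun g h => by
        rw [← ofAdd_add, ← epsY_mul g.2 h.2]; rfl
    have : K.subgroupOf derived = f.ker := by
      ext g
      rw [Subgroup.mem_subgroupOf, mem_K_iff g.2]
      rfl
    rw [Subgroup.relIndex, this, Subgroup.index_ker]
    exact Nat.card_pos.ne'
  refine series_induction ⟨?_, ?_⟩ (fun k hk ih => ?_) fun k hk ih => ?_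
  · rw [H_two]; exact derived_relIndex_ne_zero
  · rw [H'_two]; exact base
  · have h1 := ih (k + 1) (by omega) (by omega)
    rw [H_even hk, H'_even hk]
    exact ⟨diagonal_relIndex_ne_zero (H_isGNormal _) (H_antitone k.le_succ) h1.1,
      diagonal_relIndex_ne_zero (H'_isGNormal (by omega))
        (((H'_le (by omega)).trans (H_chain k hk).2)) h1.2⟩
  · have h1 := ih (k + 1) (by omega) (by omega)
    rw [H_odd hk, H'_odd hk]
    exact ⟨diagonal_relIndex_ne_zero (H'_isGNormal (by omega)) (H'_le (by omega)) h1.2,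
      diagonal_relIndex_ne_zero (H'_isGNormal (by omega)) (H'_le (by omega)) h1.2⟩

/-- The upper bound: the dimension series lies below the series `H`. -/
theorem D_le_H (n : ℕ) : D n ≤ H n := by
  have hfin : ∀ n, ((H n).subgroupOf GG).FiniteIndex := fun n => by
    refine ⟨?_⟩
    match n with
    | 0 => rw [H_zero, Subgroup.subgroupOf_self, Subgroup.index_top]; exact one_ne_zero
    | 1 => rw [H_one, Subgroup.subgroupOf_self, Subgroup.index_top]; exact one_ne_zero
    | n + 2 => exact (H_relIndex_ne_zero (n + 2) (by omega)).1
  rintro _ ⟨g, hg, rfl⟩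
  exact dimSubgroup_le_of_isRestrictedSeries isRestrictedSeries_H hfin n hg

end Grigorchuk
end

noncomputable section

namespace Grigorchuk

/-! ### The algebra of the modules `V_n` -/

/-- The vertices of level `n`, seen in the left subtree. -/
def consZero (n : ℕ) : (Fin n → ZMod 2) →+ (Fin (n + 1) → ZMod 2) :=
  AddMonoidHom.mk' (fun σ => Fin.cons 0 σ) fun σ τ => by
    ext i; refine Fin.cases ?_ (fun j => ?_) i <;> simp

/-- The inclusion `V_n → V_{n+1}` onto the span of the monomials of the left subtree; it is the
change of variables `X_i ↦ X_{i+1}`. -/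
def incl (n : ℕ) : V n →ₐ[ZMod 2] V (n + 1) :=
  AddMonoidAlgebra.mapDomainAlgHom (ZMod 2) (ZMod 2) (consZero n)

theorem incl_monomial {n : ℕ} (σ : Fin n → ZMod 2) :
    incl n (monomial σ) = monomial (Fin.cons 0 σ : Fin (n + 1) → ZMod 2) :=
  AddMonoidAlgebra.mapDomain_single

theorem monomial_mul {n : ℕ} (σ τ : Fin n → ZMod 2) :
    monomial σ * monomial τ = monomial (σ + τ) := by
  simp [monomial, AddMonoidAlgebra.single_mul_single]

theorem X_mul_incl_monomial {n : ℕ} (σ : Fin n → ZMod 2) :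
    X 0 * incl n (monomial σ) = monomial (Fin.cons 1 σ : Fin (n + 1) → ZMod 2) := by
  rw [incl_monomial, X, monomial_mul]
  congr 1
  ext i; refine Fin.cases ?_ (fun j => ?_) i <;> simp

theorem monomial_zero (n : ℕ) : monomial (0 : Fin n → ZMod 2) = 1 := rfl

theorem incl_X {n : ℕ} (i : Fin n) : incl n (X i) = X i.succ := by
  rw [X, incl_monomial, X]
  congr 1
  ext j; refine Fin.cases ?_ (fun j => ?_) j
  · simp [(Fin.succ_ne_zero i).symm]
  · simp [Pi.single_apply]

theorem char_two_V {n : ℕ} (u : V n) : u + u = 0 := by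
  rw [← two_smul (ZMod 2) u, show (2 : ZMod 2) = 0 from rfl, zero_smul]

theorem V_induction {n : ℕ} {p : V n → Prop} (h0 : p 0) (hm : ∀ σ, p (monomial σ))
    (ha : ∀ u w, p u → p w → p (u + w)) (u : V n) : p u := by
  refine AddMonoidAlgebra.induction_linear u h0 ha fun σ s => ?_
  rcases letter_cases s with rfl | rfl
  · rw [AddMonoidAlgebra.single_zero]; exact h0
  · exact hm σ

/-- The element of `V_{n+1}` with the given restrictions to the two subtrees. -/
def join {n : ℕ} (u₀ u₁ : V n) : V (n + 1) := incl n u₀ + X 0 * incl n u₁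

theorem exists_join {n : ℕ} (u : V (n + 1)) : ∃ u₀ u₁, u = join u₀ u₁ := by
  induction u using V_induction with
  | h0 => exact ⟨0, 0, by simp [join]⟩
  | hm σ =>
    obtain ⟨s, σ, rfl⟩ : ∃ s τ, σ = Fin.cons s τ := ⟨σ 0, Fin.tail σ, (Fin.cons_self_tail σ).symm⟩
    rcases letter_cases s with rfl | rfl
    · exact ⟨monomial σ, 0, by simp [join, incl_monomial]⟩
    · exact ⟨0, monomial σ, by simp [join, X_mul_incl_monomial]⟩
  | ha u w hu hw =>
    obtain ⟨u₀, u₁, rfl⟩ := hu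
    obtain ⟨w₀, w₁, rfl⟩ := hw
    exact ⟨u₀ + w₀, u₁ + w₁, by simp only [join, map_add]; ring⟩

theorem join_add {n : ℕ} (u₀ u₁ w₀ w₁ : V n) :
    join (u₀ + w₀) (u₁ + w₁) = join u₀ u₁ + join w₀ w₁ := by
  simp only [join, map_add]; ring

theorem join_zero (n : ℕ) : join (0 : V n) 0 = 0 := by simp [join]

theorem coeff_join {n : ℕ} (u₀ u₁ : V n) (σ : Fin n → ZMod 2) :
    (join u₀ u₁).coeff (Fin.cons 0 σ) = u₀.coeff σ ∧
      (join u₀ u₁).coeff (Fin.cons 1 σ) = u₁.coeff σ := by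
  have hadd : ∀ (k : ℕ) (u w : V k) τ, (u + w).coeff τ = u.coeff τ + w.coeff τ := fun _ _ _ _ => rfl
  have left : ∀ u : V n, (join u 0).coeff (Fin.cons 0 σ) = u.coeff σ ∧
      (join u 0).coeff (Fin.cons 1 σ) = 0 := fun u => by
    induction u using V_induction with
    | h0 => rw [join_zero]; exact ⟨rfl, rfl⟩
    | hm τ =>
      rw [join, map_zero, mul_zero, add_zero, incl_monomial, monomial, monomial,
        AddMonoidAlgebra.coeff_single, AddMonoidAlgebra.coeff_single]
      simp [Finsupp.single_apply, Fin.cons_inj]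
    | ha u w hu hw =>
      rw [← add_zero (0 : V n), join_add, hadd, hadd, hadd, hu.1, hu.2, hw.1, hw.2]
      exact ⟨rfl, rfl⟩
  have right : ∀ u : V n, (join 0 u).coeff (Fin.cons 0 σ) = 0 ∧
      (join 0 u).coeff (Fin.cons 1 σ) = u.coeff σ := fun u => by
    induction u using V_induction with
    | h0 => rw [join_zero]; exact ⟨rfl, rfl⟩
    | hm τ =>
      rw [join, map_zero, zero_add, X_mul_incl_monomial, monomial, monomial,
        AddMonoidAlgebra.coeff_single, AddMonoidAlgebra.coeff_single]
      simp [Finsupp.single_apply, Fin.cons_inj]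
    | ha u w hu hw =>
      rw [← add_zero (0 : V n), join_add, hadd, hadd, hadd, hu.1, hu.2, hw.1, hw.2]
      exact ⟨rfl, rfl⟩
  have e := join_add u₀ 0 0 u₁
  rw [add_zero, zero_add] at e
  rw [e, hadd, hadd, (left u₀).1, (left u₀).2, (right u₁).1, (right u₁).2, add_zero, zero_add]
  exact ⟨rfl, rfl⟩

theorem join_eq_zero {n : ℕ} {u₀ u₁ : V n} : join u₀ u₁ = 0 ↔ u₀ = 0 ∧ u₁ = 0 := by
  refine ⟨fun h => ⟨?_, ?_⟩, fun ⟨h0, h1⟩ => by rw [h0, h1, join_zero]⟩ <;> ext σ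
  · rw [← (coeff_join u₀ u₁ σ).1, h]; rfl
  · rw [← (coeff_join u₀ u₁ σ).2, h]; rfl

theorem v_succ (n t : ℕ) : v (n + 1) t = (1 - X 0) ^ (t % 2) * incl n (v n (t / 2)) := by
  rw [v, Fin.prod_univ_succ, v, map_prod]
  congr 1
  · simp
  · refine Finset.prod_congr rfl fun i _ => ?_
    rw [map_pow, map_sub, map_one, incl_X, Fin.val_succ, pow_succ', Nat.div_div_eq_div_mul]

theorem v_even (n t : ℕ) : v (n + 1) (2 * t) = incl n (v n t) := by
  rw [v_succ, Nat.mul_mod_right, pow_zero, one_mul, Nat.mul_div_cancel_left _ two_pos]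

theorem v_odd (n t : ℕ) : v (n + 1) (2 * t + 1) = (1 - X 0) * incl n (v n t) := by
  rw [v_succ, Nat.mul_add_mod, Nat.mul_add_div two_pos]
  norm_num

theorem v_even' (n t : ℕ) : v (n + 1) (2 * t) = join (v n t) 0 := by
  rw [v_even, join, map_zero, mul_zero, add_zero]

theorem v_odd' (n t : ℕ) : v (n + 1) (2 * t + 1) = join (v n t) (v n t) := by
  rw [v_odd, join, sub_mul, one_mul, sub_eq_add_neg,
    neg_eq_of_add_eq_zero_left (char_two_V (X 0 * incl n (v n t)))]

theorem VPow_antitone (n : ℕ) : Antitone (VPow n) := fun _ _ h =>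
  Submodule.span_mono (Set.image_mono (Set.Ico_subset_Ico_left h))

theorem v_mem_VPow {n r s : ℕ} (hrs : r ≤ s) (hs : s < 2 ^ n) : v n s ∈ VPow n r :=
  Submodule.subset_span ⟨s, ⟨hrs, hs⟩, rfl⟩

theorem incl_mem {n t : ℕ} {u : V n} (hu : u ∈ VPow n t) : incl n u ∈ VPow (n + 1) (2 * t) := by
  suffices h : VPow n t ≤ (VPow (n + 1) (2 * t)).comap (incl n).toLinearMap from h hu
  refine Submodule.span_le.2 ?_
  rintro _ ⟨s, hs, rfl⟩
  change incl n (v n s) ∈ VPow (n + 1) (2 * t)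
  rw [← v_even]
  have := hs.1; have := hs.2
  exact v_mem_VPow (by omega) (by rw [pow_succ]; omega)

theorem one_sub_X_mul_incl_mem {n t : ℕ} {u : V n} (hu : u ∈ VPow n t) :
    (1 - X 0) * incl n u ∈ VPow (n + 1) (2 * t + 1) := by
  suffices h : VPow n t ≤ (VPow (n + 1) (2 * t + 1)).comap
      ((LinearMap.mulLeft (ZMod 2) (1 - X 0 : V (n + 1))).comp (incl n).toLinearMap) from h hu
  refine Submodule.span_le.2 ?_
  rintro _ ⟨s, hs, rfl⟩
  change (1 - X 0) * incl n (v n s) ∈ VPow (n + 1) (2 * t + 1)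
  rw [← v_odd]
  have := hs.1; have := hs.2
  exact v_mem_VPow (by omega) (by rw [pow_succ]; omega)

/-- Since `X₁ = 1 - (1 - X₁)`, the element `join u₀ u₁` is `(u₀ + u₁) - (1 - X₁) u₁`, up to the
change of variables. -/
theorem join_mem {n t : ℕ} {u₀ u₁ : V n} (h1 : u₁ ∈ VPow n (t / 2))
    (h : u₀ + u₁ ∈ VPow n ((t + 1) / 2)) : join u₀ u₁ ∈ VPow (n + 1) t := by
  have e : join u₀ u₁ = incl n (u₀ + u₁) - (1 - X 0) * incl n u₁ := by
    rw [join, map_add]; ring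
  rw [e]
  exact sub_mem (VPow_antitone _ (by omega) (incl_mem h))
    (VPow_antitone _ (by omega) (one_sub_X_mul_incl_mem h1))

theorem VPow_zero : ∀ n, VPow n 0 = ⊤
  | 0 => by
    refine eq_top_iff.2 fun u _ => ?_
    induction u using V_induction with
    | h0 => exact zero_mem _
    | hm σ =>
      rw [Subsingleton.elim σ 0, monomial_zero]
      exact v_mem_VPow (n := 0) (s := 0) le_rfl one_pos
    | ha u w hu hw => exact add_mem (hu trivial) (hw trivial)
  | n + 1 => by
    refine eq_top_iff.2 fun u _ => ?_
    obtain ⟨u₀, u₁, rfl⟩ := exists_join u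
    have h := VPow_zero n
    exact join_mem (h ▸ Submodule.mem_top) (h ▸ Submodule.mem_top)

theorem span_range_v (n : ℕ) :
    ⊤ ≤ Submodule.span (ZMod 2) (Set.range fun i : Fin (2 ^ n) => v n i) := by
  rw [← VPow_zero n, VPow]
  refine Submodule.span_mono ?_
  rintro _ ⟨s, hs, rfl⟩
  exact ⟨⟨s, hs.2⟩, rfl⟩

theorem finrank_V (n : ℕ) : Module.finrank (ZMod 2) (V n) = 2 ^ n := by
  rw [Module.finrank_eq_card_basis (AddMonoidAlgebra.basis (Fin n → ZMod 2) (ZMod 2))]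
  simp

/-- The basis `v_n^0, …, v_n^{2^n - 1}` of `V_n`. -/
def vBasis (n : ℕ) : Module.Basis (Fin (2 ^ n)) (ZMod 2) (V n) :=
  basisOfTopLeSpanOfCardEqFinrank (fun i : Fin (2 ^ n) => v n i) (span_range_v n)
    (by rw [Fintype.card_fin, finrank_V])

theorem vBasis_apply (n : ℕ) (i : Fin (2 ^ n)) : vBasis n i = v n i := by
  rw [vBasis, coe_basisOfTopLeSpanOfCardEqFinrank]

theorem VPow_eq_span_vBasis (n r : ℕ) :
    VPow n r = Submodule.span (ZMod 2) (vBasis n '' {i | r ≤ i}) := by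
  rw [VPow]
  congr 1
  ext u
  constructor
  · rintro ⟨s, hs, rfl⟩
    exact ⟨⟨s, hs.2⟩, hs.1, vBasis_apply n _⟩
  · rintro ⟨i, hi, rfl⟩
    exact ⟨i, ⟨hi, i.2⟩, (vBasis_apply n i).symm⟩

theorem mem_VPow_iff {n r : ℕ} {u : V n} :
    u ∈ VPow n r ↔ ∀ i : Fin (2 ^ n), (i : ℕ) < r → (vBasis n).repr u i = 0 := by
  rw [VPow_eq_span_vBasis, Module.Basis.mem_span_image]
  constructor
  · intro h i hi
    by_contra h0
    exact absurd (h (Finsupp.mem_support_iff.2 h0)) (not_le.2 hi)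
  · intro h i hi
    exact not_lt.1 fun hlt => Finsupp.mem_support_iff.1 hi (h i hlt)

/-- The coordinate of `v_n^r`. -/
def vCoord (n r : ℕ) (hr : r < 2 ^ n) : V n →ₗ[ZMod 2] ZMod 2 := (vBasis n).coord ⟨r, hr⟩

theorem vCoord_v {n r : ℕ} (hr : r < 2 ^ n) : vCoord n r hr (v n r) = 1 := by
  rw [vCoord, ← vBasis_apply n ⟨r, hr⟩, Module.Basis.coord_apply, Module.Basis.repr_self,
    Finsupp.single_eq_same]

theorem mem_VPow_succ_iff {n r : ℕ} (hr : r < 2 ^ n) {u : V n} :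
    u ∈ VPow n (r + 1) ↔ u ∈ VPow n r ∧ vCoord n r hr u = 0 := by
  rw [mem_VPow_iff, mem_VPow_iff]
  constructor
  · exact fun h => ⟨fun i hi => h i (by omega), h _ (Nat.lt_succ_self r)⟩
  · rintro ⟨h, h'⟩ i hi
    rcases (Nat.lt_succ_iff.1 hi).lt_or_eq with h1 | h1
    · exact h i h1
    · obtain rfl : i = ⟨r, hr⟩ := Fin.ext h1
      exact h'

end Grigorchuk
end

noncomputable section

namespace Grigorchuk

/-! ### The isomorphism `α ⊕ β` -/

open Classical in
/-- The two sections of `g` if `g` fixes the first level, with value `1` otherwise. -/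
def sections (g : Equiv.Perm Word) : Equiv.Perm Word × Equiv.Perm Word :=
  if h : ∃ p : Equiv.Perm Word × Equiv.Perm Word, g = pair p.1 p.2 then h.choose else 1

theorem sections_pair (g₀ g₁ : Equiv.Perm Word) : sections (pair g₀ g₁) = (g₀, g₁) := by
  have h : ∃ p : Equiv.Perm Word × Equiv.Perm Word, pair g₀ g₁ = pair p.1 p.2 := ⟨(g₀, g₁), rfl⟩
  rw [sections, dif_pos h]
  exact (Prod.ext (pair_injective h.choose_spec).1 (pair_injective h.choose_spec).2).symm

/-- The element `∑ f(g_σ) X^σ` of `V_m`, where `g_σ` is the section of `g` at the vertex `σ`. -/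
def collect (f : Equiv.Perm Word → ZMod 2) : (m : ℕ) → Equiv.Perm Word → V m
  | 0, g => f g • 1
  | m + 1, g => join (collect f m (sections g).1) (collect f m (sections g).2)

variable {f : Equiv.Perm Word → ZMod 2}

theorem collect_pair (m : ℕ) (g₀ g₁ : Equiv.Perm Word) :
    collect f (m + 1) (pair g₀ g₁) = join (collect f m g₀) (collect f m g₁) := by
  rw [collect, sections_pair]

/-- A function that is additive on `A` induces a homomorphism from `A_m` to `V_m`. -/
theorem collect_mul {A : Subgroup (Equiv.Perm Word)}
    (hf : ∀ g ∈ A, ∀ h ∈ A, f (g * h) = f g + f h) :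
    ∀ m, ∀ g ∈ level A m, ∀ h ∈ level A m, collect f m (g * h) = collect f m g + collect f m h
  | 0, g, hg, h, hh => by
    rw [level_zero] at hg hh
    rw [collect, collect, collect, hf g hg h hh, add_smul]
  | m + 1, g, hg, h, hh => by
    obtain ⟨g₀, m0, g₁, m1, rfl⟩ := mem_level_succ.1 hg
    obtain ⟨h₀, n0, h₁, n1, rfl⟩ := mem_level_succ.1 hh
    rw [pair_mul, collect_pair, collect_pair, collect_pair, collect_mul hf m _ m0 _ n0,
      collect_mul hf m _ m1 _ n1, join_add]

theorem collect_one (h1 : f 1 = 0) : ∀ m, collect f m 1 = 0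
  | 0 => by rw [collect, h1, zero_smul]
  | m + 1 => by rw [← pair_one_one, collect_pair, collect_one h1 m, join_zero]

theorem collect_atVertex (h1 : f 1 = 0) (g : Equiv.Perm Word) :
    ∀ {m : ℕ} (σ : Fin m → ZMod 2), collect f m (atVertex (List.ofFn σ) g) = f g • monomial σ
  | 0, σ => by
    rw [List.ofFn_zero, atVertex_nil, collect, Subsingleton.elim σ 0, monomial_zero]
  | m + 1, σ => by
    obtain ⟨s, σ, rfl⟩ : ∃ s τ, σ = Fin.cons s τ := ⟨σ 0, Fin.tail σ, (Fin.cons_self_tail σ).symm⟩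
    have ih := collect_atVertex h1 g σ
    rw [List.ofFn_cons]
    rcases letter_cases s with rfl | rfl
    · rw [atVertex_zero_cons, collect_pair, collect_one h1, ih, join, map_smul, incl_monomial,
        map_zero, mul_zero, add_zero]
    · rw [atVertex_one_cons, collect_pair, collect_one h1, ih, join, map_smul, mul_smul_comm,
        X_mul_incl_monomial, map_zero, zero_add]

theorem collect_eq_zero_of_level {A : Subgroup (Equiv.Perm Word)} {j : ℕ}
    (h : ∀ g ∈ A, collect f j g = 0) : ∀ m, ∀ g ∈ level A m, collect f (j + m) g = 0
  | 0, g, hg => h g (by rwa [level_zero] at hg)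
  | m + 1, g, hg => by
    obtain ⟨g₀, h0, g₁, h1, rfl⟩ := mem_level_succ.1 hg
    change collect f ((j + m) + 1) _ = 0
    rw [collect_pair, collect_eq_zero_of_level h m _ h0, collect_eq_zero_of_level h m _ h1,
      join_zero]

theorem N_succ_eq_level : ∀ m, N (m + 1) = level (N 1) m
  | 0 => (level_zero _).symm
  | m + 1 => by
    ext g
    rw [mem_N_succ, mem_level_succ, N_succ_eq_level m]

theorem N_le_level_derived : ∀ m, N (m + 1) ≤ level derived (m + 1)
  | 0 => fun g hg => by
    rw [N_one] at hg
    obtain ⟨g₀, h0, g₁, h1, -, -, -, rfl⟩ := exists_of_mem_diagonal hg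
    rw [pair_mem_level_succ, level_zero]
    exact ⟨h0, h1⟩
  | m + 1 => fun g hg => by
    obtain ⟨g₀, h0, g₁, h1, rfl⟩ := mem_N_succ.1 hg
    exact pair_mem_level_succ.2 ⟨N_le_level_derived m h0, N_le_level_derived m h1⟩

theorem level_succ_le (Q : Subgroup (Equiv.Perm Word)) :
    ∀ m, level Q (m + 1) ≤ level (level Q 1) m
  | 0 => (level_zero _).ge
  | m + 1 => fun g hg => by
    obtain ⟨g₀, h0, g₁, h1, rfl⟩ := mem_level_succ.1 hg
    exact pair_mem_level_succ.2 ⟨level_succ_le Q m h0, level_succ_le Q m h1⟩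

/-- `epsY` of the left section; on `N₁` it agrees with `epsY` of the right one. -/
def epsYLeft (g : Equiv.Perm Word) : ZMod 2 := epsY (sections g).1

theorem epsYLeft_pair (g₀ g₁ : Equiv.Perm Word) : epsYLeft (pair g₀ g₁) = epsY g₀ := by
  rw [epsYLeft, sections_pair]

theorem exists_pair_of_mem_N_one {g : Equiv.Perm Word} (hg : g ∈ N 1) :
    ∃ g₀ ∈ derived, ∃ g₁ ∈ derived, g = pair g₀ g₁ ∧ epsY g₀ = epsY g₁ := by
  rw [N_one] at hg
  obtain ⟨g₀, h0, g₁, h1, -, -, e, rfl⟩ := exists_of_mem_diagonal hg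
  have := epsY_K e
  rw [epsY_mul h0 (inv_mem h1), epsY_inv h1, CharTwo.add_eq_zero] at this
  exact ⟨g₀, h0, g₁, h1, rfl, this⟩

theorem epsYLeft_mul {g h : Equiv.Perm Word} (hg : g ∈ N 1) (hh : h ∈ N 1) :
    epsYLeft (g * h) = epsYLeft g + epsYLeft h := by
  obtain ⟨g₀, m0, g₁, m1, rfl, -⟩ := exists_pair_of_mem_N_one hg
  obtain ⟨h₀, n0, h₁, n1, rfl, -⟩ := exists_pair_of_mem_N_one hh
  rw [pair_mul, epsYLeft_pair, epsYLeft_pair, epsYLeft_pair, epsY_mul m0 n0]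

/-- The map that induces `α` on `N_m`. -/
def alpha (m : ℕ) (g : Equiv.Perm Word) : V m := collect epsX m g

/-- The map that induces `β` on `N_{m+1}`. -/
def beta (m : ℕ) (g : Equiv.Perm Word) : V m := collect epsYLeft m g

theorem alpha_pair (m : ℕ) (g₀ g₁ : Equiv.Perm Word) :
    alpha (m + 1) (pair g₀ g₁) = join (alpha m g₀) (alpha m g₁) := collect_pair m g₀ g₁

theorem beta_pair (m : ℕ) (g₀ g₁ : Equiv.Perm Word) :
    beta (m + 1) (pair g₀ g₁) = join (beta m g₀) (beta m g₁) := collect_pair m g₀ g₁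

theorem alpha_mul {m : ℕ} {g h : Equiv.Perm Word} (hg : g ∈ N (m + 1)) (hh : h ∈ N (m + 1)) :
    alpha (m + 1) (g * h) = alpha (m + 1) g + alpha (m + 1) h :=
  collect_mul (fun _ hg _ hh => epsX_mul hg hh) _ _ (N_le_level_derived m hg) _
    (N_le_level_derived m hh)

theorem beta_mul {m : ℕ} {g h : Equiv.Perm Word} (hg : g ∈ N (m + 1)) (hh : h ∈ N (m + 1)) :
    beta m (g * h) = beta m g + beta m h :=
  collect_mul (A := N 1) (fun _ hg _ hh => epsYLeft_mul hg hh) _ _ (N_succ_eq_level m ▸ hg) _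
    (N_succ_eq_level m ▸ hh)

/-- The homomorphism that induces `α ⊕ β` on `N_{m+1}`. -/
def alphaBeta (m : ℕ) : N (m + 1) →* Multiplicative (V (m + 1) × V m) :=
  MonoidHom.mk' (fun g => Multiplicative.ofAdd (alpha (m + 1) g, beta m g)) fun g h => by
    rw [← ofAdd_add, Prod.mk_add_mk, ← alpha_mul g.2 h.2, ← beta_mul g.2 h.2]; rfl

theorem alphaBeta_apply (m : ℕ) (g : N (m + 1)) :
    alphaBeta m g = Multiplicative.ofAdd (alpha (m + 1) g, beta m g) := rfl

/-- The kernel of `α ⊕ β` on `N_{m+1}` is `N_{m+2}`. Since `N_{m+1} = N₁ × ⋯ × N₁`, this reduces to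
the description of `N₁` inside `𝔊'` by `epsX` and `epsY`. -/
theorem mem_N_succ_iff : ∀ (m : ℕ) {g : Equiv.Perm Word}, g ∈ N (m + 1) →
    (g ∈ N (m + 2) ↔ alpha (m + 1) g = 0 ∧ beta m g = 0)
  | 0, g, hg => by
    obtain ⟨g₀, h0, g₁, h1, rfl, e⟩ := exists_pair_of_mem_N_one hg
    have hpair : pair g₀ g₁ ∈ N 2 ↔ g₀ ∈ N 1 ∧ g₁ ∈ N 1 := by
      rw [mem_N_succ]
      constructor
      · rintro ⟨h₀, n0, h₁, n1, h⟩
        obtain ⟨rfl, rfl⟩ := pair_injective h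
        exact ⟨n0, n1⟩
      · rintro ⟨n0, n1⟩
        exact ⟨g₀, n0, g₁, n1, rfl⟩
    rw [hpair, mem_N_one_iff h0, mem_N_one_iff h1, alpha_pair, join_eq_zero, beta, alpha, alpha,
      collect, collect, collect, epsYLeft_pair, ← e]
    simp only [smul_eq_zero, one_ne_zero, or_false]
    tauto
  | m + 1, g, hg => by
    obtain ⟨g₀, h0, g₁, h1, rfl⟩ := mem_N_succ.1 hg
    have hpair : pair g₀ g₁ ∈ N (m + 3) ↔ g₀ ∈ N (m + 2) ∧ g₁ ∈ N (m + 2) := by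
      rw [mem_N_succ]
      constructor
      · rintro ⟨h₀, n0, h₁, n1, h⟩
        obtain ⟨rfl, rfl⟩ := pair_injective h
        exact ⟨n0, n1⟩
      · rintro ⟨n0, n1⟩
        exact ⟨g₀, n0, g₁, n1, rfl⟩
    rw [hpair, mem_N_succ_iff m h0, mem_N_succ_iff m h1, alpha_pair, join_eq_zero, beta_pair,
      join_eq_zero]
    tauto

theorem epsX_one : epsX 1 = 0 := by
  have := epsX_mul (one_mem derived) (one_mem derived)
  rw [one_mul] at this
  exact left_eq_add.1 this

theorem epsY_one : epsY 1 = 0 := epsY_K (one_mem K)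

theorem epsYLeft_one : epsYLeft 1 = 0 := by
  rw [← pair_one_one, epsYLeft_pair, epsY_one]

theorem epsYLeft_x_sq : epsYLeft (x ^ 2) = 1 := by
  rw [x_sq_eq, epsYLeft_pair, epsY_ca_sq]

theorem x_sq_mem_N_one : x ^ 2 ∈ N 1 := by
  rw [N_one]; exact sq_mem_diagonal_derived_K (K_le_derived x_mem_K)

theorem alpha_one_x_sq : alpha 1 (x ^ 2) = 0 := by
  have h : epsX ((c * a) ^ 2) = 0 := by
    rw [ca_sq_eq, epsX_pair, bitSum₁_mul a_mem d_mem, bits_a.2.1, bits_d.2.1, add_zero]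
  have h' : epsX ((c * a) ^ 2)⁻¹ = 0 := by
    have := epsX_mul ca_sq_mem (inv_mem ca_sq_mem)
    rwa [mul_inv_cancel, epsX_one, h, zero_add, eq_comm] at this
  rw [x_sq_eq, alpha_pair, alpha, alpha, collect, collect, h, h', zero_smul, join_zero]

/-- `α` vanishes on the elements whose sections are powers of `x ^ 2`. -/
theorem alpha_eq_zero (m : ℕ) {g : Equiv.Perm Word}
    (hg : g ∈ level (Subgroup.zpowers (x ^ 2)) m) : alpha (m + 1) g = 0 := by
  have base : ∀ g ∈ Subgroup.zpowers (x ^ 2), collect epsX 1 g = 0 := by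
    intro g hg
    have hle : Subgroup.zpowers (x ^ 2) ≤ ((AddMonoidHom.fst (V 1) (V 0)).toMultiplicative.comp
        (alphaBeta 0)).ker.map (N 1).subtype :=
      Subgroup.zpowers_le.2 ⟨⟨_, x_sq_mem_N_one⟩, alpha_one_x_sq, rfl⟩
    obtain ⟨g', h, rfl⟩ := hle hg
    exact h
  have := collect_eq_zero_of_level base m g hg
  rw [alpha]
  rwa [add_comm] at this

/-- `β` vanishes on `K_{m+1}`. -/
theorem beta_eq_zero (m : ℕ) {g : Equiv.Perm Word} (hg : g ∈ level K (m + 1)) :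
    beta m g = 0 := by
  have base : ∀ g ∈ level K 1, collect epsYLeft 0 g = 0 := by
    intro g hg
    obtain ⟨g₀, h0, g₁, h1, rfl⟩ := mem_level_succ.1 hg
    rw [level_zero] at h0
    rw [collect, epsYLeft_pair, epsY_K h0, zero_smul]
  have := collect_eq_zero_of_level base m g (level_succ_le K m hg)
  rw [beta]
  rwa [zero_add] at this

theorem level_K_le_N (m : ℕ) : level K m ≤ N m := le_sup_left

theorem level_T_le_N (m : ℕ) : level T m ≤ N (m + 1) := le_sup_right

theorem N_succ_le : ∀ m, N (m + 2) ≤ N (m + 1)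
  | 0 => fun g hg => by
    obtain ⟨g₀, h0, g₁, h1, rfl⟩ := mem_N_succ.1 hg
    rw [N_one] at h0 h1
    refine level_K_le_N 1 (pair_mem_level_succ.2 ?_)
    rw [level_zero]
    exact ⟨diagonal_derived_K_le h0, diagonal_derived_K_le h1⟩
  | m + 1 => fun g hg => by
    obtain ⟨g₀, h0, g₁, h1, rfl⟩ := mem_N_succ.1 hg
    exact pair_mem_N (N_succ_le m h0) (N_succ_le m h1)

/-- Surjectivity of `α ⊕ β` holds because the monomials are images of copies of `x` and `x²`. -/
theorem isAlphaBeta (m : ℕ) : IsAlphaBeta (m + 1) (alphaBeta m) := by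
  have hα : ∀ σ : Fin (m + 1) → ZMod 2, ∃ h : atVertex (List.ofFn σ) x ∈ N (m + 1),
      alphaBeta m ⟨_, h⟩ = Multiplicative.ofAdd (monomial σ, 0) := by
    intro σ
    have h := atVertex_mem_level x_mem_K (List.ofFn σ)
    rw [List.length_ofFn] at h
    refine ⟨level_K_le_N _ h, ?_⟩
    rw [alphaBeta_apply, alpha, collect_atVertex epsX_one, epsX_x, one_smul, beta_eq_zero m h]
  have hβ : ∀ σ : Fin m → ZMod 2, ∃ h : atVertex (List.ofFn σ) (x ^ 2) ∈ N (m + 1),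
      alphaBeta m ⟨_, h⟩ = Multiplicative.ofAdd (0, monomial σ) := by
    intro σ
    have h := atVertex_mem_level (mem_conjClosure_self (x ^ 2)) (List.ofFn σ)
    have h' := atVertex_mem_level (Subgroup.mem_zpowers (x ^ 2)) (List.ofFn σ)
    rw [List.length_ofFn] at h h'
    refine ⟨level_T_le_N _ h, ?_⟩
    rw [alphaBeta_apply, alpha_eq_zero m h', beta, collect_atVertex epsYLeft_one, epsYLeft_x_sq,
      one_smul]
  refine ⟨fun p => ?_, ?_, hα, hβ⟩
  · have h1 : ∀ u : V (m + 1), Multiplicative.ofAdd (u, (0 : V m)) ∈ (alphaBeta m).range := by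
      intro u
      induction u using V_induction with
      | h0 => exact one_mem _
      | hm σ => obtain ⟨h, e⟩ := hα σ; exact ⟨_, e⟩
      | ha u w hu hw =>
        have := mul_mem hu hw
        rwa [← ofAdd_add, Prod.mk_add_mk, add_zero] at this
    have h2 : ∀ u : V m, Multiplicative.ofAdd ((0 : V (m + 1)), u) ∈ (alphaBeta m).range := by
      intro u
      induction u using V_induction with
      | h0 => exact one_mem _
      | hm σ => obtain ⟨h, e⟩ := hβ σ; exact ⟨_, e⟩
      | ha u w hu hw =>
        have := mul_mem hu hw
        rwa [← ofAdd_add, Prod.mk_add_mk, add_zero] at this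
    have := mul_mem (h1 p.toAdd.1) (h2 p.toAdd.2)
    rwa [← ofAdd_add, Prod.mk_add_mk, add_zero, zero_add] at this
  · ext g
    constructor
    · rintro ⟨g, h, rfl⟩
      exact (mem_N_succ_iff m g.2).2 (Prod.ext_iff.1 h)
    · intro hg
      have hle := N_succ_le m hg
      exact ⟨⟨g, hle⟩, Prod.ext_iff.2 ((mem_N_succ_iff m hle).1 hg), rfl⟩

end Grigorchuk
end

noncomputable section

namespace Grigorchuk

/-! ### The upper bound for the dimension series -/

theorem alpha_mul_inv {m : ℕ} {g h : Equiv.Perm Word} (hg : g ∈ N (m + 1)) (hh : h ∈ N (m + 1)) :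
    alpha (m + 1) (g * h⁻¹) = alpha (m + 1) g + alpha (m + 1) h := by
  have := alpha_mul (mul_mem hg (inv_mem hh)) hh
  rw [inv_mul_cancel_right] at this
  rw [this, add_assoc, char_two_V, add_zero]

theorem beta_mul_inv {m : ℕ} {g h : Equiv.Perm Word} (hg : g ∈ N (m + 1)) (hh : h ∈ N (m + 1)) :
    beta m (g * h⁻¹) = beta m g + beta m h := by
  have := beta_mul (mul_mem hg (inv_mem hh)) hh
  rw [inv_mul_cancel_right] at this
  rw [this, add_assoc, char_two_V, add_zero]

/-- On the series `H`, the images under `α` and `β` lie in `VPow (m + 1) r` and `VPow m (r / 2)`.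
The index `2 ^ (m + 2) + 1 + r` is halved by the recursion for `H`, and `join_mem` halves `r` in
the same way. For even `r` the sections agree modulo `H'` only; the induction therefore carries
the stronger bound for `β` on `H'`. -/
theorem alpha_beta_mem_VPow : ∀ m r, r ≤ 2 ^ (m + 1) →
    (∀ g ∈ H (2 ^ (m + 1) + 1 + r),
      alpha (m + 1) g ∈ VPow (m + 1) r ∧ beta m g ∈ VPow m (r / 2)) ∧
    ∀ g ∈ H' (2 ^ (m + 1) + 1 + r), beta m g ∈ VPow m ((r + 1) / 2)
  | 0, 0, _ => by
    rw [Nat.zero_div, VPow_zero, VPow_zero]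
    exact ⟨fun _ _ => ⟨trivial, trivial⟩, fun _ _ => trivial⟩
  | 0, 1, _ => by
    have e : 2 ^ (0 + 1) + 1 + 1 = 2 * 2 := rfl
    rw [e, H_even le_rfl, H'_even le_rfl, H_two, H'_two, H_three]
    refine ⟨fun g hg => ?_, fun g hg => ?_⟩
    · obtain ⟨g₀, h0, g₁, h1, -, -, h, rfl⟩ := exists_of_mem_diagonal hg
      refine ⟨?_, VPow_zero 0 ▸ trivial⟩
      rw [← N_one] at h
      have hd := mul_mem h0 (inv_mem h1)
      have hX := ((mem_N_one_iff hd).1 h).1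
      have hinv := epsX_mul hd h1
      rw [inv_mul_cancel_right, hX, zero_add] at hinv
      rw [alpha_pair, alpha, alpha, collect, collect, hinv]
      refine join_mem (VPow_zero 0 ▸ trivial) ?_
      rw [char_two_V]
      exact zero_mem _
    · rw [H'_three] at hg
      obtain ⟨g₀, h0, g₁, h1, -, -, h, rfl⟩ := exists_of_mem_diagonal hg
      rw [beta, collect, epsYLeft_pair, epsY_K h0, zero_smul]
      exact zero_mem _
  | 0, 2, _ => by
    have h5 : ∀ g ∈ H 5, alpha 1 g = 0 ∧ beta 0 g = 0 := fun g hg =>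
      have h : g ∈ N 2 := H_le_N 1 hg
      (mem_N_succ_iff 0 (N_succ_le 0 h)).1 h
    have e : 2 ^ (0 + 1) + 1 + 2 = 2 * 2 + 1 := rfl
    rw [e, H'_odd one_le_two, ← H_odd one_le_two]
    refine ⟨fun g hg => ?_, fun g hg => ?_⟩
    · rw [zero_add, (h5 g hg).1, (h5 g hg).2]
      exact ⟨zero_mem _, zero_mem _⟩
    · rw [(h5 g hg).2]
      exact zero_mem _
  | 0, r + 3, h => by omega
  | m + 1, r, hr => by
    have hN : ∀ {g j}, g ∈ H (2 ^ (m + 1) + 1 + j) → g ∈ N (m + 1) := fun hg =>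
      H_le_N m (H_antitone (Nat.le_add_right _ _) hg)
    have h2 := Nat.one_le_two_pow (n := m + 1)
    rcases Nat.even_or_odd' r with ⟨s, rfl | rfl⟩
    · have hs : s ≤ 2 ^ (m + 1) := by rw [pow_succ] at hr; omega
      obtain ⟨ih, ih'⟩ := alpha_beta_mem_VPow m s hs
      have e : 2 ^ (m + 1 + 1) + 1 + 2 * s = 2 * (2 ^ (m + 1) + s) + 1 := by
        rw [pow_succ]; omega
      have e' : 2 ^ (m + 1) + s + 1 = 2 ^ (m + 1) + 1 + s := by omega
      have key : ∀ g ∈ H (2 ^ (m + 1 + 1) + 1 + 2 * s), alpha (m + 1 + 1) g ∈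
          VPow (m + 1 + 1) (2 * s) ∧ beta (m + 1) g ∈ VPow (m + 1) s := by
        rw [e, H_odd (by omega), e']
        intro g hg
        obtain ⟨g₀, h0, g₁, h1, -, -, h, rfl⟩ := exists_of_mem_diagonal hg
        rw [alpha_pair, beta_pair]
        refine ⟨join_mem ?_ ?_, join_mem (ih _ h1).2 ?_⟩
        · rw [Nat.mul_div_cancel_left _ two_pos]
          exact (ih _ h1).1
        · rw [show (2 * s + 1) / 2 = s by omega]
          exact add_mem (ih _ h0).1 (ih _ h1).1
        · rw [← beta_mul_inv (hN h0) (hN h1)]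
          exact ih' _ h
      rw [show 2 * s / 2 = s by omega, show (2 * s + 1) / 2 = s by omega]
      refine ⟨key, fun g hg => (key g ?_).2⟩
      rw [e, H_odd (by omega)]
      rwa [e, H'_odd (by omega)] at hg
    · have hs : s + 1 ≤ 2 ^ (m + 1) := by rw [pow_succ] at hr; omega
      obtain ⟨ih, ih'⟩ := alpha_beta_mem_VPow m s (by omega)
      obtain ⟨jh, jh'⟩ := alpha_beta_mem_VPow m (s + 1) hs
      have e : 2 ^ (m + 1 + 1) + 1 + (2 * s + 1) = 2 * (2 ^ (m + 1) + 1 + s) := by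
        rw [pow_succ]; omega
      have e' : 2 ^ (m + 1) + 1 + s + 1 = 2 ^ (m + 1) + 1 + (s + 1) := by omega
      rw [e, H_even (by omega), H'_even (by omega), e',
        show (2 * s + 1) / 2 = s by omega, show (2 * s + 1 + 1) / 2 = s + 1 by omega]
      refine ⟨fun g hg => ?_, fun g hg => ?_⟩
      · obtain ⟨g₀, h0, g₁, h1, -, -, h, rfl⟩ := exists_of_mem_diagonal hg
        rw [alpha_pair, beta_pair]
        refine ⟨join_mem ?_ ?_, join_mem (ih _ h1).2 ?_⟩
        · rw [show (2 * s + 1) / 2 = s by omega]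
          exact (ih _ h1).1
        · rw [show (2 * s + 1 + 1) / 2 = s + 1 by omega, ← alpha_mul_inv (hN h0) (hN h1)]
          exact (jh _ h).1
        · rw [← beta_mul_inv (hN h0) (hN h1)]
          exact (jh _ h).2
      · obtain ⟨g₀, h0, g₁, h1, -, -, h, rfl⟩ := exists_of_mem_diagonal hg
        have hle : ∀ {g j}, g ∈ H' (2 ^ (m + 1) + 1 + j) → g ∈ N (m + 1) :=
          fun hg => hN (H'_le (by omega) hg)
        rw [beta_pair]
        refine join_mem (ih' _ h1) ?_
        rw [← beta_mul_inv (hle h0) (hle h1)]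
        exact jh' _ h

end Grigorchuk
end

noncomputable section

namespace Grigorchuk

/-! ### The lower bound for the dimension series -/

/-- For `r < 2 ^ m`, the element of the `2 ^ m`-fold product whose components are `y` or `1`
according to the coefficients of `v_m^r`. The values for `r ≥ 2 ^ m` are chosen such that
`spread y m (2 ^ m) = spread y (m + 1) 0`. -/
def spread (y : Equiv.Perm Word) : ℕ → ℕ → Equiv.Perm Word
  | 0, 0 => y
  | 0, _ + 1 => pair y 1
  | m + 1, r => pair (spread y m (r / 2)) (if r % 2 = 0 then 1 else spread y m (r / 2))

variable (y : Equiv.Perm Word)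

theorem spread_even (m r : ℕ) : spread y (m + 1) (2 * r) = pair (spread y m r) 1 := by
  rw [spread, Nat.mul_mod_right, if_pos rfl, Nat.mul_div_cancel_left _ two_pos]

theorem spread_odd (m r : ℕ) :
    spread y (m + 1) (2 * r + 1) = pair (spread y m r) (spread y m r) := by
  rw [spread, if_neg (by omega), show (2 * r + 1) / 2 = r by omega]

theorem spread_two_pow : ∀ m, spread y m (2 ^ m) = spread y (m + 1) 0
  | 0 => rfl
  | m + 1 => by rw [pow_succ', spread_even, spread_two_pow m, ← spread_even]

theorem spread_sq : ∀ m r, spread y m r ^ 2 = spread (y ^ 2) m r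
  | 0, 0 => rfl
  | 0, r + 1 => by rw [spread, spread, pair_pow_two, one_pow]
  | m + 1, r => by
    rcases Nat.even_or_odd' r with ⟨s, rfl | rfl⟩
    · rw [spread_even, spread_even, pair_pow_two, one_pow, spread_sq]
    · rw [spread_odd, spread_odd, pair_pow_two, spread_sq]

/-- For `r < 2 ^ m` the element `spread y m r` lies in the product of copies of any group that
contains `y`. -/
theorem spread_mem_level {Q : Subgroup (Equiv.Perm Word)} (hy : y ∈ Q) :
    ∀ {m r}, r < 2 ^ m → spread y m r ∈ level Q m
  | 0, 0, _ => by rwa [level_zero]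
  | 0, r + 1, h => absurd h (by simp)
  | m + 1, r, h => by
    have hs : r / 2 < 2 ^ m := by rw [pow_succ] at h; omega
    have := spread_mem_level hy hs
    rw [spread, pair_mem_level_succ]
    refine ⟨this, ?_⟩
    split_ifs
    · exact one_mem _
    · exact this

/-- The element `spread y m r` realizes `v_m^r`. -/
theorem collect_spread {f : Equiv.Perm Word → ZMod 2} (h1 : f 1 = 0) :
    ∀ {m r}, r < 2 ^ m → collect f m (spread y m r) = f y • v m r
  | 0, 0, _ => rfl
  | 0, r + 1, h => absurd h (by simp)
  | m + 1, r, h => by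
    rcases Nat.even_or_odd' r with ⟨s, rfl | rfl⟩
    · rw [spread_even, collect_pair, collect_one h1,
        collect_spread h1 (by rw [pow_succ] at h; omega), v_even', join, join, map_smul, map_zero,
        mul_zero, add_zero, add_zero]
    · rw [spread_odd, collect_pair, collect_spread h1 (by rw [pow_succ] at h; omega), v_odd', join,
        join, map_smul, mul_smul_comm, smul_add]

theorem spread_eq_atVertex : ∀ m, spread y m 0 = atVertex (List.replicate m 0) y
  | 0 => by rw [spread, List.replicate_zero, atVertex_nil]
  | m + 1 => by
    rw [List.replicate_succ, atVertex_zero_cons, ← spread_eq_atVertex, ← spread_even]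

theorem a_conj_pair_one {q : Equiv.Perm Word} : ⁅a, pair q 1⁆ = pair q⁻¹ q := by
  rw [commutatorElement_def, a_inv, a_conj_pair, pair_inv, pair_mul, one_mul, inv_one, mul_one]

theorem commutator_a_spread_odd (m r : ℕ) : ⁅a, spread x (m + 1) (2 * r + 1)⁆ = 1 := by
  rw [spread_odd, commutatorElement_eq_one_iff_mul_comm, a_mul_pair]

theorem commutator_d_spread_even (m r : ℕ) : ⁅d, spread x (m + 1) (2 * r)⁆ = 1 := by
  rw [spread_even, d_eq, pair_commutator, commutatorElement_one_left, commutatorElement_one_right,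
    pair_one_one]

theorem commutator_a_spread_even {m r : ℕ} (hr : r < 2 ^ m) : ∃ t ∈ level T (m + 1),
    ⁅a, spread x (m + 1) (2 * r)⁆ = spread x (m + 1) (2 * r + 1) * t := by
  refine ⟨pair (spread x m r ^ 2)⁻¹ 1, pair_mem_level_succ.2 ⟨inv_mem ?_, one_mem _⟩, ?_⟩
  · rw [spread_sq]
    exact spread_mem_level _ (mem_conjClosure_self _) hr
  · rw [spread_even, spread_odd, a_conj_pair_one, pair_mul]
    congr 1
    group

/-- For odd `r` the generator `u` descends along the tree: its section at `1` moves the right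
half of the element, and its section at `0` fixes the left half modulo `T_m`. -/
theorem commutator_spread_odd : ∀ m r, r < 2 ^ m → (m = 0 ∨ r % 2 = 1) →
    ⁅a, spread x m r⁆ ∈ level T m ∧ ∃ u, (u = b ∨ u = c ∨ u = d) ∧ ∃ g ∈ GG, ∃ t ∈ level T m,
      ⁅u, spread x m r⁆ = g * spread x m (r + 1) * g⁻¹ * t
  | 0, 0, _, _ => by
    refine ⟨?_, d, Or.inr (Or.inr rfl), a * c, mul_mem a_mem c_mem, 1, one_mem _, ?_⟩
    · rw [level_zero, spread, commutator_a_x]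
      exact inv_mem (mem_conjClosure_self _)
    · have e : a * x * a⁻¹ = x⁻¹ := by
        have := commutator_a_x
        rw [commutatorElement_def, mul_inv_eq_iff_eq_mul] at this
        rw [this, pow_two]; group
      have e1 : a * c * pair x 1 * (a * c)⁻¹ = a * (c * pair x 1 * c⁻¹) * a := by
        rw [mul_inv_rev, a_inv]; group
      rw [spread, spread, commutator_d_x, e1, mul_one, c_eq, pair_conj, e, mul_one,
        mul_inv_cancel, a_conj_pair]
  | 0, r + 1, h, _ => absurd h (by simp)
  | m + 1, r, hr, h => by
    obtain ⟨s, rfl⟩ : ∃ s, r = 2 * s + 1 := ⟨r / 2, by omega⟩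
    have hs : s < 2 ^ m := by rw [pow_succ] at hr; omega
    refine ⟨commutator_a_spread_odd m s ▸ one_mem _, ?_⟩
    rw [spread_odd, show 2 * s + 1 + 1 = 2 * (s + 1) by ring, spread_even]
    by_cases h' : m = 0 ∨ s % 2 = 1
    · obtain ⟨ha, u', hu', g', hg', t', ht', e⟩ := commutator_spread_odd m s hs h'
      obtain ⟨u₀, hu, h0⟩ : ∃ u₀, (pair u₀ u' = b ∨ pair u₀ u' = c ∨ pair u₀ u' = d) ∧
          ⁅u₀, spread x m s⁆ ∈ level T m := by
        rcases hu' with rfl | rfl | rfl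
        · refine ⟨1, Or.inr (Or.inr d_eq.symm), ?_⟩
          rw [commutatorElement_one_left]; exact one_mem _
        · exact ⟨a, Or.inl b_eq.symm, ha⟩
        · exact ⟨a, Or.inr (Or.inl c_eq.symm), ha⟩
      obtain ⟨k, hk⟩ := exists_pair_left hg'
      refine ⟨_, hu, pair k g' * a, mul_mem (pair_swap_mem hk) a_mem, _,
        pair_mem_level_succ.2 ⟨h0, ht'⟩, ?_⟩
      have e1 : pair k g' * a * pair (spread x m (s + 1)) 1 * (pair k g' * a)⁻¹ =
          pair 1 (g' * spread x m (s + 1) * g'⁻¹) := by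
        have : pair k g' * a * pair (spread x m (s + 1)) 1 * (pair k g' * a)⁻¹ =
            pair k g' * (a * pair (spread x m (s + 1)) 1 * a) * (pair k g')⁻¹ := by
          rw [mul_inv_rev, a_inv]; group
        rw [this, a_conj_pair, pair_conj, mul_one, mul_inv_cancel]
      rw [e1, pair_commutator, e, pair_mul, one_mul]
    · obtain ⟨m, rfl⟩ := Nat.exists_eq_succ_of_ne_zero (fun h0 => h' (Or.inl h0))
      obtain ⟨l, rfl⟩ : ∃ l, s = 2 * l := ⟨s / 2, by omega⟩
      obtain ⟨t, ht, e⟩ := commutator_a_spread_even (m := m) (r := l)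
        (by rw [pow_succ] at hs; omega)
      refine ⟨c, Or.inr (Or.inl rfl), 1, one_mem _, pair t 1,
        pair_mem_level_succ.2 ⟨ht, one_mem _⟩, ?_⟩
      conv_lhs => rw [c_eq]
      rw [pair_commutator, commutator_d_spread_even, e, one_mul, inv_one, mul_one, pair_mul,
        mul_one]

/-- Up to conjugation and modulo `T_m`, a commutator with an element of `𝔊` leads from
`spread x m r` to `spread x m (r + 1)`. -/
theorem exists_commutator_spread {m r : ℕ} (hr : r < 2 ^ m) : ∃ u ∈ GG, ∃ g ∈ GG,
    ∃ t ∈ level T m, ⁅u, spread x m r⁆ = g * spread x m (r + 1) * g⁻¹ * t := by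
  by_cases h : m = 0 ∨ r % 2 = 1
  · obtain ⟨-, u, hu, h⟩ := commutator_spread_odd m r hr h
    refine ⟨u, ?_, h⟩
    rcases hu with rfl | rfl | rfl
    exacts [b_mem, c_mem, d_mem]
  · obtain ⟨m, rfl⟩ := Nat.exists_eq_succ_of_ne_zero (fun h0 => h (Or.inl h0))
    obtain ⟨l, rfl⟩ : ∃ l, r = 2 * l := ⟨r / 2, by omega⟩
    obtain ⟨t, ht, e⟩ := commutator_a_spread_even (m := m) (r := l) (by rw [pow_succ] at hr; omega)
    exact ⟨a, a_mem, 1, one_mem _, t, ht, by rw [e, one_mul, inv_one, mul_one]⟩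

/-! ### Elementary properties of the dimension series -/

/-- `[g, h] - 1 = ((g - 1)(h - 1) - (h - 1)(g - 1)) (h g)⁻¹` in the group algebra. -/
theorem commutator_mem_dimSubgroup {k G : Type*} [Field k] [Group G] {n : ℕ} (g : G) {h : G}
    (hh : h ∈ dimSubgroup k G n) : ⁅g, h⁆ ∈ dimSubgroup k G (n + 1) := by
  change toAlg k ⁅g, h⁆ - 1 ∈ augIdeal k G ^ (n + 1)
  have aug : toAlg k g - 1 ∈ augIdeal k G := by
    simp [augIdeal, RingHom.mem_ker, augmentation, toAlg]
  have e : toAlg k ⁅g, h⁆ - 1 = ((toAlg k g - 1) * (toAlg k h - 1) -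
      (toAlg k h - 1) * (toAlg k g - 1)) * toAlg k (h * g)⁻¹ := by
    have e1 : (toAlg k g - 1) * (toAlg k h - 1) - (toAlg k h - 1) * (toAlg k g - 1)
        = toAlg k (g * h) - toAlg k (h * g) := by
      simp only [toAlg, map_mul]; noncomm_ring
    rw [e1, sub_mul, ← map_mul, ← map_mul, mul_inv_cancel, map_one, commutatorElement_def,
      mul_inv_rev, mul_assoc]
  rw [e]
  refine Ideal.mul_mem_right _ _ (sub_mem ?_ ?_)
  · rw [Ideal.IsTwoSided.pow_succ]
    exact Ideal.mul_mem_mul aug hh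
  · rw [Submodule.pow_succ]
    exact Ideal.mul_mem_mul hh aug

theorem D_le_GG (n : ℕ) : D n ≤ GG := by
  rintro _ ⟨g, -, rfl⟩
  exact g.2

theorem D_isGNormal (n : ℕ) : IsGNormal (D n) := by
  refine ⟨D_le_GG n, ?_⟩
  rintro u _ hu ⟨g, hg, rfl⟩
  exact ⟨_, (dimSubgroup_normal (ZMod 2) GG n).conj_mem g hg ⟨u, hu⟩, rfl⟩

theorem D_antitone : Antitone D := fun _ _ h => by
  rintro _ ⟨g, hg, rfl⟩
  exact ⟨g, Ideal.pow_le_pow_right h hg, rfl⟩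

theorem D_one : D 1 = GG := by
  refine le_antisymm (D_le_GG 1) fun g hg => ⟨⟨g, hg⟩, ?_, rfl⟩
  change toAlg (ZMod 2) _ - 1 ∈ augIdeal (ZMod 2) GG ^ 1
  rw [Submodule.pow_one]
  simp [augIdeal, RingHom.mem_ker, augmentation, toAlg]

theorem commutator_mem_D {n : ℕ} {g h : Equiv.Perm Word} (hg : g ∈ GG) (hh : h ∈ D n) :
    ⁅g, h⁆ ∈ D (n + 1) := by
  obtain ⟨h, hh, rfl⟩ := hh
  exact ⟨⁅⟨g, hg⟩, h⁆, commutator_mem_dimSubgroup _ hh, rfl⟩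

theorem sq_mem_D {n : ℕ} {g : Equiv.Perm Word} (hg : g ∈ D n) : g ^ 2 ∈ D (2 * n) := by
  obtain ⟨g, hg, rfl⟩ := hg
  refine ⟨g ^ 2, ?_, rfl⟩
  change toAlg (ZMod 2) _ - 1 ∈ augIdeal (ZMod 2) GG ^ (2 * n)
  rw [← WeightSpan.toAlg_sub_one_sq, two_mul, Ideal.IsTwoSided.pow_add]
  exact Ideal.mul_mem_mul hg hg

theorem x_mem_D : x ∈ D 2 := commutator_mem_D a_mem (D_one.symm ▸ b_mem)

/-! ### The elements `spread x m r` in the dimension series -/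

/-- All copies of conjugates of `x` on level `m` are conjugate in `𝔊` to `spread x m 0`. -/
theorem level_K_le_D_of_spread {m n : ℕ} (h : spread x m 0 ∈ D n) : level K m ≤ D n := by
  refine level_le_of_atVertex fun σ hσ q hq => ?_
  suffices hK : K ≤ (D n).comap (atVertexHom σ) from hK hq
  refine conjClosure_le fun u hu => ?_
  rw [spread_eq_atVertex] at h
  obtain ⟨w, hw, e⟩ := exists_conj_atVertex hu (σ := List.replicate m 0) (τ := σ) (by simp [hσ])
  have := (D_isGNormal n).conj hw h
  rw [e] at this
  exact this

/-- The generators of `T` are the squares of those of `K`. -/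
theorem level_T_le_D {m n : ℕ} (h : level K m ≤ D n) : level T m ≤ D (2 * n) := by
  refine level_le_of_atVertex fun σ hσ q hq => ?_
  suffices hK : T ≤ (D (2 * n)).comap (atVertexHom σ) from hK hq
  refine conjClosure_le fun u hu => ?_
  have h1 := atVertex_mem_level (K_isGNormal.conj hu x_mem_K) σ
  rw [hσ] at h1
  have h2 := sq_mem_D (h h1)
  change atVertexHom σ _ ∈ D (2 * n)
  rwa [show u * x ^ 2 * u⁻¹ = (u * x * u⁻¹) ^ 2 by rw [pow_two, pow_two]; group, map_pow]

/-- The lower bound: each commutator with `𝔊` gains one step in the dimension series. After `2 ^ m`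
steps on level `m` the element `spread x (m + 1) 0` of the next level is reached. -/
theorem spread_mem_D : ∀ m r, r ≤ 2 ^ m → spread x m r ∈ D (2 ^ m + 1 + r) := by
  have step : ∀ m, spread x m 0 ∈ D (2 ^ m + 1) →
      ∀ r, r ≤ 2 ^ m → spread x m r ∈ D (2 ^ m + 1 + r) := by
    intro m h0 r
    have hT := level_T_le_D (level_K_le_D_of_spread h0)
    induction r with
    | zero => exact fun _ => h0
    | succ r ih =>
      intro hr
      obtain ⟨u, hu, g, hg, t, ht, e⟩ := exists_commutator_spread (m := m) (r := r) (by omega)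
      have h1 := commutator_mem_D hu (ih (by omega))
      -- `T_m` lies in degree `2 (2 ^ m + 1)`, beyond every degree that occurs on level `m`.
      have h2 : t ∈ D (2 ^ m + 1 + r + 1) := D_antitone (by omega) (hT ht)
      rw [e] at h1
      have h3 := (D_isGNormal _).conj' hg ((Subgroup.mul_mem_cancel_right _ h2).1 h1)
      rwa [show g⁻¹ * (g * spread x m (r + 1) * g⁻¹) * g = spread x m (r + 1) by group] at h3
  intro m
  induction m with
  | zero => exact step 0 x_mem_D
  | succ m ih =>
    refine step _ ?_
    have := ih _ le_rfl
    rw [spread_two_pow] at this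
    rwa [pow_succ, mul_two, add_assoc, add_comm _ 1, ← add_assoc]

theorem level_K_le_D (m : ℕ) : level K m ≤ D (2 ^ m + 1) :=
  level_K_le_D_of_spread (spread_mem_D m 0 (Nat.zero_le _))

theorem N_le_D (m : ℕ) : N (m + 1) ≤ D (2 ^ (m + 1) + 1) := by
  refine sup_le (level_K_le_D _) ((level_T_le_D (level_K_le_D m)).trans (D_antitone ?_))
  rw [pow_succ]; omega

end Grigorchuk
end

noncomputable section

namespace Grigorchuk

/-! ### The dimension series -/

/-- The elements `spread x (m + 1) s` and the squares of the elements `spread x m s` realize the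
bases of `VPow (m + 1) r` and `VPow m (r / 2)` inside the dimension series. -/
theorem exists_mem_D_alphaBeta {m r : ℕ} {u : V (m + 1)} {w : V m} (hu : u ∈ VPow (m + 1) r)
    (hw : w ∈ VPow m (r / 2)) : ∃ p ∈ N (m + 1), p ∈ D (2 ^ (m + 1) + 1 + r) ∧
      alpha (m + 1) p = u ∧ beta m p = w := by
  let S := ((D (2 ^ (m + 1) + 1 + r)).subgroupOf (N (m + 1))).map (alphaBeta m)
  have hS : ∀ {p u w}, p ∈ N (m + 1) → p ∈ D (2 ^ (m + 1) + 1 + r) → alpha (m + 1) p = u →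
      beta m p = w → Multiplicative.ofAdd (u, w) ∈ S := by
    rintro p _ _ h1 h2 rfl rfl
    exact ⟨⟨p, h1⟩, h2, rfl⟩
  have h1 : ∀ u ∈ VPow (m + 1) r, Multiplicative.ofAdd (u, (0 : V m)) ∈ S := by
    intro u hu
    induction hu using Submodule.span_induction with
    | mem u h =>
      obtain ⟨s, ⟨h1, h2⟩, rfl⟩ := h
      have hK := spread_mem_level x x_mem_K h2
      refine hS (level_K_le_N _ hK) (D_antitone (by omega) (spread_mem_D (m + 1) s h2.le)) ?_
        (beta_eq_zero m hK)
      rw [alpha, collect_spread x epsX_one h2, epsX_x, one_smul]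
    | zero => exact one_mem S
    | add u w _ _ hu hw =>
      have := mul_mem hu hw
      rwa [← ofAdd_add, Prod.mk_add_mk, add_zero] at this
    | smul s u _ hu =>
      rcases letter_cases s with rfl | rfl
      · rw [zero_smul]; exact one_mem S
      · rwa [one_smul]
  have h2 : ∀ u ∈ VPow m (r / 2), Multiplicative.ofAdd ((0 : V (m + 1)), u) ∈ S := by
    intro u hu
    induction hu using Submodule.span_induction with
    | mem u h =>
      obtain ⟨s, ⟨h1, h2⟩, rfl⟩ := h
      have hT := spread_mem_level (x ^ 2) (mem_conjClosure_self _) h2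
      have hZ := spread_mem_level (x ^ 2) (Subgroup.mem_zpowers _) h2
      refine hS (level_T_le_N _ hT) ?_ (alpha_eq_zero m hZ) ?_
      · rw [← spread_sq]
        refine D_antitone ?_ (sq_mem_D (spread_mem_D m s h2.le))
        rw [pow_succ]; omega
      · rw [beta, collect_spread _ epsYLeft_one h2, epsYLeft_x_sq, one_smul]
    | zero => exact one_mem S
    | add u w _ _ hu hw =>
      have := mul_mem hu hw
      rwa [← ofAdd_add, Prod.mk_add_mk, add_zero] at this
    | smul s u _ hu =>
      rcases letter_cases s with rfl | rfl
      · rw [zero_smul]; exact one_mem S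
      · rwa [one_smul]
  have := mul_mem (h1 u hu) (h2 w hw)
  rw [← ofAdd_add, Prod.mk_add_mk, add_zero, zero_add] at this
  obtain ⟨p, hp, e⟩ := this
  exact ⟨p, p.2, hp, Prod.ext_iff.1 e⟩

theorem D_eq_N (m : ℕ) : D (2 ^ (m + 1) + 1) = N (m + 1) :=
  le_antisymm ((D_le_H _).trans (H_le_N m)) (N_le_D m)

theorem D_le_N (m r : ℕ) : D (2 ^ (m + 1) + 1 + r) ≤ N (m + 1) :=
  (D_antitone (Nat.le_add_right _ _)).trans (D_eq_N m).le

theorem N_succ_le_D {m r : ℕ} (hr : r ≤ 2 ^ (m + 1)) :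
    N (m + 2) ≤ D (2 ^ (m + 1) + 1 + r) :=
  (N_le_D (m + 1)).trans (D_antitone (by rw [pow_succ _ (m + 1)]; omega))

/-- Two elements of `N_{m+1}` with the same image under `α ⊕ β` differ by `N_{m+2}`. -/
theorem mul_inv_mem_N_succ {m : ℕ} {g h : Equiv.Perm Word} (hg : g ∈ N (m + 1))
    (hh : h ∈ N (m + 1)) (hα : alpha (m + 1) g = alpha (m + 1) h) (hβ : beta m g = beta m h) :
    g * h⁻¹ ∈ N (m + 2) := by
  rw [mem_N_succ_iff m (mul_mem hg (inv_mem hh)), alpha_mul_inv hg hh, beta_mul_inv hg hh, hα, hβ,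
    char_two_V, char_two_V]
  exact ⟨rfl, rfl⟩

/-- The dimension series in terms of `α` and `β`: the upper bound gives the conditions on the
images, and the elements with these images modulo `N_{m+2}` are supplied by the lower bound. -/
theorem mem_D_iff {m r : ℕ} (hr : r ≤ 2 ^ (m + 1)) {g : Equiv.Perm Word} :
    g ∈ D (2 ^ (m + 1) + 1 + r) ↔
      g ∈ N (m + 1) ∧ alpha (m + 1) g ∈ VPow (m + 1) r ∧ beta m g ∈ VPow m (r / 2) := by
  constructor
  · exact fun hg => ⟨D_le_N m r hg, (alpha_beta_mem_VPow m r hr).1 g (D_le_H _ hg)⟩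
  · rintro ⟨hg, hα, hβ⟩
    obtain ⟨p, hp, hD, e, e'⟩ := exists_mem_D_alphaBeta hα hβ
    have := mul_mem (N_succ_le_D hr (mul_inv_mem_N_succ hg hp e.symm e'.symm)) hD
    rwa [inv_mul_cancel_right] at this

theorem coe_D_eq {m r : ℕ} (hr : r ≤ 2 ^ (m + 1)) :
    (D (2 ^ (m + 1) + 1 + r) : Set (Equiv.Perm Word)) =
      (N (m + 2) : Set (Equiv.Perm Word)) * alphaInv (alphaBeta m) (VPow (m + 1) r) *
        betaInv (alphaBeta m) (VPow m (r / 2)) := by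
  ext g
  constructor
  · intro hg
    obtain ⟨hN, hα, hβ⟩ := (mem_D_iff hr).1 hg
    obtain ⟨p, hp, -, e, e'⟩ := exists_mem_D_alphaBeta hα (zero_mem (VPow m (r / 2)))
    obtain ⟨q, hq, -, f, f'⟩ := exists_mem_D_alphaBeta (zero_mem (VPow (m + 1) r)) hβ
    refine ⟨g * (p * q)⁻¹ * p, ⟨g * (p * q)⁻¹, mul_inv_mem_N_succ hN (mul_mem hp hq) ?_ ?_, p,
      ⟨hp, ?_, e'⟩, rfl⟩, q, ⟨hq, f, ?_⟩, ?_⟩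
    · rw [alpha_mul hp hq, e, f, add_zero]
    · rw [beta_mul hp hq, e', f', zero_add]
    · change alpha (m + 1) p ∈ _
      rwa [e]
    · change beta m q ∈ _
      rwa [f']
    · simp only; group
  · rintro ⟨_, ⟨n, hn, p, ⟨hp, hα, e⟩, rfl⟩, q, ⟨hq, f, hβ⟩, rfl⟩
    refine mul_mem (mul_mem (N_succ_le_D hr hn) ((mem_D_iff hr).2 ⟨hp, hα, ?_⟩))
      ((mem_D_iff hr).2 ⟨hq, ?_, hβ⟩)
    · change beta m p = 0 at e
      rw [e]; exact zero_mem _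
    · change alpha (m + 1) q = 0 at f
      rw [f]; exact zero_mem _

/-! ### The ranks -/

/-- Modules over `𝔽₂` are unchanged by tensoring with `𝔽₂` over `ℤ`. -/
theorem rank_zmod_two_tensor (M : Type) [AddCommGroup M] [Module (ZMod 2) M] :
    Module.rank (ZMod 2) (ZMod 2 ⊗[ℤ] M) = Module.rank (ZMod 2) M := by
  let f : ZMod 2 ⊗[ℤ] M →ₗ[ZMod 2] M := LinearMap.liftBaseChange (ZMod 2) LinearMap.id
  have hf : ∀ c m, f (c ⊗ₜ m) = c • m := fun c m => by simp [f]
  have hinv : ∀ t, (1 : ZMod 2) ⊗ₜ[ℤ] f t = t := by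
    intro t
    induction t using TensorProduct.induction_on with
    | zero => rw [map_zero, TensorProduct.tmul_zero]
    | tmul c m =>
      rw [hf]
      rcases letter_cases c with rfl | rfl
      · rw [zero_smul, TensorProduct.tmul_zero, TensorProduct.zero_tmul]
      · rw [one_smul]
    | add s t hs ht => rw [map_add, TensorProduct.tmul_add, hs, ht]
  refine (LinearEquiv.ofBijective f ⟨fun s t h => ?_, fun m => ⟨1 ⊗ₜ m, ?_⟩⟩).rank_eq
  · rw [← hinv s, h, hinv]
  · rw [hf, one_smul]

/-- The rank of a layer may be computed from any homomorphism onto an `𝔽₂`-module whose kernel is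
the next term of the series. -/
theorem dimRank_eq {n : ℕ} {M : Type} [AddCommGroup M] [Module (ZMod 2) M]
    (f : D n →* Multiplicative M) (hf : Function.Surjective f)
    (hker : ∀ g : D n, f g = 1 ↔ (g : Equiv.Perm Word) ∈ D (n + 1)) :
    dimRank (ZMod 2) GG n = Module.rank (ZMod 2) M := by
  let e := (dimSubgroup (ZMod 2) GG n).equivMapOfInjective GG.subtype GG.subtype_injective
  let F := f.comp e.toMonoidHom
  have hF : F.ker = (dimSubgroup (ZMod 2) GG (n + 1)).subgroupOf (dimSubgroup (ZMod 2) GG n) := by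
    ext g
    refine (hker (e g)).trans ?_
    exact Subgroup.mem_map_iff_mem GG.subtype_injective
  let E : DimLayer (ZMod 2) GG n ≃* Multiplicative M :=
    (QuotientGroup.quotientMulEquivOfEq hF.symm).trans
      (QuotientGroup.quotientKerEquivOfSurjective F (hf.comp e.surjective))
  let E' : Additive (DimLayer (ZMod 2) GG n) ≃ₗ[ℤ] M :=
    (MulEquiv.toAdditiveLeft E).toIntLinearEquiv
  rw [dimRank, ← rank_zmod_two_tensor M]
  exact (LinearEquiv.baseChange ℤ (ZMod 2) _ _ E').rank_eq

theorem rank_zmod_two_prod : Module.rank (ZMod 2) (ZMod 2 × ZMod 2) = 2 := by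
  rw [rank_prod', Module.rank_self, one_add_one_eq_two]

theorem D_two : D 2 = derived := by
  refine le_antisymm ((D_le_H 2).trans H_two.le) fun g hg => ?_
  have hK : K ≤ D 2 := (level_zero K).ge.trans (level_K_le_D 0)
  have hz : z ∈ D 2 := commutator_mem_D a_mem (D_one.symm ▸ d_mem)
  rcases mem_K_or_z_mul_mem_K hg with h | h
  · exact hK h
  · exact (Subgroup.mul_mem_cancel_left _ hz).1 (hK h)

theorem dimRank_one : dimRank (ZMod 2) GG 1 = 3 := by
  have hle : D 1 ≤ GG := D_le_GG 1
  rw [dimRank_eq (M := ZMod 2 × ZMod 2 × ZMod 2) (abel.comp (Subgroup.inclusion hle)) ?_ ?_,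
    rank_prod', rank_zmod_two_prod, Module.rank_self]
  · norm_num
  · have hgen : ∀ {g : Equiv.Perm Word} {p : ZMod 2 × ZMod 2 × ZMod 2}, g ∈ GG →
        bit g [] = p.1 → bitSum₁ g = p.2.1 → bitSum₂ g = p.2.2 →
        Multiplicative.ofAdd p ∈ (abel.comp (Subgroup.inclusion hle)).range :=
      fun {g p} hg h0 h1 h2 => ⟨⟨g, D_one.symm ▸ hg⟩,
        congrArg Multiplicative.ofAdd (Prod.ext h0 (Prod.ext h1 h2))⟩
    have h1 : ∀ s : ZMod 2, Multiplicative.ofAdd (s, (0 : ZMod 2), (0 : ZMod 2)) ∈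
        (abel.comp (Subgroup.inclusion hle)).range := fun s => by
      rcases letter_cases s with rfl | rfl
      exacts [one_mem _, hgen a_mem bits_a.1 bits_a.2.1 bits_a.2.2]
    have h2 : ∀ s : ZMod 2, Multiplicative.ofAdd ((0 : ZMod 2), s, (0 : ZMod 2)) ∈
        (abel.comp (Subgroup.inclusion hle)).range := fun s => by
      rcases letter_cases s with rfl | rfl
      exacts [one_mem _, hgen c_mem bits_c.1 bits_c.2.1 bits_c.2.2]
    have h3 : ∀ s : ZMod 2, Multiplicative.ofAdd ((0 : ZMod 2), (0 : ZMod 2), s) ∈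
        (abel.comp (Subgroup.inclusion hle)).range := fun s => by
      rcases letter_cases s with rfl | rfl
      exacts [one_mem _, hgen d_mem bits_d.1 bits_d.2.1 bits_d.2.2]
    rintro ⟨s, t, u⟩
    have := mul_mem (mul_mem (h1 s) (h2 t)) (h3 u)
    simp only [← ofAdd_add, Prod.mk_add_mk, add_zero, zero_add] at this
    exact this
  · intro g
    have : (g : Equiv.Perm Word) ∈ derived ↔ abel ⟨g, hle g.2⟩ = 1 := by
      rw [mem_derived, and_iff_right (hle g.2)]
      change _ ↔ (bit g [], bitSum₁ g, bitSum₂ g) = (0, 0, 0)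
      rw [Prod.mk.injEq, Prod.mk.injEq]
    rw [one_add_one_eq_two, D_two, this]
    rfl

theorem dimRank_two : dimRank (ZMod 2) GG 2 = 2 := by
  have hD : ∀ g : D 2, (g : Equiv.Perm Word) ∈ derived := fun g => D_two ▸ g.2
  let f : D 2 →* Multiplicative (ZMod 2 × ZMod 2) := MonoidHom.mk'
    (fun g => Multiplicative.ofAdd (epsX g, epsY g)) fun g h => by
      rw [← ofAdd_add, Prod.mk_add_mk, ← epsX_mul (hD g) (hD h), ← epsY_mul (hD g) (hD h)]; rfl
  rw [dimRank_eq f ?_ ?_, rank_zmod_two_prod]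
  · have hx : Multiplicative.ofAdd ((1 : ZMod 2), (0 : ZMod 2)) ∈ f.range :=
      ⟨⟨x, x_mem_D⟩, congrArg Multiplicative.ofAdd (Prod.ext epsX_x epsY_x)⟩
    have hz : Multiplicative.ofAdd ((1 : ZMod 2), (1 : ZMod 2)) ∈ f.range :=
      ⟨⟨z, D_two ▸ z_mem⟩, congrArg Multiplicative.ofAdd (Prod.ext epsX_z epsY_z)⟩
    rintro ⟨s, t⟩
    rcases letter_cases s with rfl | rfl <;> rcases letter_cases t with rfl | rfl
    · exact one_mem f.range
    · exact mul_mem hx hz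
    · exact hx
    · exact hz
  · intro g
    rw [show 2 + 1 = 2 ^ (0 + 1) + 1 from rfl, D_eq_N, mem_N_one_iff (hD g)]
    exact Prod.ext_iff

/-- The homomorphism induced on a term of the dimension series by a linear form on
`V_{m+1} ⊕ V_m`. -/
def layerHom (m r : ℕ) {M : Type} [AddCommGroup M] [Module (ZMod 2) M]
    (l : V (m + 1) × V m →ₗ[ZMod 2] M) : D (2 ^ (m + 1) + 1 + r) →* Multiplicative M :=
  (AddMonoidHom.toMultiplicative l.toAddMonoidHom).comp
    ((alphaBeta m).comp (Subgroup.inclusion (D_le_N m r)))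

theorem layerHom_eq_one {m r : ℕ} {M : Type} [AddCommGroup M] [Module (ZMod 2) M]
    (l : V (m + 1) × V m →ₗ[ZMod 2] M) (g : D (2 ^ (m + 1) + 1 + r)) :
    layerHom m r l g = 1 ↔ l (alpha (m + 1) g, beta m g) = 0 := Iff.rfl

theorem exists_layerHom_eq {m r : ℕ} {M : Type} [AddCommGroup M] [Module (ZMod 2) M]
    (l : V (m + 1) × V m →ₗ[ZMod 2] M) {u : V (m + 1)} {w : V m} (hu : u ∈ VPow (m + 1) r)
    (hw : w ∈ VPow m (r / 2)) : ∃ g, layerHom m r l g = Multiplicative.ofAdd (l (u, w)) := by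
  obtain ⟨p, -, hD, rfl, rfl⟩ := exists_mem_D_alphaBeta hu hw
  exact ⟨⟨p, hD⟩, rfl⟩

/-- For even `r`, only `α` distinguishes the degrees `r` and `r + 1`, by the coordinate of `v^r`. -/
theorem dimRank_odd_layer {m r : ℕ} (hr : r < 2 ^ (m + 1)) (h : r % 2 = 0) :
    dimRank (ZMod 2) GG (2 ^ (m + 1) + 1 + r) = 1 := by
  let l := (vCoord (m + 1) r hr).comp (LinearMap.fst (ZMod 2) (V (m + 1)) (V m))
  rw [dimRank_eq (layerHom m r l) ?_ ?_, Module.rank_self]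
  · intro s
    obtain ⟨g, hg⟩ := exists_layerHom_eq l
      (Submodule.smul_mem _ (Multiplicative.toAdd s) (v_mem_VPow le_rfl hr))
      (zero_mem (VPow m (r / 2)))
    refine ⟨g, hg.trans (congrArg Multiplicative.ofAdd ?_)⟩
    change vCoord (m + 1) r hr (Multiplicative.toAdd s • v (m + 1) r) = Multiplicative.toAdd s
    rw [map_smul, vCoord_v, smul_eq_mul, mul_one]
  · intro g
    obtain ⟨hN, hα, hβ⟩ := (mem_D_iff hr.le).1 g.2
    rw [layerHom_eq_one, add_assoc _ r 1, mem_D_iff hr, mem_VPow_succ_iff hr,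
      show (r + 1) / 2 = r / 2 by omega]
    exact ⟨fun h => ⟨hN, ⟨hα, h⟩, hβ⟩, fun h => h.2.1.2⟩

/-- For odd `r`, both `α` and `β` distinguish the degrees `r` and `r + 1`. -/
theorem dimRank_even_layer {m r : ℕ} (hr : r < 2 ^ (m + 1)) (h : r % 2 = 1) :
    dimRank (ZMod 2) GG (2 ^ (m + 1) + 1 + r) = 2 := by
  have hr' : r / 2 < 2 ^ m := by rw [pow_succ] at hr; omega
  let l := (vCoord (m + 1) r hr).prodMap (vCoord m (r / 2) hr')
  rw [dimRank_eq (layerHom m r l) ?_ ?_, rank_zmod_two_prod]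
  · intro s
    obtain ⟨g, hg⟩ := exists_layerHom_eq l
      (Submodule.smul_mem _ (Multiplicative.toAdd s).1 (v_mem_VPow le_rfl hr))
      (Submodule.smul_mem _ (Multiplicative.toAdd s).2 (v_mem_VPow le_rfl hr'))
    refine ⟨g, hg.trans (congrArg Multiplicative.ofAdd (Prod.ext ?_ ?_))⟩
    · change vCoord (m + 1) r hr ((Multiplicative.toAdd s).1 • v (m + 1) r) = _
      rw [map_smul, vCoord_v, smul_eq_mul, mul_one]
      rfl
    · change vCoord m (r / 2) hr' ((Multiplicative.toAdd s).2 • v m (r / 2)) = _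
      rw [map_smul, vCoord_v, smul_eq_mul, mul_one]
      rfl
  · intro g
    obtain ⟨hN, hα, hβ⟩ := (mem_D_iff hr.le).1 g.2
    rw [layerHom_eq_one, add_assoc _ r 1, mem_D_iff hr, mem_VPow_succ_iff hr,
      show (r + 1) / 2 = r / 2 + 1 by omega, mem_VPow_succ_iff hr', Prod.ext_iff]
    exact ⟨fun h => ⟨hN, ⟨hα, h.1⟩, hβ, h.2⟩, fun h => ⟨h.2.1.2, h.2.2.2⟩⟩

/-- Every degree `i ≥ 3` lies in a range `2 ^ (m + 1) + 1 ≤ i ≤ 2 ^ (m + 2)`. -/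
theorem exists_layer {i : ℕ} (hi : 3 ≤ i) :
    ∃ m r, r < 2 ^ (m + 1) ∧ i = 2 ^ (m + 1) + 1 + r := by
  have h0 : i - 1 ≠ 0 := by omega
  obtain ⟨m, hm⟩ : ∃ m, Nat.log 2 (i - 1) = m + 1 :=
    Nat.exists_eq_succ_of_ne_zero (Nat.log_pos one_lt_two (by omega)).ne'
  have h1 := Nat.pow_log_le_self 2 h0
  have h2 := Nat.lt_pow_succ_log_self one_lt_two (i - 1)
  rw [hm] at h1 h2
  rw [pow_succ] at h2
  exact ⟨m, i - 1 - 2 ^ (m + 1), by omega, by omega⟩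

theorem dimRank_even {i : ℕ} (hi : 1 < i) (h : Even i) : dimRank (ZMod 2) GG i = 2 := by
  obtain rfl | h3 : i = 2 ∨ 3 ≤ i := by omega
  · exact dimRank_two
  · obtain ⟨m, r, hr, rfl⟩ := exists_layer h3
    refine dimRank_even_layer hr ?_
    rw [Nat.even_iff, pow_succ] at h
    omega

theorem dimRank_odd {i : ℕ} (hi : 1 < i) (h : Odd i) : dimRank (ZMod 2) GG i = 1 := by
  obtain rfl | h3 : i = 2 ∨ 3 ≤ i := by omega
  · exact absurd h (by decide)
  · obtain ⟨m, r, hr, rfl⟩ := exists_layer h3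
    refine dimRank_odd_layer hr ?_
    rw [Nat.odd_iff, pow_succ] at h
    omega

/-! ### Finite width -/

theorem pow_two_pow_mem_D {g : Equiv.Perm Word} (hg : g ∈ GG) : ∀ k, g ^ 2 ^ k ∈ D (2 ^ k)
  | 0 => by rwa [pow_zero, pow_one, D_one]
  | k + 1 => by
    rw [pow_succ, pow_mul, mul_comm]
    exact sq_mem_D (pow_two_pow_mem_D hg k)

/-- The quotients by the terms of the dimension series are finite `2`-groups, and an element of all
the `N_m` fixes every word. -/
theorem residuallyP_GG : ResiduallyP GG 2 := by
  intro g hg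
  obtain ⟨w, hw⟩ : ∃ w, (g : Equiv.Perm Word) w ≠ w := by
    by_contra! h
    exact hg (Subtype.ext (Equiv.ext h))
  let m := w.length + 1
  refine ⟨dimSubgroup (ZMod 2) GG (2 ^ (m + 1) + 1), inferInstance, ?_, fun h => ?_⟩
  · let Q := GG ⧸ dimSubgroup (ZMod 2) GG (2 ^ (m + 1) + 1)
    have hfin : (dimSubgroup (ZMod 2) GG (2 ^ (m + 1) + 1)).index ≠ 0 := by
      have hH := (H_relIndex_ne_zero (2 ^ (m + 1) + 1)
        (Nat.succ_le_succ Nat.one_le_two_pow)).1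
      have hD := mt (Subgroup.relIndex_eq_zero_of_le_left ((H_le_N m).trans (D_eq_N m).ge)) hH
      rwa [Subgroup.relIndex, Subgroup.subgroupOf, D,
        Subgroup.comap_map_eq_self_of_injective GG.subtype_injective] at hD
    have hp : IsPGroup 2 Q := by
      rintro ⟨u⟩
      refine ⟨m + 2, (QuotientGroup.eq_one_iff (u ^ 2 ^ (m + 2))).2 ?_⟩
      have hle : 2 ^ (m + 1) + 1 ≤ 2 ^ (m + 2) := by
        have := Nat.one_le_two_pow (n := m + 1)
        rw [pow_succ _ (m + 1)]; omega
      obtain ⟨u', hu', e⟩ := D_antitone hle (pow_two_pow_mem_D u.2 (m + 2))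
      have e' : u' = u ^ 2 ^ (m + 2) := Subtype.ext e
      rwa [e'] at hu'
    have : Finite Q := Nat.finite_of_card_ne_zero hfin
    exact (IsPGroup.iff_card (p := 2)).1 hp
  · -- `N_{m+1}` fixes the words of length `< m`.
    have hN : (g : Equiv.Perm Word) ∈ N (m + 1) := D_eq_N m ▸ ⟨g, h, rfl⟩
    rw [← SetLike.mem_coe, coe_N] at hN
    obtain ⟨p, hp, q, hq, e⟩ := hN
    refine hw ?_
    rw [← e]
    change p (q w) = w
    rw [hq.1 w (Nat.lt_succ_self _), hp.1 w (by omega)]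

theorem finiteDWidth_GG : FiniteDWidth GG 2 := by
  refine ⟨residuallyP_GG, 3, fun n hn => ?_⟩
  obtain rfl | h : n = 1 ∨ 1 < n := by omega
  · exact dimRank_one.le
  · rcases Nat.even_or_odd n with h' | h'
    · rw [dimRank_even h h']; norm_cast
    · rw [dimRank_odd h h']; norm_cast

end Grigorchuk
end

open Grigorchuk in
theorem mainTheorem1 :
    (∀ m : ℕ, 1 ≤ m →
      D (2 ^ m + 1) = N m ∧
      (N m : Set (Equiv.Perm Word)) =
        (level K m : Set (Equiv.Perm Word)) * (level T (m - 1) : Set (Equiv.Perm Word)) ∧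
      ∃ φ : N m →* Multiplicative (V m × V (m - 1)), IsAlphaBeta m φ ∧
        ∀ r : ℕ, r ≤ 2 ^ m →
          (D (2 ^ m + 1 + r) : Set (Equiv.Perm Word)) =
            (N (m + 1) : Set (Equiv.Perm Word)) * alphaInv φ (VPow m r) *
              betaInv φ (VPow (m - 1) (r / 2))) ∧
    (dimRank (ZMod 2) GG 1 = 3 ∧
      (∀ i : ℕ, 1 < i → Even i → dimRank (ZMod 2) GG i = 2) ∧
      (∀ i : ℕ, 1 < i → Odd i → dimRank (ZMod 2) GG i = 1)) ∧
    FiniteDWidth GG 2 := by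
  refine ⟨fun m hm => ?_, ⟨dimRank_one, fun _ => dimRank_even, fun _ => dimRank_odd⟩,
    finiteDWidth_GG⟩
  obtain ⟨m, rfl⟩ : ∃ k, m = k + 1 := ⟨m - 1, by omega⟩
  exact ⟨D_eq_N m, coe_N _, alphaBeta m, isAlphaBeta m, fun _ hr => coe_D_eq hr⟩
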